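/- Theorem 5.1. Let $K$ be a field of characteristic $0$ containing all roots of unity (for every $n\ge 1$ it contains a primitive $n$-th root of unity). All quivers are finite. For a quiver $Q$, let $KQ^a$ be its path algebra and $J$ the ideal generated by the arrows; let $KQ^c$ be its path coalgebra, that is, the $K$-space with basis all paths of $Q$, with $\Delta(p)=\sum_{\beta\alpha=p}\beta\otimes\alpha$, and $\varepsilon(p)=1$ if $p$ has length $0$ and $\varepsilon(p)=0$ otherwise. For $d \ge 2$ let $C_d(Q)\subseteq KQ^c$ be the subcoalgebra with basis the paths of length less than $d$. For $n \ge 1$ let $Z_n$ be the basic cycle with vertices $e_0,\dots,e_{n-1}$ and exactly one arrow $e_i\to e_{i+1}$ for each $i$ (indices modulo $n$), and put $C_d(n)=C_d(Z_n)$. A $K$-algebra $A$ is *monomial* if $A\cong KQ^a/I$ for some quiver $Q$ and some ideal $I$ that is generated by paths and satisfies $J^N\subseteq I\subseteq J^2$ for some $N\ge 2$. A $K$-coalgebra is *monomial* if it is isomorphic to a subcoalgebra of some $KQ^c$ that contains all vertices and arrows of $Q$, is contained in $C_d(Q)$ for some $d\ge 2$, and has a basis consisting of paths. (i) Let $A$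 be a monomial algebra. Then $A$ admits a Hopf algebra structure (with the given algebra structure) if and only if, as an algebra, either $A\cong K\times\cdots\times K$ ($m\ge1$ factors, for some $m$), or $A\cong KZ_n^a/J^d\times\cdots\times KZ_n^a/J^d$ ($m\ge1$ equal factors, for some $m$) for some $n\ge1$ and some $d\ge2$ dividing $n$. (ii) Let $C$ be a monomial coalgebra. Then $C$ admits a Hopf algebra structure (with the given coalgebra structure) if and only if, as a coalgebra, either $C\cong K\oplus\cdots\oplus K$ ($m\ge1$ summands, for some $m$), or $C\cong C_d(n)\oplus\cdots\oplus C_d(n)$ ($m\ge1$ equal summands, for some $m$) for some $n\ge1$ and some $d\ge2$ dividing $n$. -/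

import Mathlib

open scoped TensorProduct

noncomputable section

universe u v

/-! ### Paths of a quiver -/

/-- A path of the quiver `V`, with its source `src` and target `tgt` (trivial paths included). -/
structure QPath (V : Type*) [Quiver V] where
  src : V
  tgt : V
  path : Quiver.Path src tgt

namespace QPath

variable {V : Type*} [Quiver V]

/-- The trivial path `e_v` at a vertex. -/
def vertex (v : V) : QPath V := ⟨v, v, Quiver.Path.nil⟩

/-- The path of length one given by an arrow. -/
def arrow {a b : V} (e : a ⟶ b) : QPath V := ⟨a, b, e.toPath⟩

/-- The length of a path. -/
def length (p : QPath V) : ℕ := p.path.length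

/-- All the factorisations `p = β α` of a path `p : a → b` (first `α`, then `β`), each listed
once, as triples `⟨x, α, β⟩` with `x = t(α) = s(β)`. -/
def splits {a : V} : {b : V} → Quiver.Path a b → List (Σ x : V, Quiver.Path a x × Quiver.Path x b)
  | _, .nil => [⟨a, .nil, .nil⟩]
  | _, .cons (c := c) p e =>
      ⟨c, p.cons e, .nil⟩ :: (splits p).map fun s => ⟨s.1, s.2.1, s.2.2.cons e⟩

theorem mem_splits {a b : V} (p : Quiver.Path a b)
    (s : Σ x : V, Quiver.Path a x × Quiver.Path x b) :
    s ∈ splits p ↔ s.2.1.comp s.2.2 = p := by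
  induction p with
  | nil =>
    obtain ⟨x, α, β⟩ := s
    rw [splits, List.mem_singleton]
    constructor
    · intro h
      cases h
      rfl
    · intro h
      cases β with
      | nil =>
        cases h
        rfl
      | cons β e => cases h
  | cons p e ih =>
    obtain ⟨x, α, β⟩ := s
    rw [splits, List.mem_cons, List.mem_map]
    constructor
    · rintro (h | ⟨⟨y, γ, δ⟩, hs, h⟩)
      · cases h
        rfl
      · cases h
        exact congrArg (fun q => Quiver.Path.cons q e) ((ih ⟨y, γ, δ⟩).1 hs)
    · intro h
      cases β with
      | nil =>
        cases h
        exact Or.inl rfl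
      | cons β f =>
        cases h
        exact Or.inr ⟨⟨x, α, β⟩, (ih ⟨x, α, β⟩).2 rfl, rfl⟩

theorem nodup_splits {a b : V} (p : Quiver.Path a b) : (splits p).Nodup := by
  induction p with
  | nil => simp [splits]
  | cons p e ih =>
    refine List.nodup_cons.2 ⟨?_, ih.map ?_⟩
    · intro h
      obtain ⟨⟨y, γ, δ⟩, -, h⟩ := List.mem_map.1 h
      simp only [Sigma.mk.injEq] at h
      obtain ⟨rfl, h⟩ := h
      simp at h
    · rintro ⟨y, γ, δ⟩ ⟨y', γ', δ'⟩ h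
      simp only [Sigma.mk.injEq] at h
      obtain ⟨rfl, h⟩ := h
      simpa using h

theorem splits_assoc {M : Type*} [AddCommMonoid M] {a b : V} (p : Quiver.Path a b)
    (F : ∀ x y : V, Quiver.Path a x → Quiver.Path x y → Quiver.Path y b → M) :
    ((splits p).map fun s => ((splits s.2.2).map fun t => F s.1 t.1 s.2.1 t.2.1 t.2.2).sum).sum =
      ((splits p).map fun s => ((splits s.2.1).map fun t => F t.1 s.1 t.2.1 t.2.2 s.2.2).sum).sum := by
  induction p with
  | nil => simp [splits]
  | cons p e ih =>
    have := ih fun x y α β γ => F x y α β (γ.cons e)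
    simp [splits, Function.comp_def, List.sum_map_add, this, add_assoc]

theorem splits_left {M : Type*} [AddCommMonoid M] {a b : V} (p : Quiver.Path a b)
    (F : ∀ x : V, Quiver.Path a x → Quiver.Path x b → M) :
    ((splits p).map fun s => if s.2.2.length = 0 then F s.1 s.2.1 s.2.2 else 0).sum =
      F b p .nil := by
  cases p with
  | nil => simp [splits]
  | cons p e => simp [splits, Function.comp_def]

theorem splits_right {M : Type*} [AddCommMonoid M] {a b : V} (p : Quiver.Path a b)
    (F : ∀ x : V, Quiver.Path a x → Quiver.Path x b → M) :
    ((splits p).map fun s => if s.2.1.length = 0 then F s.1 s.2.1 s.2.2 else 0).sum =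
      F a .nil p := by
  induction p with
  | nil => simp [splits]
  | cons p e ih =>
    have := ih fun x α β => F x α (β.cons e)
    simpa [splits, Function.comp_def] using this

end QPath

/-! ### The path algebra and its ideals -/

/-- The path algebra `KQ^a`: the `K`-space with basis the set of all paths. -/
def PathAlgebra (K V : Type*) [Field K] [Quiver V] : Type _ := QPath V →₀ K

namespace PathAlgebra

variable {K V : Type*} [Field K] [Quiver V]

instance : AddCommGroup (PathAlgebra K V) := inferInstanceAs (AddCommGroup (QPath V →₀ K))
instance : Module K (PathAlgebra K V) := inferInstanceAs (Module K (QPath V →₀ K))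

variable (K V) in
/-- The basis of `KQ^a` given by the paths. -/
def basis : Module.Basis (QPath V) K (PathAlgebra K V) :=
  ⟨LinearEquiv.refl K (QPath V →₀ K)⟩

variable (K) in
/-- The basis element of `KQ^a` given by a path. -/
def of (p : QPath V) : PathAlgebra K V := basis K V p

variable (K) in
open Classical in
/-- The product of two paths: `p q` is "first `q`, then `p`" if `t(q) = s(p)`, and `0` otherwise. -/
def pathMul (p q : QPath V) : PathAlgebra K V :=
  if h : q.tgt = p.src then of K ⟨q.src, p.tgt, q.path.comp (p.path.cast h.symm rfl)⟩ else 0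

/-- The bilinear extension of `pathMul`. -/
def mulHom : PathAlgebra K V →ₗ[K] PathAlgebra K V →ₗ[K] PathAlgebra K V :=
  (basis K V).constr K fun p => (basis K V).constr K fun q => pathMul K p q

theorem mulHom_of (p q : QPath V) : mulHom (of K p) (of K q) = pathMul K p q := by
  simp only [mulHom, of, Module.Basis.constr_basis]

theorem ind {P : PathAlgebra K V → Prop} (x : PathAlgebra K V) (h0 : P 0)
    (ha : ∀ x y, P x → P y → P (x + y)) (hs : ∀ (c : K) (p), P (c • of K p)) : P x := by
  have hx : x ∈ Submodule.span K (Set.range (basis K V)) := by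
    rw [(basis K V).span_eq]
    trivial
  have key : ∀ c : K, P (c • x) := by
    induction hx using Submodule.span_induction with
    | mem x h =>
      obtain ⟨p, rfl⟩ := h
      exact fun c => hs c p
    | zero => simpa using h0
    | add x y _ _ hx hy =>
      intro c
      rw [smul_add]
      exact ha _ _ (hx c) (hy c)
    | smul a x _ hx =>
      intro c
      rw [smul_smul]
      exact hx _
  simpa using key 1

theorem mulHom_assoc (x y z : PathAlgebra K V) :
    mulHom (mulHom x y) z = mulHom x (mulHom y z) := by
  induction x using ind with
  | h0 => simp
  | ha x x' h h' => simp only [map_add, LinearMap.add_apply, h, h']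
  | hs a p =>
  induction y using ind with
  | h0 => simp
  | ha x x' h h' => simp only [map_add, LinearMap.add_apply, h, h']
  | hs b q =>
  induction z using ind with
  | h0 => simp
  | ha x x' h h' => simp only [map_add, h, h']
  | hs c r =>
  simp only [map_smul, LinearMap.smul_apply, mulHom_of]
  congr 3
  obtain ⟨p₁, p₂, p⟩ := p
  obtain ⟨q₁, q₂, q⟩ := q
  obtain ⟨r₁, r₂, r⟩ := r
  by_cases h : q₂ = p₁ <;> by_cases h' : r₂ = q₁
  · subst h h'
    simp [pathMul, mulHom_of]
  · simp [pathMul, mulHom_of, h, h']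
  · simp [pathMul, mulHom_of, h, h']
  · simp [pathMul, h, h']

variable [Fintype V]

/-- The identity element is the sum of the vertices. -/
def unit : PathAlgebra K V := ∑ v : V, of K (QPath.vertex v)

theorem unit_mulHom (x : PathAlgebra K V) : mulHom unit x = x := by
  induction x using ind with
  | h0 => simp
  | ha x x' h h' => simp only [map_add, h, h']
  | hs a p =>
  obtain ⟨p₁, p₂, p⟩ := p
  simp only [unit, map_sum, LinearMap.sum_apply, map_smul, mulHom_of]
  rw [Finset.sum_eq_single p₂]
  · simp [pathMul, QPath.vertex]
  · intro b _ hb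
    simp [pathMul, QPath.vertex, hb.symm]
  · simp

theorem mulHom_unit (x : PathAlgebra K V) : mulHom x unit = x := by
  induction x using ind with
  | h0 => simp
  | ha x x' h h' => simp only [map_add, LinearMap.add_apply, h, h']
  | hs a p =>
  obtain ⟨p₁, p₂, p⟩ := p
  simp only [unit, map_sum, map_smul, LinearMap.smul_apply, mulHom_of]
  rw [Finset.sum_eq_single p₁]
  · simp [pathMul, QPath.vertex]
  · intro b _ hb
    simp [pathMul, QPath.vertex, hb]
  · simp

instance : Ring (PathAlgebra K V) :=
  { (inferInstance : AddCommGroup (PathAlgebra K V)) with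
    mul := fun x y => mulHom x y
    one := unit
    left_distrib := fun x y z => map_add (mulHom x) y z
    right_distrib := fun x y z => by
      change mulHom (x + y) z = mulHom x z + mulHom y z
      simp
    zero_mul := fun x => by
      change mulHom 0 x = 0
      simp
    mul_zero := fun x => map_zero (mulHom x)
    mul_assoc := mulHom_assoc
    one_mul := unit_mulHom
    mul_one := mulHom_unit }

instance : Algebra K (PathAlgebra K V) :=
  Algebra.ofModule
    (fun r x y => by
      change mulHom (r • x) y = r • mulHom x y
      simp)
    (fun r x y => map_smul (mulHom x) r y)

variable (K)

/-- The two-sided ideal of `KQ^a` generated by a set of paths. -/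
def pathIdeal (S : Set (QPath V)) : Ideal (PathAlgebra K V) :=
  (TwoSidedIdeal.span (of K '' S)).asIdeal

instance (S : Set (QPath V)) : (pathIdeal K S).IsTwoSided :=
  inferInstanceAs (TwoSidedIdeal.span (of K '' S)).asIdeal.IsTwoSided

variable (V) in
/-- The ideal `J` of `KQ^a` generated by the arrows. -/
def arrowIdeal : Ideal (PathAlgebra K V) :=
  pathIdeal K {p | ∃ (a b : V) (e : a ⟶ b), p = QPath.arrow e}

instance : (arrowIdeal K V).IsTwoSided := inferInstanceAs (pathIdeal K _).IsTwoSided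

end PathAlgebra

/-- An ideal `I` of `KQ^a` is admissible if `J^N ⊆ I ⊆ J^2` for some `N ≥ 2`. -/
def IsAdmissibleIdeal {K V : Type*} [Field K] [Quiver V] [Fintype V]
    (I : Ideal (PathAlgebra K V)) : Prop :=
  ∃ N : ℕ, 2 ≤ N ∧ PathAlgebra.arrowIdeal K V ^ N ≤ I ∧ I ≤ PathAlgebra.arrowIdeal K V ^ 2

/-- `A` is a monomial algebra: `A ≅ KQ^a / I` for a finite quiver `Q` and an admissible ideal `I`
generated by paths. -/
def IsMonomialAlgebra (K A : Type*) [Field K] [Ring A] [Algebra K A] : Prop :=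
  ∃ (V : Type) (_ : Fintype V) (_ : Quiver.{0} V) (_ : ∀ a b : V, Finite (a ⟶ b))
    (S : Set (QPath V)),
    IsAdmissibleIdeal (PathAlgebra.pathIdeal K S) ∧
      Nonempty (A ≃ₐ[K] (PathAlgebra K V ⧸ PathAlgebra.pathIdeal K S))

/-! ### The path coalgebra -/

/-- The path coalgebra `KQ^c`: the `K`-space with basis the set of all paths. -/
def PathCoalgebra (K V : Type*) [Field K] [Quiver V] : Type _ := QPath V →₀ K

namespace PathCoalgebra

variable {K V : Type*} [Field K] [Quiver V]

instance : AddCommGroup (PathCoalgebra K V) := inferInstanceAs (AddCommGroup (QPath V →₀ K))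
instance : Module K (PathCoalgebra K V) := inferInstanceAs (Module K (QPath V →₀ K))

variable (K V) in
/-- The basis of `KQ^c` given by the paths. -/
def basis : Module.Basis (QPath V) K (PathCoalgebra K V) :=
  ⟨LinearEquiv.refl K (QPath V →₀ K)⟩

variable (K) in
/-- The basis element of `KQ^c` given by a path. -/
def of (p : QPath V) : PathCoalgebra K V := basis K V p

/-- `Δ(p) = ∑_{β α = p} β ⊗ α`, and `ε(p)` is `1` if `p` is a vertex and `0` otherwise. -/
instance : CoalgebraStruct K (PathCoalgebra K V) where
  comul := (basis K V).constr K fun p =>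
    ((QPath.splits p.path).map fun s => of K ⟨s.1, p.tgt, s.2.2⟩ ⊗ₜ[K] of K ⟨p.src, s.1, s.2.1⟩).sum
  counit := (basis K V).constr K fun p => if p.length = 0 then 1 else 0

theorem comul_of (p : QPath V) :
    Coalgebra.comul (R := K) (of K p) =
      ((QPath.splits p.path).map fun s =>
        of K ⟨s.1, p.tgt, s.2.2⟩ ⊗ₜ[K] of K ⟨p.src, s.1, s.2.1⟩).sum :=
  (basis K V).constr_basis K _ p

theorem counit_of (p : QPath V) :
    Coalgebra.counit (R := K) (of K p) = if p.length = 0 then (1 : K) else 0 :=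
  (basis K V).constr_basis K _ p

theorem list_sum_tmul {M N ι : Type*} [AddCommGroup M] [Module K M] [AddCommGroup N] [Module K N]
    (l : List ι) (f : ι → M) (n : N) :
    (l.map f).sum ⊗ₜ[K] n = (l.map fun i => f i ⊗ₜ[K] n).sum := by
  induction l with
  | nil => simp
  | cons a l ih => simp [TensorProduct.add_tmul, ih]

theorem tmul_list_sum {M N ι : Type*} [AddCommGroup M] [Module K M] [AddCommGroup N] [Module K N]
    (l : List ι) (f : ι → N) (m : M) :
    m ⊗ₜ[K] (l.map f).sum = (l.map fun i => m ⊗ₜ[K] f i).sum := by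
  induction l with
  | nil => simp
  | cons a l ih => simp [TensorProduct.tmul_add, ih]

instance : Coalgebra K (PathCoalgebra K V) where
  coassoc := (basis K V).ext fun p => by
    change TensorProduct.assoc K _ _ _ (Coalgebra.comul.rTensor _ (Coalgebra.comul (of K p))) =
      Coalgebra.comul.lTensor _ (Coalgebra.comul (of K p))
    simp only [comul_of, map_list_sum, List.map_map, Function.comp_def, LinearMap.rTensor_tmul,
      LinearMap.lTensor_tmul, list_sum_tmul, tmul_list_sum, TensorProduct.assoc_tmul]
    exact QPath.splits_assoc p.path fun x y α β γ =>
      of K ⟨y, p.tgt, γ⟩ ⊗ₜ[K] (of K ⟨x, y, β⟩ ⊗ₜ[K] of K ⟨p.src, x, α⟩)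
  rTensor_counit_comp_comul := (basis K V).ext fun p => by
    change Coalgebra.counit.rTensor _ (Coalgebra.comul (of K p)) = (1 : K) ⊗ₜ[K] of K p
    simp only [comul_of, map_list_sum, List.map_map, Function.comp_def, LinearMap.rTensor_tmul,
      counit_of]
    refine Eq.trans ?_ (QPath.splits_left p.path fun x α β => (1 : K) ⊗ₜ[K] of K ⟨p.src, x, α⟩)
    congr 2 with s
    change (if s.2.2.length = 0 then (1 : K) else 0) ⊗ₜ[K] _ = _
    split_ifs <;> simp
  lTensor_counit_comp_comul := (basis K V).ext fun p => by
    change Coalgebra.counit.lTensor _ (Coalgebra.comul (of K p)) = of K p ⊗ₜ[K] (1 : K)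
    simp only [comul_of, map_list_sum, List.map_map, Function.comp_def, LinearMap.lTensor_tmul,
      counit_of]
    refine Eq.trans ?_ (QPath.splits_right p.path fun x α β => of K ⟨x, p.tgt, β⟩ ⊗ₜ[K] (1 : K))
    congr 2 with s
    change _ ⊗ₜ[K] (if s.2.1.length = 0 then (1 : K) else 0) = _
    split_ifs <;> simp

end PathCoalgebra

/-! ### Subcoalgebras -/

/-- A subcoalgebra of a `K`-coalgebra `C`: a subspace `D` with `Δ(D) ⊆ D ⊗ D`. -/
structure Subcoalgebra (K C : Type*) [Field K] [AddCommGroup C] [Module K C] [Coalgebra K C]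
    extends Submodule K C where
  comul_mem : ∀ x ∈ toSubmodule, Coalgebra.comul (R := K) x ∈
    LinearMap.range (TensorProduct.map toSubmodule.subtype toSubmodule.subtype)

namespace Subcoalgebra

variable {K C : Type*} [Field K] [AddCommGroup C] [Module K C] [Coalgebra K C]

/-- The inclusion `D ⊗ D → C ⊗ C`, which is injective. -/
def inclTensor (D : Subcoalgebra K C) :
    D.toSubmodule ⊗[K] D.toSubmodule →ₗ[K] C ⊗[K] C :=
  TensorProduct.map D.toSubmodule.subtype D.toSubmodule.subtype

theorem inclTensor_injective (D : Subcoalgebra K C) : Function.Injective D.inclTensor :=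
  TensorProduct.map_injective_of_flat_flat _ _ D.toSubmodule.injective_subtype
    D.toSubmodule.injective_subtype

/-- The restriction of the comultiplication and of the counit to a subcoalgebra. -/
instance (D : Subcoalgebra K C) : CoalgebraStruct K D.toSubmodule where
  comul := (LinearEquiv.ofInjective D.inclTensor D.inclTensor_injective).symm.toLinearMap ∘ₗ
    (Coalgebra.comul ∘ₗ D.toSubmodule.subtype).codRestrict (LinearMap.range D.inclTensor)
      fun x => D.comul_mem x x.2
  counit := Coalgebra.counit ∘ₗ D.toSubmodule.subtype

theorem inclTensor_comul (D : Subcoalgebra K C) (x : D.toSubmodule) :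
    D.inclTensor (Coalgebra.comul (R := K) x) = Coalgebra.comul (R := K) (x : C) :=
  congrArg Subtype.val (LinearEquiv.apply_symm_apply
    (LinearEquiv.ofInjective D.inclTensor D.inclTensor_injective) _)

theorem inclTensor_comp_comul (D : Subcoalgebra K C) :
    D.inclTensor ∘ₗ (Coalgebra.comul (R := K) (A := D.toSubmodule)) =
      Coalgebra.comul (R := K) ∘ₗ D.toSubmodule.subtype :=
  LinearMap.ext D.inclTensor_comul

theorem counit_coe (D : Subcoalgebra K C) :
    (Coalgebra.counit (R := K) (A := D.toSubmodule)) =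
      Coalgebra.counit (R := K) ∘ₗ D.toSubmodule.subtype := rfl

instance (D : Subcoalgebra K C) : Coalgebra K D.toSubmodule where
  coassoc := by
    set i := D.toSubmodule.subtype with hi
    have hinj : Function.Injective (TensorProduct.map i D.inclTensor) :=
      TensorProduct.map_injective_of_flat_flat _ _ D.toSubmodule.injective_subtype
        D.inclTensor_injective
    refine LinearMap.ext fun x => hinj ?_
    have h1 : TensorProduct.map i D.inclTensor ∘ₗ
        (TensorProduct.assoc K D.toSubmodule D.toSubmodule D.toSubmodule).toLinearMap =
        (TensorProduct.assoc K C C C).toLinearMap ∘ₗ TensorProduct.map D.inclTensor i :=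
      TensorProduct.ext_threefold fun a b c => rfl
    have h2 : TensorProduct.map D.inclTensor i ∘ₗ
        Coalgebra.comul.rTensor D.toSubmodule =
        Coalgebra.comul.rTensor C ∘ₗ D.inclTensor := by
      rw [LinearMap.rTensor, LinearMap.rTensor, inclTensor, ← TensorProduct.map_comp,
        ← TensorProduct.map_comp, ← inclTensor, inclTensor_comp_comul]
      rfl
    have h3 : TensorProduct.map i D.inclTensor ∘ₗ
        Coalgebra.comul.lTensor D.toSubmodule =
        Coalgebra.comul.lTensor C ∘ₗ D.inclTensor := by
      rw [LinearMap.lTensor, LinearMap.lTensor, inclTensor, ← TensorProduct.map_comp,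
        ← TensorProduct.map_comp, ← inclTensor, inclTensor_comp_comul]
      rfl
    calc TensorProduct.map i D.inclTensor (TensorProduct.assoc K _ _ _
          (Coalgebra.comul.rTensor _ (Coalgebra.comul x)))
        = TensorProduct.assoc K _ _ _ (Coalgebra.comul.rTensor _
            (D.inclTensor (Coalgebra.comul x))) := by
          rw [← LinearMap.comp_apply (Coalgebra.comul.rTensor C), ← h2]
          exact LinearMap.congr_fun h1 _
      _ = Coalgebra.comul.lTensor _ (D.inclTensor (Coalgebra.comul x)) := by
          rw [inclTensor_comul, Coalgebra.coassoc_apply]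
      _ = _ := (LinearMap.congr_fun h3 _).symm
  rTensor_counit_comp_comul := by
    have hinj : Function.Injective (D.toSubmodule.subtype.lTensor K) :=
      Module.Flat.lTensor_preserves_injective_linearMap _ D.toSubmodule.injective_subtype
    refine LinearMap.ext fun x => hinj ?_
    have h : D.toSubmodule.subtype.lTensor K ∘ₗ Coalgebra.counit.rTensor D.toSubmodule =
        Coalgebra.counit.rTensor C ∘ₗ D.inclTensor :=
      TensorProduct.ext' fun a b => rfl
    refine (LinearMap.congr_fun h _).trans ?_
    rw [LinearMap.comp_apply, inclTensor_comul, Coalgebra.rTensor_counit_comul]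
    rfl
  lTensor_counit_comp_comul := by
    have hinj : Function.Injective (D.toSubmodule.subtype.rTensor K) :=
      Module.Flat.rTensor_preserves_injective_linearMap _ D.toSubmodule.injective_subtype
    refine LinearMap.ext fun x => hinj ?_
    have h : D.toSubmodule.subtype.rTensor K ∘ₗ Coalgebra.counit.lTensor D.toSubmodule =
        Coalgebra.counit.lTensor C ∘ₗ D.inclTensor :=
      TensorProduct.ext' fun a b => rfl
    refine (LinearMap.congr_fun h _).trans ?_
    rw [LinearMap.comp_apply, inclTensor_comul, Coalgebra.lTensor_counit_comul]
    rfl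

end Subcoalgebra

namespace PathCoalgebra

variable (K V : Type*) [Field K] [Quiver V]

/-- The subcoalgebra `C_d(Q)` of `KQ^c` with basis the paths of length `< d`. -/
def truncated (d : ℕ) : Subcoalgebra K (PathCoalgebra K V) where
  toSubmodule := Submodule.span K (of K '' {p | p.length < d})
  comul_mem x hx := by
    refine (Submodule.span_le (p := Submodule.comap Coalgebra.comul (LinearMap.range _))).2 ?_ hx
    rintro _ ⟨p, hp, rfl⟩
    change Coalgebra.comul (of K p) ∈ LinearMap.range _
    rw [comul_of]
    refine list_sum_mem fun t ht => ?_
    obtain ⟨s, hs, rfl⟩ := List.mem_map.1 ht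
    have hlen := congrArg Quiver.Path.length ((QPath.mem_splits _ _).1 hs)
    rw [Quiver.Path.length_comp] at hlen
    have hp : p.path.length < d := hp
    refine ⟨⟨_, Submodule.subset_span ⟨_, ?_, rfl⟩⟩ ⊗ₜ ⟨_, Submodule.subset_span ⟨_, ?_, rfl⟩⟩, rfl⟩
    · change s.2.2.length < d
      omega
    · change s.2.1.length < d
      omega

end PathCoalgebra

/-- A subcoalgebra `C` of `KQ^c` is monomial if it contains all vertices and arrows of `Q`, is
contained in `C_d(Q)` for some `d ≥ 2`, and has a basis consisting of paths. -/
def Subcoalgebra.IsMonomial {K V : Type*} [Field K] [Quiver V]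
    (C : Subcoalgebra K (PathCoalgebra K V)) : Prop :=
  (∀ v : V, PathCoalgebra.of K (QPath.vertex v) ∈ C.toSubmodule) ∧
  (∀ (a b : V) (e : a ⟶ b), PathCoalgebra.of K (QPath.arrow e) ∈ C.toSubmodule) ∧
  (∃ d : ℕ, 2 ≤ d ∧ C.toSubmodule ≤ (PathCoalgebra.truncated K V d).toSubmodule) ∧
  (∃ S : Set (QPath V), C.toSubmodule = Submodule.span K (PathCoalgebra.of K '' S))

/-- `C` is a monomial coalgebra: it is isomorphic to a monomial subcoalgebra of the path coalgebra
of a finite quiver. -/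
def IsMonomialCoalgebra (K C : Type*) [Field K] [AddCommGroup C] [Module K C] [Coalgebra K C] :
    Prop :=
  ∃ (V : Type) (_ : Fintype V) (_ : Quiver.{0} V) (_ : ∀ a b : V, Finite (a ⟶ b))
    (D : Subcoalgebra K (PathCoalgebra K V)),
    D.IsMonomial ∧ Nonempty (C ≃ₗc[K] D.toSubmodule)

/-! ### Basic cycles -/

/-- The vertices `e_0, …, e_{n-1}` of the basic cycle `Z_n`, with indices modulo `n`. -/
def BasicCycle (n : ℕ) : Type := ZMod n

namespace BasicCycle

instance (n : ℕ) [NeZero n] : Fintype (BasicCycle n) := inferInstanceAs (Fintype (ZMod n))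

/-- In `Z_n` there is a unique arrow from `e_i` to `e_{i+1}` for each `i`, and no other arrow. -/
instance (n : ℕ) : Quiver.{0} (BasicCycle n) where
  Hom i j := PLift ((show ZMod n from j) = (show ZMod n from i) + 1)

end BasicCycle

/-- The algebra `KZ_n^a / J^d`. -/
abbrev CycleAlgebra (K : Type*) [Field K] (n d : ℕ) [NeZero n] : Type _ :=
  PathAlgebra K (BasicCycle n) ⧸ PathAlgebra.arrowIdeal K (BasicCycle n) ^ d

/-- The coalgebra `C_d(n)`: the subcoalgebra of `KZ_n^c` with basis the paths of length `< d`. -/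
abbrev CycleCoalgebra (K : Type*) [Field K] (n d : ℕ) : Type _ :=
  (PathCoalgebra.truncated K (BasicCycle n) d).toSubmodule

/-! ### Hopf structures -/

/-- The algebra `A` admits a Hopf algebra structure: there is a Hopf algebra structure on `A`
whose underlying algebra is the given one. -/
def Algebra.AdmitsHopf (K A : Type*) [Field K] [Ring A] [alg : Algebra K A] : Prop :=
  ∃ H : HopfAlgebra K A, H.toBialgebra.toAlgebra = alg

/-- The coalgebra `C` admits a Hopf algebra structure: it is isomorphic, as a coalgebra, to (the
underlying coalgebra of) a Hopf algebra. By transport of structure this is the same as a Hopf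
algebra structure on the space `C` itself with the given comultiplication and counit. -/
def Coalgebra.AdmitsHopf (K : Type u) (C : Type v) [Field K] [AddCommGroup C] [Module K C]
    [Coalgebra K C] : Prop :=
  ∃ (H : Type v) (_ : Ring H) (_ : HopfAlgebra K H), Nonempty (C ≃ₗc[K] H)

end

/-! Everything is reduced to coalgebras. A finite-dimensional coalgebra `C` and its convolution
algebra `C → K` determine one another, and a Hopf structure on the algebra transposes to one on `C`
(`admitsHopf_of_convEquiv`). Since an ideal generated by paths is spanned by the paths it contains,
a monomial algebra is the convolution algebra of the monomial coalgebra spanned by the surviving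
paths. So (i) follows from (ii) together with explicit Hopf algebras.

Existence. On `KZ_n/J^d` the vertices are made to behave like the indicator functions on `ZMod n`. A
character `χ` with `χ 1` a primitive `d`-th root of unity, available because `d ∣ n`, gives a
group-like element `k`, and the sum `X` of the arrows is given `Δ(X) = X ⊗ k + 1 ⊗ X`. The two
summands `q`-commute with `q = χ 1`, so `Δ(X)^d = 0` by the `q`-binomial theorem, as required by
`X^d = 0`. Several equal factors arise by tensoring with the Hopf algebra `K^m`.

Necessity. Let `H` be a Hopf algebra with a finite basis `T` of paths of a quiver. Its group-like
elements are the vertices, so the vertices form a group. The coordinate of a maximal path is an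
integral up to translation by a vertex; integrals are unique up to a scalar, so maximal paths with
the same target agree, and counting gives the same for sources. Hence at most one arrow leaves each
vertex. Translating skew-primitive elements by vertices shows that, if there is an arrow at all, the
arrows are exactly `v ⟶ v * a` for one central `a`: the quiver is a union of cycles of length
`orderOf a`, one for each coset of `⟨a⟩`.

It remains to find `T`. Averaging the coordinate of an arrow gives a left invariant functional `ξ`
that vanishes on vertices but not on arrows; right translation of arrows by vertices rescales `ξ` by
a character `χ`. Convolution powers of `ξ` detect path length, and their invariance forces `T` to be
all paths of length less than some `d`. Evaluating `ξ ^ d = 0` on a product of paths of lengths `i +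
j = d` gives `(d choose i)_q = 0` with `q = χ a` (`IsArrowForm.pow_apply_mul`). In characteristic
zero these equations say that `q` is a primitive `d`-th root of unity, and then `d ∣ orderOf a`. -/

noncomputable section

universe u v

open Coalgebra WithConv

/-! ### Duality between finite-dimensional algebras and coalgebras -/

section Duality

variable {K : Type u} [Field K]

/-- The coordinates in a tensor product basis are products of coordinate functionals of the two
factors, so functionals of the form `f ⊗ g` already separate points. -/
theorem tensor_ext_functional {C D : Type*} [AddCommGroup C] [Module K C] [AddCommGroup D]
    [Module K D] {z w : C ⊗[K] D}
    (h : ∀ (f : C →ₗ[K] K) (g : D →ₗ[K] K), LinearMap.mul' K K (TensorProduct.map f g z) =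
      LinearMap.mul' K K (TensorProduct.map f g w)) : z = w := by
  let b := Module.Basis.ofVectorSpace K C
  let b' := Module.Basis.ofVectorSpace K D
  refine (b.tensorProduct b').ext_elem fun i => ?_
  have key : ∀ x : C ⊗[K] D, (b.tensorProduct b').repr x i =
      LinearMap.mul' K K (TensorProduct.map (b.coord i.1) (b'.coord i.2) x) := by
    intro x
    induction x with
    | zero => simp
    | add x y hx hy => simp only [map_add, Finsupp.add_apply, hx, hy]
    | tmul x y =>
      rw [Module.Basis.tensorProduct_repr_tmul_apply]
      simp [mul_comm]
  rw [key, key, h]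

/-- The linear equivalence of `C` with the dual of `A` given by an isomorphism of `A` with the
convolution algebra of `C`. -/
def dualOfConvEquiv {A C : Type*} [AddCommGroup A] [Module K A] [AddCommGroup C] [Module K C]
    [FiniteDimensional K C] (θ : A ≃ₗ[K] WithConv (C →ₗ[K] K)) :
    C ≃ₗ[K] WithConv (A →ₗ[K] K) :=
  (Module.evalEquiv K C).trans
    (((θ.trans (WithConv.linearEquiv K (C →ₗ[K] K))).dualMap).trans
      (WithConv.linearEquiv K (A →ₗ[K] K)).symm)

theorem dualOfConvEquiv_apply {A C : Type*} [AddCommGroup A] [Module K A] [AddCommGroup C]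
    [Module K C] [FiniteDimensional K C] (θ : A ≃ₗ[K] WithConv (C →ₗ[K] K)) (c : C) (a : A) :
    (dualOfConvEquiv θ c).ofConv a = (θ a).ofConv c := rfl

variable {A : Type*} [Ring A] [HopfAlgebra K A] {C : Type v} [AddCommGroup C] [Module K C]
  [Coalgebra K C] (θ : A ≃ₐ[K] WithConv (C →ₗ[K] K))

theorem convEquiv_surjective (f : C →ₗ[K] K) : ∃ a, (θ a).ofConv = f :=
  ⟨θ.symm (toConv f), by simp⟩

theorem convEquiv_mul (a b : A) (c : C) : (θ (a * b)).ofConv c =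
    LinearMap.mul' K K (TensorProduct.map (θ a).ofConv (θ b).ofConv (comul (R := K) c)) := by
  rw [map_mul]
  rfl

theorem convEquiv_mul_repr (a b : A) {c : C} {ι : Type*} (r : Coalgebra.Repr K c ι) :
    (θ (a * b)).ofConv c =
      ∑ i ∈ r.index, (θ a).ofConv (r.left i) * (θ b).ofConv (r.right i) := by
  rw [map_mul, r.convMul_apply]

theorem convEquiv_one (c : C) : (θ 1).ofConv c = counit (R := K) c := by
  rw [map_one]
  rfl

variable [FiniteDimensional K C]

/-- The ring structure on the dual `C` of a Hopf algebra `A`. -/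
abbrev dualRing : Ring C :=
  let φ := dualOfConvEquiv θ.toLinearEquiv
  { (inferInstance : AddCommGroup C) with
    mul := fun x y => φ.symm (φ x * φ y)
    one := φ.symm 1
    left_distrib := fun x y z => by
      change φ.symm (φ x * φ (y + z)) = φ.symm (φ x * φ y) + φ.symm (φ x * φ z)
      simp [mul_add]
    right_distrib := fun x y z => by
      change φ.symm (φ (x + y) * φ z) = φ.symm (φ x * φ z) + φ.symm (φ y * φ z)
      simp [add_mul]
    zero_mul := fun x => by
      change φ.symm (φ 0 * φ x) = 0
      simp
    mul_zero := fun x => by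
      change φ.symm (φ x * φ 0) = 0
      simp
    mul_assoc := fun x y z => by
      change φ.symm (φ (φ.symm (φ x * φ y)) * φ z) = φ.symm (φ x * φ (φ.symm (φ y * φ z)))
      simp [mul_assoc]
    one_mul := fun x => by
      change φ.symm (φ (φ.symm 1) * φ x) = x
      simp
    mul_one := fun x => by
      change φ.symm (φ x * φ (φ.symm 1)) = x
      simp }

/-- The algebra structure on the dual `C` of a Hopf algebra `A`. -/
abbrev dualAlgebra : letI := dualRing θ; Algebra K C :=
  let _ := dualRing θ
  let φ := dualOfConvEquiv θ.toLinearEquiv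
  Algebra.ofModule
    (fun r x y => by
      change φ.symm (φ (r • x) * φ y) = r • φ.symm (φ x * φ y)
      simp)
    (fun r x y => by
      change φ.symm (φ x * φ (r • y)) = r • φ.symm (φ x * φ y)
      simp)

theorem dualRing_mul_apply (x y : C) (a : A) :
    (θ a).ofConv (letI := dualRing θ; x * y) =
      LinearMap.mul' K K (TensorProduct.map (dualOfConvEquiv θ.toLinearEquiv x).ofConv
        (dualOfConvEquiv θ.toLinearEquiv y).ofConv (comul (R := K) a)) := by
  let φ := dualOfConvEquiv θ.toLinearEquiv
  change (φ (φ.symm (φ x * φ y))).ofConv a = _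
  rw [LinearEquiv.apply_symm_apply]
  rfl

theorem dualRing_one_apply (a : A) :
    (θ a).ofConv (letI := dualRing θ; (1 : C)) = counit (R := K) a := by
  let φ := dualOfConvEquiv θ.toLinearEquiv
  change (φ (φ.symm 1)).ofConv a = _
  rw [LinearEquiv.apply_symm_apply]
  rfl

theorem convEquiv_ext {x y : C} (h : ∀ a, (θ a).ofConv x = (θ a).ofConv y) : x = y := by
  refine (dualOfConvEquiv θ.toLinearEquiv).injective (WithConv.ext (LinearMap.ext h))

/-- A finite-dimensional coalgebra whose convolution algebra is a Hopf algebra admits a Hopf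
algebra structure. -/
theorem admitsHopf_of_convEquiv (θ : A ≃ₐ[K] WithConv (C →ₗ[K] K)) :
    Coalgebra.AdmitsHopf K C := by
  let _ := dualRing θ
  let _ := dualAlgebra θ
  have hmul : ∀ (x y : C) (a : A) {ι : Type _} (r : Coalgebra.Repr K a ι), (θ a).ofConv (x * y) =
      ∑ i ∈ r.index, (θ (r.left i)).ofConv x * (θ (r.right i)).ofConv y := by
    intro x y a ι r
    rw [dualRing_mul_apply, ← r.eq]
    simp [dualOfConvEquiv_apply]
  have hone := dualRing_one_apply θ
  have htest : ∀ {z w : C ⊗[K] C}, (∀ a b : A,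
      LinearMap.mul' K K (TensorProduct.map (θ a).ofConv (θ b).ofConv z) =
        LinearMap.mul' K K (TensorProduct.map (θ a).ofConv (θ b).ofConv w)) → z = w := by
    intro z w h
    refine tensor_ext_functional fun f g => ?_
    obtain ⟨a, rfl⟩ := convEquiv_surjective θ f
    obtain ⟨b, rfl⟩ := convEquiv_surjective θ g
    exact h a b
  -- The pairing of `A ⊗ A` with `C ⊗ C` turns the product on the second into the coproducts of the
  -- two arguments from `A`.
  have hprod : ∀ (z w : C ⊗[K] C) (a b : A) {ι κ : Type _} (r : Coalgebra.Repr K a ι)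
      (s : Coalgebra.Repr K b κ),
      LinearMap.mul' K K (TensorProduct.map (θ a).ofConv (θ b).ofConv (z * w)) =
        ∑ i ∈ r.index, ∑ j ∈ s.index,
          LinearMap.mul' K K (TensorProduct.map (θ (r.left i)).ofConv (θ (s.left j)).ofConv z) *
          LinearMap.mul' K K
            (TensorProduct.map (θ (r.right i)).ofConv (θ (s.right j)).ofConv w) := by
    intro z w a b ι κ r s
    induction z with
    | zero => simp
    | add x y hx hy => simp only [add_mul, map_add, hx, hy, Finset.sum_add_distrib]
    | tmul x y =>
    induction w with
    | zero => simp
    | add x y hx hy => simp only [mul_add, map_add, hx, hy, Finset.sum_add_distrib]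
    | tmul x' y' =>
    simp only [Algebra.TensorProduct.tmul_mul_tmul, TensorProduct.map_tmul,
      LinearMap.mul'_apply, hmul _ _ _ r, hmul _ _ _ s]
    rw [Finset.sum_mul_sum]
    refine Finset.sum_congr rfl fun i _ => Finset.sum_congr rfl fun j _ => by ring
  -- Each bialgebra axiom for `C` is the transpose of one for `A`: multiplicativity of the counit of
  -- `C` comes from `Δ(1) = 1 ⊗ 1` in `A`, the value `Δ(1)` in `C` from multiplicativity of the
  -- counit of `A`, and the other two axioms are self-dual.
  let B : Bialgebra K C := Bialgebra.mk' K C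
    (by
      rw [← convEquiv_one θ, hone, Bialgebra.counit_one])
    (by
      intro x y
      rw [← convEquiv_one θ, ← convEquiv_one θ, ← convEquiv_one θ,
        dualRing_mul_apply, Bialgebra.comul_one, Algebra.TensorProduct.one_def]
      simp [dualOfConvEquiv_apply])
    (by
      refine htest fun a b => ?_
      rw [← convEquiv_mul, hone, Algebra.TensorProduct.one_def]
      simp [hone])
    (by
      intro x y
      refine htest fun a b => ?_
      rw [← convEquiv_mul, hprod _ _ _ _ (ℛ K a) (ℛ K b), dualRing_mul_apply,
        Bialgebra.comul_mul, ← (ℛ K a).eq, ← (ℛ K b).eq]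
      simp only [Finset.sum_mul_sum, map_sum, Algebra.TensorProduct.tmul_mul_tmul,
        TensorProduct.map_tmul, LinearMap.mul'_apply, dualOfConvEquiv_apply,
        AlgEquiv.toLinearEquiv_apply,
        convEquiv_mul])
  let φ := dualOfConvEquiv θ.toLinearEquiv
  -- The antipode of `C` is the transpose of the antipode of `A`.
  let S : C →ₗ[K] C := φ.symm.toLinearMap ∘ₗ (WithConv.linearEquiv K _).symm.toLinearMap ∘ₗ
    (LinearMap.lcomp K K (HopfAlgebra.antipode K (A := A))) ∘ₗ
    (WithConv.linearEquiv K _).toLinearMap ∘ₗ φ.toLinearMap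
  have hS : ∀ (c : C) (a : A), (θ a).ofConv (S c) = (θ (HopfAlgebra.antipode K a)).ofConv c := by
    intro c a
    change (φ (φ.symm _)).ofConv a = _
    rw [LinearEquiv.apply_symm_apply]
    rfl
  let H : HopfAlgebra K C :=
    { B with
      antipode := S
      mul_antipode_rTensor_comul := by
        refine LinearMap.ext fun c => convEquiv_ext θ fun a => ?_
        have e1 := (ℛ K a)
        change (θ a).ofConv (LinearMap.mul' K C (S.rTensor C (comul c))) =
          (θ a).ofConv (algebraMap K C (counit c))
        rw [Algebra.algebraMap_eq_smul_one, map_smul, hone, ← (ℛ K c).eq]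
        simp only [map_sum, LinearMap.rTensor_tmul, LinearMap.mul'_apply, hmul _ _ _ (ℛ K a), hS]
        rw [Finset.sum_comm]
        simp only [← convEquiv_mul_repr]
        rw [← LinearMap.sum_apply, ← WithConv.ofConv_sum, ← map_sum,
          HopfAlgebra.sum_antipode_mul_eq_smul, map_smul, WithConv.ofConv_smul,
          LinearMap.smul_apply, convEquiv_one]
        simp [mul_comm]
      mul_antipode_lTensor_comul := by
        refine LinearMap.ext fun c => convEquiv_ext θ fun a => ?_
        change (θ a).ofConv (LinearMap.mul' K C (S.lTensor C (comul c))) =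
          (θ a).ofConv (algebraMap K C (counit c))
        rw [Algebra.algebraMap_eq_smul_one, map_smul, hone, ← (ℛ K c).eq]
        simp only [map_sum, LinearMap.lTensor_tmul, LinearMap.mul'_apply, hmul _ _ _ (ℛ K a), hS]
        rw [Finset.sum_comm]
        simp only [← convEquiv_mul_repr]
        rw [← LinearMap.sum_apply, ← WithConv.ofConv_sum, ← map_sum,
          HopfAlgebra.sum_mul_antipode_eq_smul, map_smul, WithConv.ofConv_smul,
          LinearMap.smul_apply, convEquiv_one]
        simp [mul_comm] }
  exact ⟨C, inferInstance, H, ⟨CoalgEquiv.refl K C⟩⟩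

end Duality

/-! ### Functoriality of the convolution algebra -/

section ConvFunctor

variable {K : Type*} [Field K]

/-- Isomorphic coalgebras have isomorphic convolution algebras. -/
def convCongr {C C' : Type*} [AddCommGroup C] [Module K C] [Coalgebra K C] [AddCommGroup C']
    [Module K C'] [Coalgebra K C'] (e : C ≃ₗc[K] C') :
    WithConv (C' →ₗ[K] K) ≃ₐ[K] WithConv (C →ₗ[K] K) :=
  AlgEquiv.ofLinearEquiv
    (WithConv.congrLinearEquiv (e.toLinearEquiv.dualMap : (C' →ₗ[K] K) ≃ₗ[K] (C →ₗ[K] K)))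
    (WithConv.ext <| LinearMap.ext fun x => by
      change counit (R := K) (e x) = counit (R := K) x
      simp)
    (fun f g => WithConv.ext <| LinearMap.ext fun x => by
      change LinearMap.mul' K K (TensorProduct.map f.ofConv g.ofConv (comul (R := K) (e x))) =
        LinearMap.mul' K K (TensorProduct.map (f.ofConv ∘ₗ e.toLinearEquiv.toLinearMap)
          (g.ofConv ∘ₗ e.toLinearEquiv.toLinearMap) (comul (R := K) x))
      rw [TensorProduct.map_comp, ← CoalgHomClass.map_comp_comul_apply]
      rfl)

/-- The convolution algebra of a finite direct sum of coalgebras. -/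
def convPi {ι : Type*} [Fintype ι] [DecidableEq ι] (C : ι → Type*) [∀ i, AddCommGroup (C i)]
    [∀ i, Module K (C i)] [∀ i, Coalgebra K (C i)] :
    WithConv ((∀ i, C i) →ₗ[K] K) ≃ₐ[K] (∀ i, WithConv (C i →ₗ[K] K)) :=
  AlgEquiv.ofLinearEquiv
    ((WithConv.linearEquiv K _).trans ((LinearMap.lsum K C K).symm.trans
      (LinearEquiv.piCongrRight fun i => (WithConv.linearEquiv K (C i →ₗ[K] K)).symm)))
    (funext fun i => WithConv.ext <| LinearMap.ext fun x => by
      change counit (R := K) (Pi.single i x) = counit (R := K) x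
      simp)
    (fun f g => funext fun i => WithConv.ext <| LinearMap.ext fun x => by
      change LinearMap.mul' K K (TensorProduct.map f.ofConv g.ofConv
          (comul (R := K) (Pi.single i x))) =
        LinearMap.mul' K K (TensorProduct.map (f.ofConv ∘ₗ LinearMap.single K C i)
          (g.ofConv ∘ₗ LinearMap.single K C i) (comul (R := K) x))
      rw [TensorProduct.map_comp, Pi.comul_single]
      rfl)

/-- The convolution algebra of the trivial coalgebra `K`. -/
def convSelf : WithConv (K →ₗ[K] K) ≃ₐ[K] K :=
  AlgEquiv.ofLinearEquiv
    ((WithConv.linearEquiv K _).trans (LinearMap.ringLmapEquivSelf K K K))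
    (by
      change counit (R := K) (1 : K) = 1
      simp)
    (fun f g => by
      change LinearMap.mul' K K (TensorProduct.map f.ofConv g.ofConv (comul (R := K) (1 : K))) =
        f.ofConv 1 * g.ofConv 1
      simp)

/-- The convolution algebra of `K ⊕ ⋯ ⊕ K`. -/
def convPiSelf (m : ℕ) : WithConv ((Fin m → K) →ₗ[K] K) ≃ₐ[K] (Fin m → K) :=
  (convPi fun _ : Fin m => K).trans (AlgEquiv.piCongrRight fun _ => convSelf)

end ConvFunctor

/-! ### Transport of Hopf structures along algebra isomorphisms -/

section Transport

variable {K : Type*} [Field K]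

/-- Hopf algebra structures can be transported along algebra isomorphisms. -/
theorem algebraAdmitsHopf_of_algEquiv {A B : Type*} [Ring A] [Algebra K A] [Ring B]
    [algB : Algebra K B] (h : Algebra.AdmitsHopf K B) (e : A ≃ₐ[K] B) :
    Algebra.AdmitsHopf K A := by
  obtain ⟨H, rfl⟩ := h
  let φ : B →ₗ[K] A := e.symm.toLinearMap
  let Δ : A →ₐ[K] A ⊗[K] A := ((Algebra.TensorProduct.congr e.symm e.symm).toAlgHom.comp
    (Bialgebra.comulAlgHom K B)).comp e.toAlgHom
  let ε : A →ₐ[K] K := (Bialgebra.counitAlgHom K B).comp e.toAlgHom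
  have hΔ : ∀ a {ι : Type _} (r : Coalgebra.Repr K (e a) ι), Δ a =
      ∑ i ∈ r.index, e.symm (r.left i) ⊗ₜ e.symm (r.right i) := by
    intro a ι r
    change Algebra.TensorProduct.congr e.symm e.symm (comul (e a)) = _
    rw [← r.eq]
    simp
  have hε : ∀ a, ε a = counit (R := K) (e a) := fun a => rfl
  have hΔ' : ∀ b, Δ (φ b) = TensorProduct.map φ φ (comul (R := K) b) := by
    intro b
    change TensorProduct.map φ φ (comul (R := K) (e (e.symm b))) = _
    rw [AlgEquiv.apply_symm_apply]
  -- Both iterated comultiplications of `A` are the images under `φ ⊗ φ ⊗ φ` of those of `B`, so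
  -- coassociativity is inherited.
  have hL : ∀ z : B ⊗[K] B, TensorProduct.assoc K A A A
      (TensorProduct.map Δ.toLinearMap LinearMap.id (TensorProduct.map φ φ z)) =
      TensorProduct.map φ (TensorProduct.map φ φ)
        (TensorProduct.assoc K B B B (comul.rTensor B z)) := by
    intro z
    rw [← LinearMap.comp_apply (TensorProduct.map Δ.toLinearMap LinearMap.id),
      ← TensorProduct.map_comp]
    induction z with
    | zero => simp
    | add x y hx hy => simp only [map_add, hx, hy]
    | tmul x y =>
      simp only [TensorProduct.map_tmul, LinearMap.comp_apply, LinearMap.rTensor_tmul,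
        AlgHom.toLinearMap_apply, hΔ', LinearMap.id_apply]
      generalize (comul (R := K) x : B ⊗[K] B) = w
      induction w with
      | zero => simp
      | add x y hx hy => simp only [map_add, TensorProduct.add_tmul, hx, hy]
      | tmul x y => simp
  have hR : ∀ z : B ⊗[K] B, 
      TensorProduct.map LinearMap.id Δ.toLinearMap (TensorProduct.map φ φ z) =
      TensorProduct.map φ (TensorProduct.map φ φ) (comul.lTensor B z) := by
    intro z
    induction z with
    | zero => simp
    | add x y hx hy => simp only [map_add, hx, hy]
    | tmul x y =>
      simp only [TensorProduct.map_tmul, LinearMap.lTensor_tmul,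
        AlgHom.toLinearMap_apply, hΔ', LinearMap.id_apply]
  let Bi : Bialgebra K A := Bialgebra.ofAlgHom Δ ε
    (by
      refine AlgHom.ext fun a => ?_
      obtain ⟨b, rfl⟩ := e.symm.surjective a
      change TensorProduct.assoc K A A A
        (TensorProduct.map Δ.toLinearMap LinearMap.id (Δ (φ b))) =
        TensorProduct.map LinearMap.id Δ.toLinearMap (Δ (φ b))
      rw [hΔ', hL, hR, coassoc_apply])
    (by
      refine AlgHom.ext fun a => ?_
      obtain ⟨b, rfl⟩ := e.symm.surjective a
      change TensorProduct.map ε.toLinearMap LinearMap.id (Δ (φ b)) = 1 ⊗ₜ φ b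
      rw [hΔ', ← LinearMap.lTensor_tmul, ← rTensor_counit_comul]
      generalize (comul (R := K) b : B ⊗[K] B) = w
      induction w with
      | zero => simp
      | add x y hx hy => simp only [map_add, hx, hy]
      | tmul x y => simp [hε, φ])
    (by
      refine AlgHom.ext fun a => ?_
      obtain ⟨b, rfl⟩ := e.symm.surjective a
      change TensorProduct.map LinearMap.id ε.toLinearMap (Δ (φ b)) = φ b ⊗ₜ 1
      rw [hΔ', ← LinearMap.rTensor_tmul, ← lTensor_counit_comul]
      generalize (comul (R := K) b : B ⊗[K] B) = w
      induction w with
      | zero => simp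
      | add x y hx hy => simp only [map_add, hx, hy]
      | tmul x y => simp [hε, φ])
  let S : A →ₗ[K] A := e.symm.toLinearMap ∘ₗ HopfAlgebra.antipode K (A := B) ∘ₗ e.toLinearMap
  let HA : HopfAlgebra K A :=
    { Bi with
      antipode := S
      mul_antipode_rTensor_comul := by
        refine LinearMap.ext fun a => ?_
        change LinearMap.mul' K A (S.rTensor A (Δ a)) = algebraMap K A (ε a)
        rw [hΔ a (ℛ K (e a)), hε]
        apply e.injective
        simp only [map_sum, LinearMap.rTensor_tmul, LinearMap.mul'_apply, map_mul,
          AlgEquiv.commutes, ← HopfAlgebra.sum_antipode_mul_eq_algebraMap_counit (ℛ K (e a))]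
        simp [S]
      mul_antipode_lTensor_comul := by
        refine LinearMap.ext fun a => ?_
        change LinearMap.mul' K A (S.lTensor A (Δ a)) = algebraMap K A (ε a)
        rw [hΔ a (ℛ K (e a)), hε]
        apply e.injective
        simp only [map_sum, LinearMap.lTensor_tmul, LinearMap.mul'_apply, map_mul,
          AlgEquiv.commutes, ← HopfAlgebra.sum_mul_antipode_eq_algebraMap_counit (ℛ K (e a))]
        simp [S] }
  exact ⟨HA, rfl⟩

end Transport

/-! ### Coalgebras with a basis of paths -/

namespace QPath

variable {V : Type*} [Quiver V]

open Classical in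
theorem splits_sum_eq_single {M : Type*} [AddCommMonoid M] {a b : V} (p : Quiver.Path a b)
    (F : (Σ x : V, Quiver.Path a x × Quiver.Path x b) → M)
    (s : Σ x : V, Quiver.Path a x × Quiver.Path x b) (hs : s.2.1.comp s.2.2 = p)
    (h : ∀ t : (Σ x : V, Quiver.Path a x × Quiver.Path x b), t.2.1.comp t.2.2 = p → t ≠ s →
      F t = 0) :
    ((splits p).map F).sum = F s := by
  rw [← List.sum_toFinset _ (nodup_splits p)]
  refine Finset.sum_eq_single s (fun t ht hts => h t ?_ hts) fun hn => ?_
  · exact (mem_splits p t).1 (List.mem_toFinset.1 ht)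
  · exact absurd (List.mem_toFinset.2 ((mem_splits p s).2 hs)) hn

theorem splits_sum_eq_zero {M : Type*} [AddCommMonoid M] {a b : V} (p : Quiver.Path a b)
    (F : (Σ x : V, Quiver.Path a x × Quiver.Path x b) → M)
    (h : ∀ t : (Σ x : V, Quiver.Path a x × Quiver.Path x b), t.2.1.comp t.2.2 = p → F t = 0) :
    ((splits p).map F).sum = 0 := by
  refine List.sum_eq_zero fun x hx => ?_
  obtain ⟨t, ht, rfl⟩ := List.mem_map.1 hx
  exact h t ((mem_splits p t).1 ht)

/-- Cancellation on the right in the free category: a factorisation of a given path is determined by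
its second factor. The hypothesis is an equality in `QPath`, since the two middle vertices are not
yet known to agree. -/
theorem mk_inj_left {a x x' b : V} {β : Quiver.Path x b} {β' : Quiver.Path x' b}
    {α : Quiver.Path a x} {α' : Quiver.Path a x'} (h : (⟨x, b, β⟩ : QPath V) = ⟨x', b, β'⟩)
    (h' : α.comp β = α'.comp β') :
    (⟨x, α, β⟩ : Σ x : V, Quiver.Path a x × Quiver.Path x b) = ⟨x', α', β'⟩ := by
  cases h
  rw [Quiver.Path.comp_inj_left] at h'
  subst h'
  rfl

theorem mk_inj_right {a x x' b : V} {β : Quiver.Path x b} {β' : Quiver.Path x' b}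
    {α : Quiver.Path a x} {α' : Quiver.Path a x'} (h : (⟨a, x, α⟩ : QPath V) = ⟨a, x', α'⟩)
    (h' : α.comp β = α'.comp β') :
    (⟨x, α, β⟩ : Σ x : V, Quiver.Path a x × Quiver.Path x b) = ⟨x', α', β'⟩ := by
  cases h
  rw [Quiver.Path.comp_inj_right] at h'
  subst h'
  rfl

end QPath

/-- A basis of the coalgebra `C` indexed by a set `T` of paths of `V`, closed under subpaths and
containing the vertices, for which `Δ` and `ε` are given by the formulas of the path coalgebra. -/
structure PathBasis (K V C : Type*) [Field K] [Quiver V] [AddCommGroup C] [Module K C]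
    [Coalgebra K C] where
  T : Set (QPath V)
  vertex_mem : ∀ v, QPath.vertex v ∈ T
  comp_mem : ∀ {a x b : V} (α : Quiver.Path a x) (β : Quiver.Path x b),
    (⟨a, b, α.comp β⟩ : QPath V) ∈ T → (⟨a, x, α⟩ : QPath V) ∈ T ∧ (⟨x, b, β⟩ : QPath V) ∈ T
  basis : Module.Basis T K C
  -- Defined on all paths, with irrelevant values outside `T`, so that `Δ` can be written as a sum
  -- over factorisations without carrying membership proofs.
  vec : QPath V → C
  basis_apply : ∀ p : T, basis p = vec p
  comul_vec : ∀ p ∈ T, comul (R := K) (vec p) =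
    ((QPath.splits p.path).map fun s =>
      vec ⟨s.1, p.tgt, s.2.2⟩ ⊗ₜ[K] vec ⟨p.src, s.1, s.2.1⟩).sum
  counit_vec : ∀ p ∈ T, counit (R := K) (vec p) = if p.length = 0 then (1 : K) else 0

namespace PathBasis

variable {K V C : Type*} [Field K] [Quiver V] [AddCommGroup C] [Module K C] [Coalgebra K C]
  (B : PathBasis K V C)

/-- The functional on `C` with prescribed values on the basis of paths. -/
def functional (f : QPath V → K) : C →ₗ[K] K := B.basis.constr K fun p => f p

theorem functional_vec (f : QPath V → K) {p : QPath V} (hp : p ∈ B.T) :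
    B.functional f (B.vec p) = f p := by
  have := B.basis.constr_basis K (fun p => f p) ⟨p, hp⟩
  rwa [basis_apply] at this

theorem ext_vec {M : Type*} [AddCommGroup M] [Module K M] {f g : C →ₗ[K] M}
    (h : ∀ p ∈ B.T, f (B.vec p) = g (B.vec p)) : f = g :=
  B.basis.ext fun p => by
    rw [basis_apply]
    exact h p p.2

theorem conv_vec (f g : WithConv (C →ₗ[K] K)) {p : QPath V} (hp : p ∈ B.T) :
    (f * g) (B.vec p) = ((QPath.splits p.path).map fun s =>
      f (B.vec ⟨s.1, p.tgt, s.2.2⟩) * g (B.vec ⟨p.src, s.1, s.2.1⟩)).sum := by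
  rw [LinearMap.convMul_apply, B.comul_vec p hp, map_list_sum, map_list_sum, List.map_map,
    List.map_map]
  rfl

open Classical in
/-- The coordinate of `C` at a path `p` (zero if `p` is not in `T`). -/
def coord (p : QPath V) : C →ₗ[K] K := B.functional fun q => if p = q then 1 else 0

open Classical in
theorem coord_vec (p : QPath V) {q : QPath V} (hq : q ∈ B.T) :
    B.coord p (B.vec q) = if p = q then 1 else 0 := B.functional_vec _ hq

theorem coord_eq_zero {p : QPath V} (hp : p ∉ B.T) : B.coord p = 0 := by
  classical
  refine B.ext_vec fun q hq => ?_
  rw [B.coord_vec p hq, if_neg]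
  · rfl
  · rintro rfl
    exact hp hq

/-- Comultiplication by cutting is dual to multiplication by concatenation. If the concatenation
lies outside `T`, both sides vanish, because no path of `T` has this factorisation. -/
theorem coord_mul_comp {a x b : V} (α : Quiver.Path a x) (β : Quiver.Path x b) :
    toConv (B.coord ⟨x, b, β⟩) * toConv (B.coord ⟨a, x, α⟩) =
      toConv (B.coord ⟨a, b, α.comp β⟩) := by
  classical
  refine WithConv.ext (B.ext_vec fun p hp => ?_)
  refine (B.conv_vec _ _ hp).trans ?_
  change _ = B.coord _ _
  rw [B.coord_vec _ hp]
  obtain ⟨c, d, p⟩ := p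
  split_ifs with h
  · cases h
    rw [QPath.splits_sum_eq_single _ _ ⟨x, α, β⟩ rfl]
    · change B.coord _ _ * B.coord _ _ = 1
      rw [B.coord_vec _ (B.comp_mem _ _ hp).1, B.coord_vec _ (B.comp_mem _ _ hp).2]
      simp
    · rintro ⟨y, α', β'⟩ h hne
      dsimp only at h
      have hp' := hp
      rw [← h] at hp'
      change B.coord _ _ * B.coord _ _ = 0
      rw [B.coord_vec _ (B.comp_mem _ _ hp').2, if_neg, zero_mul]
      intro h'
      exact hne (QPath.mk_inj_left h'.symm h)
  · refine QPath.splits_sum_eq_zero _ _ ?_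
    rintro ⟨y, (α' : Quiver.Path c y), (β' : Quiver.Path y d)⟩ h'
    obtain rfl : α'.comp β' = p := h'
    change B.coord _ _ * B.coord _ _ = 0
    rw [B.coord_vec _ (B.comp_mem _ _ hp).1, B.coord_vec _ (B.comp_mem _ _ hp).2]
    split_ifs with h1 h2
    · cases h1
      cases h2
      exact absurd rfl h
    all_goals simp

theorem coord_mul_of_ne {p q : QPath V} (h : q.tgt ≠ p.src) :
    toConv (B.coord p) * toConv (B.coord q) = 0 := by
  classical
  refine WithConv.ext (B.ext_vec fun r hr => ?_)
  refine (B.conv_vec _ _ hr).trans ?_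
  obtain ⟨c, d, r⟩ := r
  refine QPath.splits_sum_eq_zero _ _ ?_
  rintro ⟨y, (α : Quiver.Path c y), (β : Quiver.Path y d)⟩ h'
  obtain rfl : α.comp β = r := h'
  change B.coord _ _ * B.coord _ _ = 0
  rw [B.coord_vec _ (B.comp_mem _ _ hr).1, B.coord_vec _ (B.comp_mem _ _ hr).2]
  split_ifs with h1 h2
  · cases h1
    cases h2
    exact absurd rfl h
  all_goals simp

/-- The coordinates at the paths multiply as in the path algebra. -/
def convHom [Fintype V] : PathAlgebra K V →ₐ[K] WithConv (C →ₗ[K] K) :=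
  AlgHom.ofLinearMap ((PathAlgebra.basis K V).constr K fun p => toConv (B.coord p))
    (by
      classical
      change (PathAlgebra.basis K V).constr K _ PathAlgebra.unit = 1
      simp only [PathAlgebra.unit, PathAlgebra.of, map_sum, Module.Basis.constr_basis]
      refine WithConv.ext (B.ext_vec fun p hp => ?_)
      rw [← WithConv.toConv_sum]
      change (∑ v, B.coord (QPath.vertex v)) (B.vec p) = counit (B.vec p)
      rw [B.counit_vec p hp, LinearMap.sum_apply]
      simp only [B.coord_vec _ hp]
      obtain ⟨a, b, p⟩ := p
      cases p with
      | nil =>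
        rw [Finset.sum_eq_single a]
        · simp [QPath.vertex, QPath.length]
        · intro v _ hv
          rw [if_neg]
          intro h
          cases h
          exact hv rfl
        · simp
      | cons p e =>
        rw [Finset.sum_eq_zero]
        · simp [QPath.length]
        · intro v _
          rw [if_neg]
          intro h
          cases h)
    (by
      intro x y
      change (PathAlgebra.basis K V).constr K _ (PathAlgebra.mulHom x y) = _
      induction x using PathAlgebra.ind with
      | h0 => simp
      | ha x x' h h' => simp only [map_add, LinearMap.add_apply, h, h', add_mul]
      | hs a p =>
      induction y using PathAlgebra.ind with
      | h0 => simp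
      | ha x x' h h' => simp only [map_add, h, h', mul_add]
      | hs b q =>
      simp only [map_smul, LinearMap.smul_apply, PathAlgebra.mulHom_of, smul_mul_smul_comm,
        smul_smul, mul_comm a b]
      congr 1
      obtain ⟨p₁, p₂, p⟩ := p
      obtain ⟨q₁, q₂, q⟩ := q
      by_cases h : q₂ = p₁
      · subst h
        simp only [PathAlgebra.pathMul, dite_true, PathAlgebra.of, Module.Basis.constr_basis,
          coord_mul_comp]
        rfl
      · simp only [PathAlgebra.pathMul, h, dite_false, PathAlgebra.of, Module.Basis.constr_basis,
          map_zero]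
        exact (B.coord_mul_of_ne (p := ⟨p₁, p₂, p⟩) (q := ⟨q₁, q₂, q⟩) h).symm)

theorem convHom_of [Fintype V] (p : QPath V) :
    B.convHom (PathAlgebra.of K p) = toConv (B.coord p) :=
  (PathAlgebra.basis K V).constr_basis K _ p

theorem convHom_eq_functional [Fintype V] (x : PathAlgebra K V) :
    B.convHom x = toConv (B.functional fun p => (PathAlgebra.basis K V).repr x p) := by
  classical
  induction x using PathAlgebra.ind with
  | h0 =>
    refine WithConv.ext (B.ext_vec fun r hr => ?_)
    rw [ofConv_toConv, B.functional_vec _ hr]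
    simp
  | ha x x' h h' =>
    rw [map_add, h, h']
    refine WithConv.ext (B.ext_vec fun r hr => ?_)
    rw [ofConv_toConv, B.functional_vec _ hr]
    change B.functional _ _ + B.functional _ _ = _
    simp [B.functional_vec _ hr]
  | hs a p =>
    rw [map_smul, convHom_of]
    refine WithConv.ext (B.ext_vec fun r hr => ?_)
    rw [ofConv_toConv, B.functional_vec _ hr]
    change a • B.coord _ _ = _
    rw [B.coord_vec _ hr]
    simp [PathAlgebra.of, Finsupp.single_apply]

/-- The image of `x` is the functional whose values on the basis `T` are the coefficients of `x`; it
vanishes exactly when `x` is supported off `T`. -/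
theorem convHom_eq_zero_iff [Fintype V] (x : PathAlgebra K V) :
    B.convHom x = 0 ↔ x ∈ Submodule.span K (PathAlgebra.of K '' B.Tᶜ) := by
  have h1 : PathAlgebra.of K '' B.Tᶜ = PathAlgebra.basis K V '' B.Tᶜ := rfl
  rw [h1, Module.Basis.mem_span_image, convHom_eq_functional]
  constructor
  · intro h p hp hpT
    rw [Finset.mem_coe, Finsupp.mem_support_iff] at hp
    apply hp
    rw [← B.functional_vec (fun p => (PathAlgebra.basis K V).repr x p) hpT]
    exact LinearMap.congr_fun (congrArg ofConv h) _
  · intro h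
    refine WithConv.ext (B.ext_vec fun r hr => ?_)
    rw [ofConv_toConv, B.functional_vec _ hr]
    by_contra hne
    exact h (Finsupp.mem_support_iff.2 hne) hr

theorem convHom_surjective [Fintype V] [Finite B.T] : Function.Surjective B.convHom := by
  classical
  have := Fintype.ofFinite B.T
  intro f
  refine ⟨∑ p : B.T, f.ofConv (B.vec p) • PathAlgebra.of K p.1, ?_⟩
  rw [map_sum]
  simp only [map_smul, convHom_of]
  refine WithConv.ext (B.ext_vec fun r hr => ?_)
  rw [WithConv.ofConv_sum, LinearMap.sum_apply]
  simp only [WithConv.ofConv_smul, LinearMap.smul_apply, B.coord_vec _ hr]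
  rw [Finset.sum_eq_single ⟨r, hr⟩]
  · simp
  · intro p _ hp
    rw [if_neg, smul_zero]
    rintro rfl
    exact hp rfl
  · simp

/-- The quotient of the path algebra by an ideal spanned by the paths outside `T` is the
convolution algebra of a coalgebra with basis `T`. -/
def quotientEquiv [Fintype V] [Finite B.T] (I : Ideal (PathAlgebra K V)) [I.IsTwoSided]
    (hI : ∀ x, x ∈ I ↔ x ∈ Submodule.span K (PathAlgebra.of K '' B.Tᶜ)) :
    (PathAlgebra K V ⧸ I) ≃ₐ[K] WithConv (C →ₗ[K] K) :=
  AlgEquiv.ofBijective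
    (Ideal.Quotient.liftₐ I B.convHom fun x hx => (B.convHom_eq_zero_iff x).2 ((hI x).1 hx))
    ⟨by
      rw [injective_iff_map_eq_zero]
      intro x hx
      obtain ⟨x, rfl⟩ := Ideal.Quotient.mk_surjective x
      exact Ideal.Quotient.eq_zero_iff_mem.2 ((hI x).2 ((B.convHom_eq_zero_iff x).1 hx)),
    fun f => by
      obtain ⟨x, rfl⟩ := B.convHom_surjective f
      exact ⟨Ideal.Quotient.mk I x, rfl⟩⟩

/-- Transport of a path basis along an isomorphism of coalgebras. -/
def map {C' : Type*} [AddCommGroup C'] [Module K C'] [Coalgebra K C'] (e : C ≃ₗc[K] C') :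
    PathBasis K V C' where
  T := B.T
  vertex_mem := B.vertex_mem
  comp_mem := B.comp_mem
  basis := B.basis.map e.toLinearEquiv
  vec p := e (B.vec p)
  basis_apply p := by
    rw [Module.Basis.map_apply, basis_apply]
    rfl
  comul_vec p hp := by
    rw [← CoalgHomClass.map_comp_comul_apply, B.comul_vec p hp, map_list_sum, List.map_map]
    rfl
  counit_vec p hp := by
    rw [CoalgHomClass.counit_comp_apply, B.counit_vec p hp]

end PathBasis

/-! ### Monomial subcoalgebras and ideals -/

namespace QPath

variable {V : Type*} [Quiver V]

theorem finite_setOf_length_lt [Finite V] [∀ a b : V, Finite (a ⟶ b)] (d : ℕ) :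
    {p : QPath V | p.length < d}.Finite := by
  induction d with
  | zero => simp
  | succ d ih =>
    have := ih.to_subtype
    refine (Set.finite_range (fun s : V ⊕ (Σ p : {p : QPath V | p.length < d},
      Σ c : V, p.1.tgt ⟶ c) => (Sum.elim vertex
        (fun s => ⟨s.1.1.src, s.2.1, s.1.1.path.cons s.2.2⟩) s : QPath V))).subset ?_
    rintro ⟨a, b, p⟩ hp
    cases p with
    | nil => exact ⟨Sum.inl a, rfl⟩
    | cons p e =>
      refine ⟨Sum.inr ⟨⟨⟨a, _, p⟩, ?_⟩, _, e⟩, rfl⟩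
      have : p.length + 1 < d + 1 := hp
      change p.length < d
      omega

end QPath

namespace PathAlgebra

variable {K V : Type*} [Field K] [Quiver V]

theorem of_mul_of [Fintype V] {a x b : V} (α : Quiver.Path a x) (β : Quiver.Path x b) :
    of K ⟨x, b, β⟩ * of K ⟨a, x, α⟩ = of K ⟨a, b, α.comp β⟩ := by
  change mulHom _ _ = _
  rw [mulHom_of]
  simp [pathMul]

theorem of_mul_of_ne [Fintype V] {p q : QPath V} (h : q.tgt ≠ p.src) :
    of K p * of K q = 0 := by
  change mulHom _ _ = _
  rw [mulHom_of]
  simp [pathMul, h]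

theorem mul_mem_span [Fintype V] {U W X : Set (QPath V)}
    (h : ∀ {a x b : V} (α : Quiver.Path a x) (β : Quiver.Path x b), (⟨x, b, β⟩ : QPath V) ∈ U →
      (⟨a, x, α⟩ : QPath V) ∈ W → (⟨a, b, α.comp β⟩ : QPath V) ∈ X)
    {x y : PathAlgebra K V} (hx : x ∈ Submodule.span K (of K '' U))
    (hy : y ∈ Submodule.span K (of K '' W)) : x * y ∈ Submodule.span K (of K '' X) := by
  induction hx using Submodule.span_induction with
  | zero => simp
  | add x x' _ _ h h' => rw [add_mul]; exact add_mem h h'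
  | smul c x _ h => rw [smul_mul_assoc]; exact Submodule.smul_mem _ _ h
  | mem x hx =>
  induction hy using Submodule.span_induction with
  | zero => simp
  | add x x' _ _ h h' => rw [mul_add]; exact add_mem h h'
  | smul c x _ h => rw [mul_smul_comm]; exact Submodule.smul_mem _ _ h
  | mem y hy =>
  obtain ⟨p, hp, rfl⟩ := hx
  obtain ⟨q, hq, rfl⟩ := hy
  by_cases hpq : q.tgt = p.src
  · obtain ⟨p₁, p₂, p⟩ := p
    obtain ⟨q₁, q₂, q⟩ := q
    dsimp only at hpq
    subst hpq
    rw [of_mul_of]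
    exact Submodule.subset_span ⟨_, h _ _ hp hq, rfl⟩
  · rw [of_mul_of_ne hpq]
    exact zero_mem _

theorem mem_span_univ (x : PathAlgebra K V) :
    x ∈ Submodule.span K (of K '' (Set.univ : Set (QPath V))) := by
  have : Submodule.span K (of K '' (Set.univ : Set (QPath V))) = ⊤ := by
    rw [Set.image_univ]
    exact (basis K V).span_eq
  rw [this]
  trivial

theorem of_mem_span_iff {p : QPath V} {U : Set (QPath V)} :
    of K p ∈ Submodule.span K (of K '' U) ↔ p ∈ U :=
  (basis K V).self_mem_span_image

variable [Fintype V]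

/-- The two-sided ideal spanned by a set of paths closed under extension. -/
def spanIdeal (U : Set (QPath V))
    (h : ∀ {a x b : V} (α : Quiver.Path a x) (β : Quiver.Path x b),
      (⟨x, b, β⟩ : QPath V) ∈ U ∨ (⟨a, x, α⟩ : QPath V) ∈ U → (⟨a, b, α.comp β⟩ : QPath V) ∈ U) :
    TwoSidedIdeal (PathAlgebra K V) :=
  TwoSidedIdeal.mk' (Submodule.span K (of K '' U) : Set (PathAlgebra K V))
    (zero_mem _) add_mem neg_mem
    (fun {x _} hy => mul_mem_span (fun {_ _ _} α β _ h2 => h α β (Or.inr h2)) (mem_span_univ x) hy)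
    (fun {_ y} hx => mul_mem_span (fun {_ _ _} α β h1 _ => h α β (Or.inl h1)) hx (mem_span_univ y))

theorem mem_spanIdeal {U : Set (QPath V)}
    {h : ∀ {a x b : V} (α : Quiver.Path a x) (β : Quiver.Path x b),
      (⟨x, b, β⟩ : QPath V) ∈ U ∨ (⟨a, x, α⟩ : QPath V) ∈ U → (⟨a, b, α.comp β⟩ : QPath V) ∈ U}
    {x : PathAlgebra K V} :
    x ∈ spanIdeal (K := K) U h ↔ x ∈ Submodule.span K (of K '' U) :=
  TwoSidedIdeal.mem_mk' _ _ _ _ _ _ _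

/-- The span of the paths lying in the ideal is stable under multiplication by paths, so it is
itself a two-sided ideal; it contains the generators, hence everything. -/
theorem mem_pathIdeal_iff (S : Set (QPath V)) (x : PathAlgebra K V) :
    x ∈ pathIdeal K S ↔ x ∈ Submodule.span K (of K '' {p | of K p ∈ pathIdeal K S}) := by
  constructor
  · intro hx
    have hle : TwoSidedIdeal.span (of K '' S) ≤
        spanIdeal {p | of K p ∈ pathIdeal K S} (by
          rintro a x b α β (h | h)
          · change of K _ ∈ pathIdeal K S
            rw [← of_mul_of]
            exact Ideal.mul_mem_right _ _ h
          · change of K _ ∈ pathIdeal K S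
            rw [← of_mul_of]
            exact Ideal.mul_mem_left _ _ h) := by
      rw [TwoSidedIdeal.span_le]
      rintro _ ⟨p, hp, rfl⟩
      refine mem_spanIdeal.2 (Submodule.subset_span (Set.mem_image_of_mem _ ?_))
      exact TwoSidedIdeal.mem_asIdeal.2 (TwoSidedIdeal.subset_span (Set.mem_image_of_mem _ hp))
    exact mem_spanIdeal.1 (hle (TwoSidedIdeal.mem_asIdeal.1 hx))
  · intro hx
    refine (Submodule.span_le (p := (pathIdeal K S).restrictScalars K)).2 ?_ hx
    rintro _ ⟨p, hp, rfl⟩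
    exact hp

/-- Lengths add under concatenation, which bounds `J ^ d` from above. Conversely a path of length at
least `d + 1` factors as a path of length at least `d` after its first arrow. -/
theorem mem_arrowIdeal_pow_iff (d : ℕ) (x : PathAlgebra K V) :
    x ∈ arrowIdeal K V ^ d ↔ x ∈ Submodule.span K (of K '' {p | d ≤ p.length}) := by
  have hJ : ∀ x ∈ arrowIdeal K V, x ∈ Submodule.span K (of K '' {p | 1 ≤ p.length}) := by
    intro x hx
    have hle : TwoSidedIdeal.span
        (of K '' {p : QPath V | ∃ (a b : V) (e : a ⟶ b), p = QPath.arrow e}) ≤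
        spanIdeal {p : QPath V | 1 ≤ p.length} (by
          intro a x b α β h
          change 1 ≤ (α.comp β).length
          rw [Quiver.Path.length_comp]
          rcases h with h | h
          · have : 1 ≤ β.length := h
            omega
          · have : 1 ≤ α.length := h
            omega) := by
      rw [TwoSidedIdeal.span_le]
      rintro _ ⟨p, ⟨a, b, e, rfl⟩, rfl⟩
      exact mem_spanIdeal.2 (Submodule.subset_span ⟨_, le_refl 1, rfl⟩)
    exact mem_spanIdeal.1 (hle (TwoSidedIdeal.mem_asIdeal.1 hx))
  have hadd : ∀ m n, ∀ {a x b : V} (α : Quiver.Path a x) (β : Quiver.Path x b),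
      (⟨x, b, β⟩ : QPath V) ∈ {p : QPath V | m ≤ p.length} →
      (⟨a, x, α⟩ : QPath V) ∈ {p : QPath V | n ≤ p.length} →
      (⟨a, b, α.comp β⟩ : QPath V) ∈ {p : QPath V | m + n ≤ p.length} := by
    intro m n a x b α β h1 h2
    have h1 : m ≤ β.length := h1
    have h2 : n ≤ α.length := h2
    change m + n ≤ (α.comp β).length
    rw [Quiver.Path.length_comp]
    omega
  induction d generalizing x with
  | zero =>
    rw [Submodule.pow_zero, Ideal.one_eq_top]
    refine iff_of_true trivial (Submodule.span_mono (Set.image_mono fun p _ => ?_)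
      (mem_span_univ x))
    exact Nat.zero_le _
  | succ d ih =>
    rw [Submodule.pow_succ]
    constructor
    · intro hx
      induction hx using Submodule.smul_induction_on' with
      | smul r hr n hn =>
        exact mul_mem_span (hadd d 1) ((ih r).1 hr) (hJ n hn)
      | add x _ y _ hx hy => exact add_mem hx hy
    · intro hx
      refine (Submodule.span_le (p := (arrowIdeal K V ^ d * arrowIdeal K V).restrictScalars K)).2
        ?_ hx
      rintro _ ⟨⟨a, b, p⟩, hp, rfl⟩
      have hp : d + 1 ≤ p.length := hp
      obtain ⟨c, e, p', rfl, hlen⟩ := (Quiver.Path.length_ne_zero_iff_eq_comp p).1 (by omega)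
      rw [← of_mul_of]
      refine Ideal.mul_mem_mul ((ih _).2 (Submodule.subset_span ⟨_, ?_, rfl⟩)) ?_
      · change d ≤ p'.length
        omega
      · exact TwoSidedIdeal.mem_asIdeal.2 (TwoSidedIdeal.subset_span ⟨_, ⟨a, c, e, rfl⟩, rfl⟩)

end PathAlgebra

namespace PathCoalgebra

variable {K V : Type*} [Field K] [Quiver V]

theorem of_mem_span_iff {p : QPath V} {U : Set (QPath V)} :
    of K p ∈ Submodule.span K (of K '' U) ↔ p ∈ U :=
  (basis K V).self_mem_span_image

/-- The subcoalgebra spanned by a set of paths closed under subpaths. -/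
def spanSubcoalgebra (T : Set (QPath V))
    (hT : ∀ {a x b : V} (α : Quiver.Path a x) (β : Quiver.Path x b),
      (⟨a, b, α.comp β⟩ : QPath V) ∈ T → (⟨a, x, α⟩ : QPath V) ∈ T ∧ (⟨x, b, β⟩ : QPath V) ∈ T) :
    Subcoalgebra K (PathCoalgebra K V) where
  toSubmodule := Submodule.span K (of K '' T)
  comul_mem x hx := by
    refine (Submodule.span_le (p := Submodule.comap Coalgebra.comul (LinearMap.range _))).2 ?_ hx
    rintro _ ⟨p, hp, rfl⟩
    change Coalgebra.comul (of K p) ∈ LinearMap.range _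
    rw [comul_of]
    refine list_sum_mem fun t ht => ?_
    obtain ⟨s, hs, rfl⟩ := List.mem_map.1 ht
    have h := (QPath.mem_splits _ _).1 hs
    have hp' : (⟨p.src, p.tgt, s.2.1.comp s.2.2⟩ : QPath V) ∈ T := by
      rw [h]
      exact hp
    exact ⟨⟨_, Submodule.subset_span ⟨_, (hT _ _ hp').2, rfl⟩⟩ ⊗ₜ
      ⟨_, Submodule.subset_span ⟨_, (hT _ _ hp').1, rfl⟩⟩, rfl⟩

theorem basis_coord_of [DecidableEq (QPath V)] (p q : QPath V) :
    (basis K V).coord p (of K q) = if q = p then 1 else 0 := by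
  simp [of, Finsupp.single_apply]

/-- Applying the coordinate of one factor to the corresponding side of `Δ` leaves exactly the other
factor, by cancellation. Since `Δ` of an element of `D` lies in `D ⊗ D`, the result stays in `D`. -/
theorem comp_mem_of_subcoalgebra (D : Subcoalgebra K (PathCoalgebra K V)) {a x b : V}
    (α : Quiver.Path a x) (β : Quiver.Path x b) (h : of K ⟨a, b, α.comp β⟩ ∈ D.toSubmodule) :
    of K ⟨a, x, α⟩ ∈ D.toSubmodule ∧ of K ⟨x, b, β⟩ ∈ D.toSubmodule := by
  classical
  obtain ⟨z, hz⟩ := D.comul_mem _ h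
  rw [comul_of] at hz
  constructor
  · let L : PathCoalgebra K V ⊗[K] PathCoalgebra K V →ₗ[K] PathCoalgebra K V :=
      (TensorProduct.lid K _).toLinearMap ∘ₗ ((basis K V).coord ⟨x, b, β⟩).rTensor _
    have h1 : ∀ z, L (TensorProduct.map D.toSubmodule.subtype D.toSubmodule.subtype z) ∈
        D.toSubmodule := by
      intro z
      induction z with
      | zero => simp
      | add x y hx hy =>
        rw [map_add, map_add]
        exact add_mem hx hy
      | tmul y z =>
        simp only [TensorProduct.map_tmul, L, LinearMap.comp_apply, LinearMap.rTensor_tmul]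
        exact Submodule.smul_mem _ _ z.2
    have h2 := h1 z
    rw [hz, map_list_sum, List.map_map, QPath.splits_sum_eq_single _ _ ⟨x, α, β⟩ rfl] at h2
    · simpa only [Function.comp_apply, L, LinearMap.comp_apply, LinearMap.rTensor_tmul,
        LinearMap.lTensor_tmul, basis_coord_of, LinearEquiv.coe_coe, TensorProduct.lid_tmul,
        TensorProduct.rid_tmul, if_true, one_smul] using h2
    · rintro ⟨y, α', β'⟩ h hne
      simp only [Function.comp_apply, L, LinearMap.comp_apply, LinearMap.rTensor_tmul,
        basis_coord_of, LinearEquiv.coe_coe, TensorProduct.lid_tmul]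
      rw [if_neg, zero_smul]
      exact fun h' => hne (QPath.mk_inj_left h' h)
  · let L : PathCoalgebra K V ⊗[K] PathCoalgebra K V →ₗ[K] PathCoalgebra K V :=
      (TensorProduct.rid K _).toLinearMap ∘ₗ ((basis K V).coord ⟨a, x, α⟩).lTensor _
    have h1 : ∀ z, L (TensorProduct.map D.toSubmodule.subtype D.toSubmodule.subtype z) ∈
        D.toSubmodule := by
      intro z
      induction z with
      | zero => simp
      | add x y hx hy =>
        rw [map_add, map_add]
        exact add_mem hx hy
      | tmul y z =>
        simp only [TensorProduct.map_tmul, L, LinearMap.comp_apply, LinearMap.lTensor_tmul]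
        exact Submodule.smul_mem _ _ y.2
    have h2 := h1 z
    rw [hz, map_list_sum, List.map_map, QPath.splits_sum_eq_single _ _ ⟨x, α, β⟩ rfl] at h2
    · simpa only [Function.comp_apply, L, LinearMap.comp_apply, LinearMap.rTensor_tmul,
        LinearMap.lTensor_tmul, basis_coord_of, LinearEquiv.coe_coe, TensorProduct.lid_tmul,
        TensorProduct.rid_tmul, if_true, one_smul] using h2
    · rintro ⟨y, α', β'⟩ h hne
      simp only [Function.comp_apply, L, LinearMap.comp_apply, LinearMap.lTensor_tmul,
        basis_coord_of, LinearEquiv.coe_coe, TensorProduct.rid_tmul]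
      rw [if_neg, zero_smul]
      exact fun h' => hne (QPath.mk_inj_right h' h)

open Classical in
/-- The path basis of a subcoalgebra of the path coalgebra spanned by paths. -/
def pathBasis (D : Subcoalgebra K (PathCoalgebra K V)) (T : Set (QPath V))
    (hT : D.toSubmodule = Submodule.span K (of K '' T)) (hv : ∀ v, QPath.vertex v ∈ T) :
    PathBasis K V D.toSubmodule :=
  have hmem : ∀ p, of K p ∈ D.toSubmodule ↔ p ∈ T := fun p => by rw [hT, of_mem_span_iff]
  have hcomp : ∀ {a x b : V} (α : Quiver.Path a x) (β : Quiver.Path x b),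
      (⟨a, b, α.comp β⟩ : QPath V) ∈ T →
        (⟨a, x, α⟩ : QPath V) ∈ T ∧ (⟨x, b, β⟩ : QPath V) ∈ T := fun α β h => by
    rw [← hmem] at h
    rw [← hmem, ← hmem]
    exact comp_mem_of_subcoalgebra D α β h
  let vec : QPath V → D.toSubmodule := fun p =>
    if h : of K p ∈ D.toSubmodule then ⟨of K p, h⟩ else 0
  have hvec : ∀ p ∈ T, (vec p : PathCoalgebra K V) = of K p := fun p hp => by
    simp only [vec, (hmem p).2 hp, dite_true]
  { T := T
    vertex_mem := hv
    comp_mem := hcomp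
    basis := Module.Basis.mk (v := fun p : T => vec p)
      (by
        refine LinearIndependent.of_comp D.toSubmodule.subtype ?_
        have : (D.toSubmodule.subtype ∘ fun p : T => vec p) = fun p : T => basis K V p :=
          funext fun p => hvec p p.2
        rw [this]
        exact (basis K V).linearIndependent.comp _ Subtype.val_injective)
      (by
        rintro ⟨x, hx⟩ -
        have hx' := hx
        rw [hT] at hx'
        have key : ∀ y ∈ Submodule.span K (of K '' T), ∃ z ∈ Submodule.span K
            (Set.range fun p : T => vec p), (z : PathCoalgebra K V) = y := by
          intro y hy
          induction hy using Submodule.span_induction with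
          | mem y hy =>
            obtain ⟨p, hp, rfl⟩ := hy
            exact ⟨vec p, Submodule.subset_span ⟨⟨p, hp⟩, rfl⟩, hvec p hp⟩
          | zero => exact ⟨0, zero_mem _, rfl⟩
          | add y y' _ _ h h' =>
            obtain ⟨z, hz, rfl⟩ := h
            obtain ⟨z', hz', rfl⟩ := h'
            exact ⟨z + z', add_mem hz hz', rfl⟩
          | smul c y _ h =>
            obtain ⟨z, hz, rfl⟩ := h
            exact ⟨c • z, Submodule.smul_mem _ _ hz, rfl⟩
        obtain ⟨z, hz, h⟩ := key x hx'
        rwa [show (⟨x, hx⟩ : D.toSubmodule) = z from Subtype.ext h.symm])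
    vec := vec
    basis_apply := fun p => Module.Basis.mk_apply _ _ p
    comul_vec := fun p hp => by
      apply D.inclTensor_injective
      rw [D.inclTensor_comul, hvec p hp, comul_of, map_list_sum, List.map_map]
      refine congrArg List.sum (List.map_congr_left fun s hs => ?_)
      have h := (QPath.mem_splits _ _).1 hs
      have hp' : (⟨p.src, p.tgt, s.2.1.comp s.2.2⟩ : QPath V) ∈ T := by
        rw [h]
        exact hp
      change _ = (vec _ : PathCoalgebra K V) ⊗ₜ[K] (vec _ : PathCoalgebra K V)
      rw [hvec _ (hcomp _ _ hp').1, hvec _ (hcomp _ _ hp').2]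
    counit_vec := fun p hp => by
      change counit (R := K) (vec p : PathCoalgebra K V) = _
      rw [hvec p hp, counit_of] }

end PathCoalgebra

/-- A monomial coalgebra has a finite path basis containing the arrows. -/
theorem IsMonomialCoalgebra.exists_pathBasis {K C : Type*} [Field K] [AddCommGroup C] [Module K C]
    [Coalgebra K C] (h : IsMonomialCoalgebra K C) :
    ∃ (V : Type) (_ : Fintype V) (_ : Quiver.{0} V) (B : PathBasis K V C), B.T.Finite ∧
      ∀ (a b : V) (e : a ⟶ b), QPath.arrow e ∈ B.T := by
  obtain ⟨V, _, _, _, D, ⟨hv, ha, ⟨d, -, hd⟩, S, hS⟩, ⟨e⟩⟩ := h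
  refine ⟨V, inferInstance, inferInstance, (PathCoalgebra.pathBasis D S hS fun v => ?_).map e.symm,
    ?_, fun a b e => ?_⟩
  · have := hv v
    rwa [hS, PathCoalgebra.of_mem_span_iff] at this
  · refine (QPath.finite_setOf_length_lt d).subset fun p hp => ?_
    have hp : p ∈ S := hp
    have h1 : PathCoalgebra.of K p ∈ D.toSubmodule := by rwa [hS, PathCoalgebra.of_mem_span_iff]
    exact PathCoalgebra.of_mem_span_iff.1 (hd h1)
  · have := ha a b e
    rwa [hS, PathCoalgebra.of_mem_span_iff] at this

/-- A monomial algebra is the convolution algebra of a finite-dimensional monomial coalgebra. -/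
theorem IsMonomialAlgebra.exists_coalgebra {K : Type u} {A : Type*} [Field K] [Ring A] [Algebra K A]
    (h : IsMonomialAlgebra K A) :
    ∃ (C : Type u) (_ : AddCommGroup C) (_ : Module K C) (_ : Coalgebra K C),
      FiniteDimensional K C ∧ IsMonomialCoalgebra K C ∧
        Nonempty (A ≃ₐ[K] WithConv (C →ₗ[K] K)) := by
  obtain ⟨V, _, _, _, S, ⟨N, hN, hJI, hIJ⟩, ⟨e⟩⟩ := h
  let I := PathAlgebra.pathIdeal K S
  -- The paths that survive in the quotient. From `I ⊆ J²` they include all vertices and arrows;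
  -- from `J^N ⊆ I` their lengths are less than `N`; as `I` is an ideal, they are closed under
  -- subpaths.
  let T : Set (QPath V) := {p | PathAlgebra.of K p ∉ I}
  have hI2 : ∀ p : QPath V, PathAlgebra.of K p ∈ I → 2 ≤ p.length := by
    intro p hp
    have := (PathAlgebra.mem_arrowIdeal_pow_iff 2 _).1 (hIJ hp)
    exact PathAlgebra.of_mem_span_iff.1 this
  have hTN : ∀ p ∈ T, p.length < N := by
    intro p hp
    by_contra! hlen
    exact hp (hJI ((PathAlgebra.mem_arrowIdeal_pow_iff N _).2
      (PathAlgebra.of_mem_span_iff.2 hlen)))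
  have hv : ∀ v, QPath.vertex v ∈ T := fun v hv => by
    have : 2 ≤ 0 := hI2 _ hv
    omega
  have ha : ∀ (a b : V) (e : a ⟶ b), QPath.arrow e ∈ T := fun a b e he => by
    have : 2 ≤ 1 := hI2 _ he
    omega
  let D : Subcoalgebra K (PathCoalgebra K V) := PathCoalgebra.spanSubcoalgebra T (by
    intro a x b α β h
    have h : PathAlgebra.of K ⟨a, b, α.comp β⟩ ∉ I := h
    rw [← PathAlgebra.of_mul_of] at h
    exact ⟨fun h1 => h (Ideal.mul_mem_left _ _ h1), fun h1 => h (Ideal.mul_mem_right _ _ h1)⟩)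
  let B := PathCoalgebra.pathBasis D T rfl hv
  have hfin : T.Finite := (QPath.finite_setOf_length_lt N).subset hTN
  have : Finite B.T := hfin.to_subtype
  refine ⟨D.toSubmodule, inferInstance, inferInstance, inferInstance,
    Module.Finite.of_basis B.basis, ?_, ⟨e.trans (B.quotientEquiv I fun x => ?_)⟩⟩
  · refine ⟨V, inferInstance, inferInstance, inferInstance, D,
      ⟨fun v => PathCoalgebra.of_mem_span_iff.2 (hv v),
        fun a b e => PathCoalgebra.of_mem_span_iff.2 (ha a b e),
        ⟨N, hN, Submodule.span_mono (Set.image_mono hTN)⟩, T, rfl⟩, ⟨CoalgEquiv.refl K _⟩⟩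
  · refine (PathAlgebra.mem_pathIdeal_iff S x).trans ?_
    have : B.Tᶜ = {p | PathAlgebra.of K p ∈ I} := by
      change {p | PathAlgebra.of K p ∉ I}ᶜ = _
      ext p
      simp
    rw [this]

/-! ### Gaussian binomial coefficients -/

section QBinomial

variable {K : Type*} [Field K]

/-- The Gaussian binomial coefficient `(i + j choose i)_q`. -/
def qbin (q : K) : ℕ → ℕ → K
  | 0, _ => 1
  | _ + 1, 0 => 1
  | i + 1, j + 1 => q ^ (j + 1) * qbin q i (j + 1) + qbin q (i + 1) j

@[simp] theorem qbin_zero_left (q : K) (j : ℕ) : qbin q 0 j = 1 := by rw [qbin]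

@[simp] theorem qbin_zero_right (q : K) (i : ℕ) : qbin q i 0 = 1 := by
  cases i <;> rw [qbin]

theorem qbin_succ_succ (q : K) (i j : ℕ) :
    qbin q (i + 1) (j + 1) = q ^ (j + 1) * qbin q i (j + 1) + qbin q (i + 1) j := by rw [qbin]

/-- The usual product formula with denominators cleared, so that it makes sense at roots of unity
too. -/
theorem qbin_mul_prod (q : K) (i j : ℕ) :
    qbin q i j * ∏ s ∈ Finset.range i, (1 - q ^ (s + 1)) =
      ∏ s ∈ Finset.range i, (1 - q ^ (j + s + 1)) := by
  induction i generalizing j with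
  | zero => simp
  | succ i ih =>
    induction j with
    | zero => simp
    | succ j ihj =>
      have h1 := ih (j + 1)
      rw [qbin_succ_succ, add_mul, ihj, Finset.prod_range_succ, Finset.prod_range_succ',
        Finset.prod_range_succ]
      have h2 : ∏ k ∈ Finset.range i, (1 - q ^ (j + (k + 1) + 1)) =
          ∏ s ∈ Finset.range i, (1 - q ^ (j + 1 + s + 1)) :=
        Finset.prod_congr rfl fun k _ => by ring
      rw [h2, ← h1]
      ring

/-- The numerator contains the factor `1 - q ^ d = 0`, while the denominator only involves exponents
strictly between `0` and `d`. -/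
theorem qbin_eq_zero {q : K} {d : ℕ} (hq : IsPrimitiveRoot q d) {i j : ℕ} (hij : i + j = d)
    (hi : 0 < i) (hj : 0 < j) : qbin q i j = 0 := by
  have h := qbin_mul_prod q i j
  have h1 : ∏ s ∈ Finset.range i, (1 - q ^ (j + s + 1)) = 0 := by
    refine Finset.prod_eq_zero (i := i - 1) (Finset.mem_range.2 (by omega)) ?_
    rw [show j + (i - 1) + 1 = d by omega, hq.pow_eq_one, sub_self]
  rw [h1] at h
  refine (mul_eq_zero.1 h).resolve_right ?_
  refine Finset.prod_ne_zero_iff.2 fun s hs => ?_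
  rw [Finset.mem_range] at hs
  rw [sub_ne_zero]
  exact (hq.pow_ne_one_of_pos_of_lt (by omega) (by omega)).symm

theorem qbin_one_left (q : K) (j : ℕ) : qbin q 1 j = ∑ s ∈ Finset.range (j + 1), q ^ s := by
  induction j with
  | zero => simp
  | succ j ih => rw [qbin_succ_succ, ih, qbin_zero_left, Finset.sum_range_succ _ (j + 1)]; ring

/-- The vanishing of the Gaussian binomial coefficients `(d choose i)_q` characterizes primitive
roots of unity in characteristic zero. -/
theorem isPrimitiveRoot_of_qbin_eq_zero [CharZero K] {q : K} {d : ℕ} (hd : 2 ≤ d)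
    (h : ∀ i j, 0 < i → 0 < j → i + j = d → qbin q i j = 0) : IsPrimitiveRoot q d := by
  -- For `q = 1` the coefficient `(d choose 1)_q` is the integer `d`, nonzero in characteristic
  -- zero.
  have hq1 : q ≠ 1 := by
    rintro rfl
    have := h 1 (d - 1) one_pos (by omega) (by omega)
    rw [qbin_one_left] at this
    simp at this
    norm_cast at this
  have hqd : q ^ d = 1 := by
    have := h 1 (d - 1) one_pos (by omega) (by omega)
    rw [qbin_one_left, show d - 1 + 1 = d by omega] at this
    have h2 := geom_sum_mul q d
    rw [this, zero_mul] at h2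
    exact (sub_eq_zero.1 h2.symm)
  -- With `N` the exact order of `q`, the aim is to exclude `N < d`: the coefficient `(d choose
  -- N)_q` will turn out to be a positive integer.
  obtain ⟨N, hN0, hN, hNd⟩ : ∃ N, 0 < N ∧ IsPrimitiveRoot q N ∧ N ∣ d :=
    ⟨orderOf q, orderOf_pos_iff.2 (isOfFinOrder_iff_pow_eq_one.2 ⟨d, by omega, hqd⟩),
      IsPrimitiveRoot.orderOf q, orderOf_dvd_of_pow_eq_one hqd⟩
  have hN1 : N ≠ 1 := by
    rintro rfl
    exact hq1 (by simpa using hN.pow_eq_one)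
  -- In the product formula the denominator is nonzero. If `N ∣ t`, numerator and denominator agree
  -- factor by factor; otherwise some exponent among `t + 1, …, t + N - 1` is a multiple of `N`.
  have hlow : ∀ t, qbin q (N - 1) t = if N ∣ t then 1 else 0 := by
    intro t
    have h1 := qbin_mul_prod q (N - 1) t
    have h2 : ∏ s ∈ Finset.range (N - 1), (1 - q ^ (s + 1)) ≠ 0 := by
      refine Finset.prod_ne_zero_iff.2 fun s hs => ?_
      rw [Finset.mem_range] at hs
      rw [sub_ne_zero]
      exact (hN.pow_ne_one_of_pos_of_lt (by omega) (by omega)).symm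
    split_ifs with ht
    · refine mul_right_cancel₀ h2 (h1.trans ?_)
      rw [one_mul]
      refine Finset.prod_congr rfl fun s _ => ?_
      rw [add_assoc, pow_add, (hN.pow_eq_one_iff_dvd t).2 ht, one_mul]
    · refine (mul_eq_zero.1 (h1.trans ?_)).resolve_right h2
      have hmod : 0 < t % N := Nat.pos_of_ne_zero fun h0 => ht (Nat.dvd_of_mod_eq_zero h0)
      have hlt := Nat.mod_lt t hN0
      refine Finset.prod_eq_zero (i := N - t % N - 1) (Finset.mem_range.2 (by omega)) ?_
      rw [sub_eq_zero, eq_comm, hN.pow_eq_one_iff_dvd]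
      refine ⟨t / N + 1, ?_⟩
      have := Nat.div_add_mod t N
      rw [mul_add]
      omega
  -- By `hlow`, the Pascal recursion adds `1` each time the second index reaches a multiple of `N`
  -- and `0` otherwise; `m` counts these multiples. Hence `qbin q N j` is never zero in
  -- characteristic zero.
  have hsum : ∀ j, ∃ m : ℕ, qbin q N j = (m : K) + 1 := by
    intro j
    induction j with
    | zero => exact ⟨0, by simp⟩
    | succ j ih =>
      obtain ⟨m, hm⟩ := ih
      obtain ⟨N, rfl⟩ : ∃ M, N = M + 1 := ⟨N - 1, by omega⟩
      rw [qbin_succ_succ, hm]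
      have := hlow (j + 1)
      rw [Nat.add_sub_cancel] at this
      rw [this]
      split_ifs with hdvd
      · exact ⟨m + 1, by rw [(hN.pow_eq_one_iff_dvd _).2 hdvd]; push_cast; ring⟩
      · exact ⟨m, by ring⟩
  rcases (Nat.le_of_dvd (by omega) hNd).eq_or_lt with rfl | hlt
  · exact hN
  · obtain ⟨m, hm⟩ := hsum (d - N)
    rw [h N (d - N) hN0 (by omega) (by omega)] at hm
    exact absurd hm.symm (Nat.cast_add_one_ne_zero m)

/-- The `q`-binomial theorem. Multiplying by `y` on the left moves it past `z ^ j` at the cost of `q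
^ j`, which is the weight in the Pascal recursion of `qbin`. -/
theorem add_pow_eq_sum_qbin {B : Type*} [Ring B] [Algebra K B] {q : K} {y z : B}
    (h : y * z = q • (z * y)) (k : ℕ) :
    (y + z) ^ k = ∑ p ∈ Finset.HasAntidiagonal.antidiagonal k,
      qbin q p.1 p.2 • (z ^ p.2 * y ^ p.1) := by
  have hy : ∀ j, y * z ^ j = q ^ j • (z ^ j * y) := by
    intro j
    induction j with
    | zero => simp
    | succ j ih =>
      rw [pow_succ', ← mul_assoc, h, smul_mul_assoc, mul_assoc, ih, mul_smul_comm, smul_smul,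
        ← pow_succ', mul_assoc]
  induction k with
  | zero => simp
  | succ k ih =>
    -- The two halves of the Pascal recursion, set to zero at the boundary index where the
    -- corresponding half is absent; there the other half supplies the whole coefficient.
    let g : ℕ × ℕ → B := fun p => (if p.1 = 0 then 0 else q ^ p.2 * qbin q (p.1 - 1) p.2) •
      (z ^ p.2 * y ^ p.1)
    let g' : ℕ × ℕ → B := fun p => (if p.2 = 0 then 0 else qbin q p.1 (p.2 - 1)) •
      (z ^ p.2 * y ^ p.1)
    have h1 : ∀ p ∈ Finset.HasAntidiagonal.antidiagonal (k + 1),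
        qbin q p.1 p.2 • (z ^ p.2 * y ^ p.1) = g p + g' p := by
      rintro ⟨i, j⟩ hp
      rw [Finset.HasAntidiagonal.mem_antidiagonal] at hp
      rw [← add_smul]
      rcases i with _ | i <;> rcases j with _ | j
      · simp at hp
      · simp
      · simp
      · simp [qbin_succ_succ]
    rw [Finset.sum_congr rfl h1, Finset.sum_add_distrib, Finset.Nat.sum_antidiagonal_succ,
      Finset.Nat.sum_antidiagonal_succ' (f := g'), pow_succ', ih, Finset.mul_sum,
      show g (0, k + 1) = 0 by simp [g], show g' (k + 1, 0) = 0 by simp [g'], zero_add, zero_add,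
      ← Finset.sum_add_distrib]
    refine Finset.sum_congr rfl fun p _ => ?_
    simp only [g, g', Nat.add_sub_cancel, Nat.succ_ne_zero, if_false, add_mul, mul_smul_comm]
    rw [← mul_assoc, hy, ← mul_assoc, ← pow_succ', smul_mul_assoc, smul_add,
      smul_smul, mul_assoc, ← pow_succ', mul_comm (qbin q p.1 p.2)]

theorem add_pow_eq_of_isPrimitiveRoot {B : Type*} [Ring B] [Algebra K B] {q : K} {d : ℕ}
    (hd : 0 < d) (hq : IsPrimitiveRoot q d) {y z : B} (h : y * z = q • (z * y)) :
    (y + z) ^ d = y ^ d + z ^ d := by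
  rw [add_pow_eq_sum_qbin h, Finset.sum_eq_add (d, 0) (0, d)]
  · simp
  · intro h0
    cases h0
    omega
  · rintro ⟨i, j⟩ hp ⟨h1, h2⟩
    rw [Finset.HasAntidiagonal.mem_antidiagonal] at hp
    dsimp only at hp
    rw [qbin_eq_zero hq hp, zero_smul]
    · rcases Nat.eq_zero_or_pos i with rfl | hi
      · exact absurd (by rw [← hp, zero_add]) h2
      · exact hi
    · rcases Nat.eq_zero_or_pos j with rfl | hj
      · exact absurd (by rw [← hp, add_zero]) h1
      · exact hj
  · simp
  · simp

end QBinomial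

/-! ### The algebra of a basic cycle: presentation -/

namespace BasicCycle

variable {n : ℕ}

/-- The index modulo `n` of a vertex of the basic cycle. -/
def idx (v : BasicCycle n) : ZMod n := v

/-- The vertex of the basic cycle with a given index modulo `n`. -/
def ofIdx (i : ZMod n) : BasicCycle n := i

@[simp] theorem ofIdx_idx (v : BasicCycle n) : ofIdx v.idx = v := rfl

theorem idx_injective : Function.Injective (idx : BasicCycle n → ZMod n) := fun _ _ h => h

theorem idx_of_hom {v w : BasicCycle n} (e : v ⟶ w) : w.idx = v.idx + 1 := e.down

/-- The arrow between consecutive vertices of the basic cycle. -/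
def hom {v w : BasicCycle n} (h : w.idx = v.idx + 1) : v ⟶ w := ⟨h⟩

theorem hom_unique {v w : BasicCycle n} (e f : v ⟶ w) : e = f :=
  Subsingleton.elim (α := PLift (w.idx = v.idx + 1)) e f

theorem tgt_eq {v w : BasicCycle n} (p : Quiver.Path v w) : w.idx = v.idx + p.length := by
  induction p with
  | nil => simp
  | cons p e ih =>
    refine (idx_of_hom e).trans ?_
    rw [ih, Quiver.Path.length_cons]
    push_cast
    ring

end BasicCycle

namespace CycleAlgebra

variable {K : Type*} [Field K] {n d : ℕ} [NeZero n]

section Lift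

variable {B : Type*} [Ring B] [Algebra K B]

/-- Elements satisfying the relations of the vertices and of the sum of the arrows of a truncated
basic cycle algebra. -/
structure Relations (d : ℕ) (E : ZMod n → B) (X : B) : Prop where
  sum : ∑ i, E i = 1
  mul : ∀ i j, E i * E j = if i = j then E i else 0
  comm : ∀ i, X * E i = E (i + 1) * X
  pow : X ^ d = 0

theorem Relations.pow_mul {E : ZMod n → B} {X : B} (h : Relations d E X) (k : ℕ) (i : ZMod n) :
    X ^ k * E i = E (i + k) * X ^ k := by
  induction k with
  | zero => simp
  | succ k ih =>
    rw [pow_succ', mul_assoc, ih, ← mul_assoc, h.comm, mul_assoc]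
    push_cast
    rw [add_assoc]

/-- The algebra homomorphism out of the path algebra of a basic cycle determined by the images of
the vertices and of the sum of the arrows. -/
def pathLift {E : ZMod n → B} {X : B} (h : Relations d E X) :
    PathAlgebra K (BasicCycle n) →ₐ[K] B :=
  AlgHom.ofLinearMap
    -- In a basic cycle a path is determined by its source and its length, so its image must be a
    -- power of `X` times the idempotent of the source.
    ((PathAlgebra.basis K (BasicCycle n)).constr K fun p => X ^ p.length * E p.src.idx)
    (by
      change (PathAlgebra.basis K _).constr K _ PathAlgebra.unit = 1
      simp only [PathAlgebra.unit, PathAlgebra.of, map_sum, Module.Basis.constr_basis]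
      refine Eq.trans (Finset.sum_congr rfl fun i _ => ?_) h.sum
      change X ^ 0 * E (BasicCycle.idx i) = E (BasicCycle.idx i)
      simp)
    (by
      intro x y
      induction x using PathAlgebra.ind with
      | h0 => simp
      | ha x x' h h' => simp only [map_add, h, h', add_mul]
      | hs a p =>
      induction y using PathAlgebra.ind with
      | h0 => simp
      | ha x x' h h' => simp only [map_add, h, h', mul_add]
      | hs b q =>
      simp only [map_smul, smul_mul_smul_comm]
      congr 1
      obtain ⟨p₁, p₂, p⟩ := p
      obtain ⟨q₁, q₂, q⟩ := q
      have hmul : (X ^ p.length * E p₁.idx) * (X ^ q.length * E q₁.idx) =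
          X ^ p.length * (E p₁.idx * E q₂.idx) * X ^ q.length := by
        rw [h.pow_mul q.length, ← BasicCycle.tgt_eq q]
        simp only [mul_assoc]
      by_cases hpq : q₂ = p₁
      · subst hpq
        rw [PathAlgebra.of_mul_of]
        simp only [PathAlgebra.of, Module.Basis.constr_basis]
        refine Eq.trans ?_ hmul.symm
        rw [h.mul, if_pos rfl, mul_assoc]
        change X ^ (q.comp p).length * E q₁.idx = _
        rw [Quiver.Path.length_comp, add_comm, pow_add, mul_assoc, h.pow_mul, ← BasicCycle.tgt_eq q]
      · rw [PathAlgebra.of_mul_of_ne (p := ⟨p₁, p₂, p⟩) (q := ⟨q₁, q₂, q⟩) hpq]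
        simp only [PathAlgebra.of, Module.Basis.constr_basis, map_zero]
        refine Eq.trans ?_ hmul.symm
        rw [h.mul, if_neg (fun h => hpq (BasicCycle.idx_injective h.symm)), mul_zero, zero_mul])

theorem pathLift_of {E : ZMod n → B} {X : B} (h : Relations d E X) (p : QPath (BasicCycle n)) :
    pathLift (K := K) h (PathAlgebra.of K p) = X ^ p.length * E p.src.idx :=
  (PathAlgebra.basis K _).constr_basis K _ p

/-- The universal property of the algebra of a truncated basic cycle. -/
def lift {E : ZMod n → B} {X : B} (h : Relations d E X) : CycleAlgebra K n d →ₐ[K] B :=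
  Ideal.Quotient.liftₐ _ (pathLift h) fun x hx => by
    rw [PathAlgebra.mem_arrowIdeal_pow_iff] at hx
    refine (Submodule.span_le (p := LinearMap.ker (pathLift (K := K) h).toLinearMap)).2 ?_ hx
    rintro _ ⟨p, hp, rfl⟩
    change pathLift h (PathAlgebra.of K p) = 0
    have hp : d ≤ p.length := hp
    rw [pathLift_of, ← Nat.add_sub_cancel' hp, pow_add, h.pow, zero_mul, zero_mul]

end Lift

variable (K d) in
/-- The vertices in the algebra of a truncated basic cycle. -/
def E (i : ZMod n) : CycleAlgebra K n d :=
  Ideal.Quotient.mk _ (PathAlgebra.of K (QPath.vertex (BasicCycle.ofIdx i)))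

/-- The arrow of a basic cycle starting at a vertex. -/
def arrow (i : ZMod n) : QPath (BasicCycle n) :=
  QPath.arrow (BasicCycle.hom (v := .ofIdx i) (w := .ofIdx (i + 1)) rfl)

variable (K n d) in
/-- The sum of the arrows in the algebra of a truncated basic cycle. -/
def X : CycleAlgebra K n d :=
  Ideal.Quotient.mk _ (∑ i : ZMod n, PathAlgebra.of K (arrow i))

/-- Only one arrow leaves the target of the path, so a single summand survives. Thus the sum of all
arrows acts as "continue by one arrow", and every path becomes a power of it times a vertex. -/
theorem sum_arrow_mul_of {i j : BasicCycle n} (p : Quiver.Path i j) {l : BasicCycle n}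
    (e : j ⟶ l) : (∑ i : ZMod n, PathAlgebra.of K (arrow i)) * PathAlgebra.of K ⟨i, j, p⟩ =
      PathAlgebra.of K ⟨i, l, p.cons e⟩ := by
  obtain rfl : l = .ofIdx (j.idx + 1) := BasicCycle.idx_of_hom e
  rw [Finset.sum_mul, Finset.sum_eq_single j.idx]
  · exact PathAlgebra.of_mul_of p _
  · intro b _ hb
    exact PathAlgebra.of_mul_of_ne (p := arrow b) (q := ⟨i, j, p⟩) hb.symm
  · exact fun h => absurd (Finset.mem_univ _) h

theorem mk_of (p : QPath (BasicCycle n)) :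
    (Ideal.Quotient.mk _ (PathAlgebra.of K p) : CycleAlgebra K n d) =
      X K n d ^ p.length * E K d p.src.idx := by
  obtain ⟨i, j, p⟩ := p
  induction p with
  | nil => simp [QPath.length, E, QPath.vertex]
  | cons p e ih =>
    rw [← sum_arrow_mul_of, map_mul, ih]
    change X K n d * _ = X K n d ^ (p.length + 1) * _
    rw [pow_succ', mul_assoc]
    rfl

variable (K n d) in
theorem relations : Relations d (E K d) (X K n d) where
  sum := by
    simp only [E, ← map_sum]
    exact map_one (Ideal.Quotient.mk _)
  mul i j := by
    rw [E, E, ← map_mul]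
    split_ifs with h
    · subst h
      exact congrArg _ (PathAlgebra.of_mul_of Quiver.Path.nil Quiver.Path.nil)
    · rw [PathAlgebra.of_mul_of_ne (fun h' => h h'.symm), map_zero]
  comm i := by
    rw [E, E, X, ← map_mul, ← map_mul]
    congr 1
    let e : BasicCycle.ofIdx i ⟶ BasicCycle.ofIdx (i + 1) := BasicCycle.hom rfl
    refine (sum_arrow_mul_of (n := n) Quiver.Path.nil e).trans ?_
    rw [Finset.mul_sum, Finset.sum_eq_single i]
    · exact (PathAlgebra.of_mul_of e.toPath Quiver.Path.nil).symm
    · intro b _ hb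
      refine PathAlgebra.of_mul_of_ne (p := QPath.vertex _) (q := arrow b) fun h => hb ?_
      exact add_right_cancel (h : b + 1 = i + 1)
    · simp
  pow := by
    rw [X, ← map_pow]
    refine Ideal.Quotient.eq_zero_iff_mem.2 ?_
    refine Submodule.pow_mem_pow _ (sum_mem fun i _ => ?_) d
    exact TwoSidedIdeal.mem_asIdeal.2 (TwoSidedIdeal.subset_span
      (Set.mem_image_of_mem _ ⟨_, _, _, rfl⟩))

@[simp] theorem lift_E {B : Type*} [Ring B] [Algebra K B] {E' : ZMod n → B} {X' : B}
    (h : Relations d E' X') (i : ZMod n) : lift (K := K) h (E K d i) = E' i := by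
  change pathLift (K := K) h (PathAlgebra.of K _) = _
  rw [pathLift_of]
  change X' ^ 0 * E' i = _
  simp

@[simp] theorem lift_X {B : Type*} [Ring B] [Algebra K B] {E' : ZMod n → B} {X' : B}
    (h : Relations d E' X') : lift (K := K) h (X K n d) = X' := by
  change pathLift (K := K) h (∑ i : ZMod n, PathAlgebra.of K (arrow i)) = _
  rw [map_sum]
  have : ∀ i : ZMod n, pathLift (K := K) h (PathAlgebra.of K (arrow i)) = X' * E' i := by
    intro i
    rw [pathLift_of]
    change X' ^ 1 * E' i = _
    rw [pow_one]
  simp only [this, ← Finset.mul_sum, h.sum, mul_one]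

theorem adjoin_eq_top :
    Algebra.adjoin K (Set.range (E K d) ∪ {X K n d}) = (⊤ : Subalgebra K (CycleAlgebra K n d)) := by
  refine eq_top_iff.2 fun x hx => ?_
  clear hx
  obtain ⟨x, rfl⟩ := Ideal.Quotient.mk_surjective x
  induction x using PathAlgebra.ind with
  | h0 => rw [map_zero]; exact zero_mem _
  | ha x y hx hy => rw [map_add]; exact add_mem hx hy
  | hs c p =>
    have h1 : (Ideal.Quotient.mk (PathAlgebra.arrowIdeal K (BasicCycle n) ^ d)
        (c • PathAlgebra.of K p)) = c • (X K n d ^ p.length * E K d p.src.idx) := by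
      rw [← mk_of]
      rfl
    rw [h1]
    have hX : X K n d ∈ Algebra.adjoin K (Set.range (E K d) ∪ {X K n d}) :=
      Algebra.subset_adjoin (Set.mem_union_right _ rfl)
    have hE : E K d p.src.idx ∈ Algebra.adjoin K (Set.range (E K d) ∪ {X K n d}) :=
      Algebra.subset_adjoin (Set.mem_union_left _ ⟨_, rfl⟩)
    exact Subalgebra.smul_mem _ (mul_mem (pow_mem hX _) hE) c

theorem algHom_ext {B : Type*} [Ring B] [Algebra K B] {f g : CycleAlgebra K n d →ₐ[K] B}
    (hE : ∀ i, f (E K d i) = g (E K d i)) (hX : f (X K n d) = g (X K n d)) : f = g := by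
  refine AlgHom.ext_of_adjoin_eq_top adjoin_eq_top ?_
  rintro _ (⟨i, rfl⟩ | rfl)
  · exact hE i
  · exact hX

theorem ext_mul_E {a b : CycleAlgebra K n d} (h : ∀ i, a * E K d i = b * E K d i) : a = b := by
  rw [← mul_one a, ← mul_one b, ← (relations K n d).sum, Finset.mul_sum, Finset.mul_sum]
  exact Finset.sum_congr rfl fun i _ => h i

end CycleAlgebra

/-! ### Antipodes on generators -/

section Antipode

variable {K : Type*} [Field K] {A : Type*} [Ring A] [Algebra K A] {Δ : A →ₐ[K] A ⊗[K] A}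
  {ε : A →ₐ[K] K} {S : A →ₗ[K] A} {s : Set A}

/-- The left antipode axiom can be checked on generators. -/
theorem mul_antipode_rTensor_of_adjoin (hs : Algebra.adjoin K s = ⊤) (hone : S 1 = 1)
    (hmul : ∀ a b, S (a * b) = S b * S a)
    (h : ∀ a ∈ s, LinearMap.mul' K A (S.rTensor A (Δ a)) = algebraMap K A (ε a)) (a : A) :
    LinearMap.mul' K A (S.rTensor A (Δ a)) = algebraMap K A (ε a) := by
  -- As `S` reverses products, the contraction of the left factor `u` ends up between `S x` and `y`;
  -- being a scalar, it can be pulled out. The axiom is therefore stable under products.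
  have key : ∀ u v : A ⊗[K] A, ∀ c : K, LinearMap.mul' K A (S.rTensor A u) = algebraMap K A c →
      LinearMap.mul' K A (S.rTensor A (u * v)) = c • LinearMap.mul' K A (S.rTensor A v) := by
    intro u v c hu
    induction v with
    | zero => simp
    | add x y hx hy => simp only [mul_add, map_add, smul_add, hx, hy]
    | tmul x y =>
      have h1 : ∀ u : A ⊗[K] A, LinearMap.mul' K A (S.rTensor A (u * x ⊗ₜ[K] y)) =
          S x * LinearMap.mul' K A (S.rTensor A u) * y := by
        intro u
        induction u with
        | zero => simp
        | add x y hx hy => simp only [add_mul, mul_add, map_add, hx, hy]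
        | tmul u v =>
          simp only [Algebra.TensorProduct.tmul_mul_tmul, LinearMap.rTensor_tmul,
            LinearMap.mul'_apply, hmul, mul_assoc]
      rw [h1, hu, ← Algebra.commutes, mul_assoc, ← Algebra.smul_def, LinearMap.rTensor_tmul,
        LinearMap.mul'_apply]
  have ha : a ∈ Algebra.adjoin K s := by
    rw [hs]
    trivial
  induction ha using Algebra.adjoin_induction with
  | algebraMap r =>
    rw [AlgHom.commutes, AlgHom.commutes, Algebra.TensorProduct.algebraMap_apply,
      LinearMap.rTensor_tmul, LinearMap.mul'_apply, mul_one, Algebra.algebraMap_eq_smul_one,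
      map_smul, hone]
    simp [Algebra.algebraMap_eq_smul_one]
  | add x y _ _ hx hy => simp only [map_add, hx, hy]
  | mul x y _ _ hx hy =>
    rw [map_mul, key _ _ _ hx, hy, map_mul, map_mul, ← Algebra.smul_def]
  | mem x hx => exact h x hx

/-- The right antipode axiom can be checked on generators. -/
theorem mul_antipode_lTensor_of_adjoin (hs : Algebra.adjoin K s = ⊤) (hone : S 1 = 1)
    (hmul : ∀ a b, S (a * b) = S b * S a)
    (h : ∀ a ∈ s, LinearMap.mul' K A (S.lTensor A (Δ a)) = algebraMap K A (ε a)) (a : A) :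
    LinearMap.mul' K A (S.lTensor A (Δ a)) = algebraMap K A (ε a) := by
  have key : ∀ u v : A ⊗[K] A, ∀ c : K, LinearMap.mul' K A (S.lTensor A v) = algebraMap K A c →
      LinearMap.mul' K A (S.lTensor A (u * v)) = c • LinearMap.mul' K A (S.lTensor A u) := by
    intro u v c hv
    induction u with
    | zero => simp
    | add x y hx hy => simp only [add_mul, map_add, smul_add, hx, hy]
    | tmul x y =>
      have h1 : ∀ v : A ⊗[K] A, LinearMap.mul' K A (S.lTensor A (x ⊗ₜ[K] y * v)) =
          x * LinearMap.mul' K A (S.lTensor A v) * S y := by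
        intro v
        induction v with
        | zero => simp
        | add x y hx hy => simp only [add_mul, mul_add, map_add, hx, hy]
        | tmul u v =>
          simp only [Algebra.TensorProduct.tmul_mul_tmul, LinearMap.lTensor_tmul,
            LinearMap.mul'_apply, hmul, mul_assoc]
      rw [h1, hv, ← Algebra.commutes, mul_assoc, ← Algebra.smul_def, LinearMap.lTensor_tmul,
        LinearMap.mul'_apply]
  have ha : a ∈ Algebra.adjoin K s := by
    rw [hs]
    trivial
  induction ha using Algebra.adjoin_induction with
  | algebraMap r =>
    rw [AlgHom.commutes, AlgHom.commutes, Algebra.TensorProduct.algebraMap_apply,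
      LinearMap.lTensor_tmul, LinearMap.mul'_apply, hone, mul_one]
    rfl
  | add x y _ _ hx hy => simp only [map_add, hx, hy]
  | mul x y _ _ hx hy =>
    rw [map_mul, key _ _ _ hy, hx, map_mul, map_mul, ← Algebra.commutes, ← Algebra.smul_def]
  | mem x hx => exact h x hx

end Antipode

/-! ### The Hopf algebra structure on the algebra of a truncated basic cycle -/

namespace CycleAlgebra

variable {K : Type*} [Field K] {n d : ℕ} [NeZero n]

theorem mul_E (i j : ZMod n) : E K d i * E K d j = if i = j then E K d i else 0 :=
  (relations K n d).mul i j

theorem X_mul_E (i : ZMod n) : X K n d * E K d i = E K d (i + 1) * X K n d :=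
  (relations K n d).comm i

theorem sum_E_sub (j : ZMod n) : ∑ i, E K d (i - j) = 1 :=
  (Equiv.sum_comp (Equiv.subRight j) (E K d)).trans (relations K n d).sum

variable (d) in
/-- The diagonal element with eigenvalues `χ`. -/
def diag (χ : ZMod n → K) : CycleAlgebra K n d := ∑ i, χ i • E K d i

theorem diag_mul_E (χ : ZMod n → K) (i : ZMod n) : diag d χ * E K d i = χ i • E K d i := by
  rw [diag, Finset.sum_mul, Finset.sum_eq_single i]
  · rw [smul_mul_assoc, mul_E, if_pos rfl]
  · intro j _ hj
    rw [smul_mul_assoc, mul_E, if_neg hj, smul_zero]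
  · simp

theorem E_mul_diag (χ : ZMod n → K) (i : ZMod n) : E K d i * diag d χ = χ i • E K d i := by
  rw [diag, Finset.mul_sum, Finset.sum_eq_single i]
  · rw [mul_smul_comm, mul_E, if_pos rfl]
  · intro j _ hj
    rw [mul_smul_comm, mul_E, if_neg hj.symm, smul_zero]
  · simp

theorem diag_mul_diag (χ ψ : ZMod n → K) : diag d χ * diag d ψ = diag d (χ * ψ) := by
  refine ext_mul_E fun i => ?_
  rw [mul_assoc, diag_mul_E, mul_smul_comm, diag_mul_E, diag_mul_E, smul_smul, mul_comm]
  rfl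

theorem diag_one : diag d (1 : ZMod n → K) = 1 := by
  refine ext_mul_E fun i => ?_
  rw [diag_mul_E, one_mul]
  simp

section Hopf

variable (χ : AddChar (ZMod n) K)

/-- The character `χ` as an element of the algebra. -/
abbrev charElem (d : ℕ) : CycleAlgebra K n d := diag d χ

/-- The inverse of `charElem`. -/
abbrev charElemInv (d : ℕ) : CycleAlgebra K n d := diag d fun i => χ (-i)

theorem charElemInv_mul : charElemInv χ d * charElem χ d = 1 := by
  rw [diag_mul_diag, ← diag_one]
  congr 1
  funext i
  change χ (-i) * χ i = 1
  rw [← AddChar.map_add_eq_mul, neg_add_cancel, AddChar.map_zero_eq_one]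

theorem charElem_mul_X : charElem χ d * X K n d = χ 1 • (X K n d * charElem χ d) := by
  refine ext_mul_E fun i => ?_
  rw [mul_assoc, X_mul_E, ← mul_assoc, diag_mul_E, smul_mul_assoc, smul_mul_assoc, mul_assoc,
    diag_mul_E, mul_smul_comm, X_mul_E, smul_smul, AddChar.map_add_eq_mul, mul_comm]

/-- The images of the vertices under the comultiplication. -/
def comulE (i : ZMod n) : CycleAlgebra K n d ⊗[K] CycleAlgebra K n d :=
  ∑ j, E K d j ⊗ₜ E K d (i - j)

/-- The relations for the vertices are the group law of `ZMod n` dualised. For the last one, moving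
`k` past `X` costs `χ 1`, so the two summands of `Δ(X)` `q`-commute; with `χ 1` a primitive `d`-th
root of unity the mixed terms of the `d`-th power disappear, and each summand has zero `d`-th power.
-/
theorem comul_relations (hd : 0 < d) (hχ : IsPrimitiveRoot (χ 1) d) :
    Relations d (comulE (K := K) (n := n) (d := d))
      (X K n d ⊗ₜ[K] charElem χ d + 1 ⊗ₜ[K] X K n d) where
  sum := by
    simp only [comulE]
    rw [Finset.sum_comm]
    simp only [← TensorProduct.tmul_sum, sum_E_sub, ← TensorProduct.sum_tmul]
    rw [(relations K n d).sum]
    rfl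
  mul i i' := by
    simp only [comulE, Finset.sum_mul_sum, Algebra.TensorProduct.tmul_mul_tmul, mul_E]
    split_ifs with h
    · subst h
      refine Finset.sum_congr rfl fun j _ => ?_
      rw [Finset.sum_eq_single j]
      · simp
      · intro l _ hl
        rw [if_neg hl.symm, TensorProduct.zero_tmul]
      · simp
    · refine Finset.sum_eq_zero fun j _ => Finset.sum_eq_zero fun l _ => ?_
      split_ifs with h1 h2
      · exact absurd (by simpa [h1] using h2) h
      all_goals simp
  comm i := by
    simp only [comulE, Finset.mul_sum, Finset.sum_mul, add_mul, mul_add,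
      Algebra.TensorProduct.tmul_mul_tmul, one_mul, mul_one, Finset.sum_add_distrib]
    congr 1
    · rw [← Equiv.sum_comp (Equiv.addRight (1 : ZMod n))
        fun j => (E K d j * X K n d) ⊗ₜ[K] (E K d (i + 1 - j) * charElem χ d)]
      refine Finset.sum_congr rfl fun j _ => ?_
      rw [X_mul_E, diag_mul_E, Equiv.coe_addRight, E_mul_diag]
      simp
    · refine Finset.sum_congr rfl fun j _ => ?_
      rw [X_mul_E, show i - j + 1 = i + 1 - j by ring]
  pow := by
    rw [add_pow_eq_of_isPrimitiveRoot hd hχ]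
    · rw [Algebra.TensorProduct.tmul_pow, Algebra.TensorProduct.tmul_pow, (relations K n d).pow]
      simp
    · simp only [Algebra.TensorProduct.tmul_mul_tmul, one_mul, mul_one, charElem_mul_X,
        TensorProduct.tmul_smul]

theorem counit_relations (hd : 0 < d) :
    Relations d (fun i : ZMod n => if i = 0 then (1 : K) else 0) (0 : K) where
  sum := by simp
  mul i j := by
    split_ifs <;> simp_all
  comm i := by simp
  pow := zero_pow hd.ne'

/-- Diagonal elements act by scalars on each vertex idempotent, so collecting them to one side only
changes a scalar. This makes the antipode image `-(X k⁻¹)` nilpotent of the right order. -/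
theorem X_mul_inv_pow (k : ℕ) (i : ZMod n) :
    ∃ c : K, (X K n d * charElemInv χ d) ^ k * E K d i = c • (X K n d ^ k * E K d i) := by
  induction k with
  | zero => exact ⟨1, by simp⟩
  | succ k ih =>
    obtain ⟨c, hc⟩ := ih
    refine ⟨c * χ (-(i + k)), ?_⟩
    rw [pow_succ', mul_assoc, hc, (relations K n d).pow_mul, mul_smul_comm, mul_assoc,
      ← mul_assoc (charElemInv χ d), diag_mul_E, smul_mul_assoc, mul_smul_comm, smul_smul,
      ← (relations K n d).pow_mul, ← mul_assoc, pow_succ']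

theorem antipode_relations :
    Relations d (fun i : ZMod n => MulOpposite.op (E K d (-i)))
      (MulOpposite.op (-(X K n d * charElemInv χ d))) where
  sum := by
    have h := Equiv.sum_comp (Equiv.neg (ZMod n)) (E K d)
    simp only [Equiv.neg_apply] at h
    rw [← Finset.op_sum, h, (relations K n d).sum]
    rfl
  mul i j := by
    rw [← MulOpposite.op_mul, mul_E]
    split_ifs with h1 h2 h2
    · rw [h2]
    · exact absurd (neg_injective h1).symm h2
    · exact absurd (by rw [h2]) h1
    · rfl
  comm i := by
    rw [← MulOpposite.op_mul, ← MulOpposite.op_mul]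
    congr 1
    rw [neg_mul, mul_neg, mul_assoc, diag_mul_E, ← mul_assoc, 
      show -i = -(i + 1) + 1 by ring, ← X_mul_E, mul_assoc, E_mul_diag]
  pow := by
    rw [← MulOpposite.op_pow, neg_pow]
    have : (X K n d * charElemInv χ d) ^ d = 0 := by
      refine ext_mul_E fun i => ?_
      obtain ⟨c, hc⟩ := X_mul_inv_pow (d := d) χ d i
      rw [hc, (relations K n d).pow]
      simp
    rw [this, mul_zero]
    rfl

theorem comul_charElem {Δ : CycleAlgebra K n d →ₐ[K] CycleAlgebra K n d ⊗[K] CycleAlgebra K n d}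
    (hΔ : ∀ i, Δ (E K d i) = comulE i) :
    Δ (charElem χ d) = charElem χ d ⊗ₜ charElem χ d := by
  simp only [diag, map_sum, map_smul, hΔ, comulE, TensorProduct.sum_tmul, TensorProduct.tmul_sum,
    Finset.smul_sum]
  rw [Finset.sum_comm]
  refine Eq.trans (Finset.sum_congr rfl fun j _ => ?_) Finset.sum_comm
  rw [← Equiv.sum_comp (Equiv.addRight j)]
  refine Finset.sum_congr rfl fun i _ => ?_
  simp [AddChar.map_add_eq_mul, TensorProduct.smul_tmul', TensorProduct.tmul_smul, smul_smul]

/-- The algebra of the basic cycle of length `n` truncated at `d` admits a Hopf algebra structure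
if there is a primitive `d`-th root of unity which is a value of a character of `ℤ/n`. -/
theorem admitsHopf_of_addChar (hd : 0 < d) (hχ : IsPrimitiveRoot (χ 1) d) :
    Algebra.AdmitsHopf K (CycleAlgebra K n d) := by
  let A := CycleAlgebra K n d
  let Δ : A →ₐ[K] A ⊗[K] A := lift (comul_relations χ hd hχ)
  let ε : A →ₐ[K] K := lift (counit_relations hd)
  -- Taking the antipode as a homomorphism to the opposite algebra lets the universal property
  -- define it and makes it reverse products automatically; its axioms then need checking only on
  -- vertices and on `X`.
  let S : A →ₐ[K] Aᵐᵒᵖ := lift (antipode_relations χ)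
  have hΔE : ∀ i, Δ (E K d i) = comulE i := fun i => lift_E _ i
  have hΔX : Δ (X K n d) = X K n d ⊗ₜ[K] charElem χ d + 1 ⊗ₜ[K] X K n d := lift_X _
  have hΔk : Δ (charElem χ d) = charElem χ d ⊗ₜ charElem χ d := comul_charElem χ hΔE
  have hεE : ∀ i, ε (E K d i) = if i = 0 then 1 else 0 := fun i => lift_E _ i
  have hεX : ε (X K n d) = 0 := lift_X _
  have hεk : ε (charElem χ d) = 1 := by
    simp [diag, hεE]
  have hSE : ∀ i, S (E K d i) = MulOpposite.op (E K d (-i)) := fun i => lift_E _ i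
  have hSX : S (X K n d) = MulOpposite.op (-(X K n d * charElemInv χ d)) := lift_X _
  have hSk : S (charElem χ d) = MulOpposite.op (charElemInv χ d) := by
    simp only [diag, map_sum, map_smul, hSE, ← MulOpposite.op_smul, ← Finset.op_sum]
    congr 1
    rw [← Equiv.sum_comp (Equiv.neg (ZMod n))]
    simp
  let Bi : Bialgebra K A := Bialgebra.ofAlgHom Δ ε
    (by
      refine algHom_ext (fun i => ?_) ?_
      · change TensorProduct.assoc K A A A (Algebra.TensorProduct.map Δ (.id K A) (Δ (E K d i))) =
          Algebra.TensorProduct.map (.id K A) Δ (Δ (E K d i))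
        simp only [hΔE, comulE, map_sum, Algebra.TensorProduct.map_tmul, AlgHom.id_apply,
          TensorProduct.sum_tmul, TensorProduct.tmul_sum, TensorProduct.assoc_tmul]
        rw [Finset.sum_comm]
        refine Finset.sum_congr rfl fun j _ => ?_
        rw [← Equiv.sum_comp (Equiv.addRight j)]
        refine Finset.sum_congr rfl fun l _ => ?_
        rw [Equiv.coe_addRight, add_sub_cancel_right, show i - (l + j) = i - j - l by ring]
      · change TensorProduct.assoc K A A A
            (Algebra.TensorProduct.map Δ (.id K A) (Δ (X K n d))) =
          Algebra.TensorProduct.map (.id K A) Δ (Δ (X K n d))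
        simp only [hΔX, map_add, Algebra.TensorProduct.map_tmul, AlgHom.id_apply, hΔk, map_one,
          TensorProduct.add_tmul, TensorProduct.tmul_add, Algebra.TensorProduct.one_def,
          TensorProduct.assoc_tmul]
        abel)
    (by
      refine algHom_ext (fun i => ?_) ?_
      · change Algebra.TensorProduct.map ε (.id K A) (Δ (E K d i)) = 1 ⊗ₜ E K d i
        simp only [hΔE, comulE, map_sum, Algebra.TensorProduct.map_tmul, AlgHom.id_apply, hεE]
        rw [Finset.sum_eq_single 0]
        · simp
        · intro j _ hj
          simp [hj]
        · simp
      · change Algebra.TensorProduct.map ε (.id K A) (Δ (X K n d)) = 1 ⊗ₜ X K n d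
        simp only [hΔX, map_add, Algebra.TensorProduct.map_tmul, AlgHom.id_apply, hεX, map_one,
          TensorProduct.zero_tmul, zero_add])
    (by
      refine algHom_ext (fun i => ?_) ?_
      · change Algebra.TensorProduct.map (.id K A) ε (Δ (E K d i)) = E K d i ⊗ₜ 1
        simp only [hΔE, comulE, map_sum, Algebra.TensorProduct.map_tmul, AlgHom.id_apply, hεE]
        rw [Finset.sum_eq_single i]
        · simp
        · intro j _ hj
          rw [if_neg (fun h => hj (sub_eq_zero.1 h).symm), TensorProduct.tmul_zero]
        · simp
      · change Algebra.TensorProduct.map (.id K A) ε (Δ (X K n d)) = X K n d ⊗ₜ 1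
        simp only [hΔX, map_add, Algebra.TensorProduct.map_tmul, AlgHom.id_apply, hεX, hεk,
          TensorProduct.tmul_zero, add_zero])
  let S' : A →ₗ[K] A := (MulOpposite.opLinearEquiv K).symm.toLinearMap ∘ₗ S.toLinearMap
  have hS' : ∀ a, S' a = (S a).unop := fun a => rfl
  have hS'mul : ∀ a b, S' (a * b) = S' b * S' a := fun a b => by
    rw [hS', map_mul, MulOpposite.unop_mul]
    rfl
  have hR := mul_antipode_rTensor_of_adjoin (Δ := Δ) (ε := ε) (S := S') (adjoin_eq_top (d := d))
    (by rw [hS', map_one, MulOpposite.unop_one]) hS'mul (by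
      rintro _ (⟨i, rfl⟩ | rfl)
      · rw [hΔE, comulE, map_sum, map_sum, hεE]
        have : ∀ j : ZMod n, LinearMap.mul' K A (S'.rTensor A (E K d j ⊗ₜ[K] E K d (i - j))) =
            if i = 0 then E K d (-j) else 0 := by
          intro j
          rw [LinearMap.rTensor_tmul, LinearMap.mul'_apply, hS', hSE, MulOpposite.unop_op, mul_E]
          refine if_congr ⟨fun h => ?_, fun h => ?_⟩ rfl rfl
          · linear_combination -h
          · linear_combination -h
        rw [Finset.sum_congr rfl fun j _ => this j]
        split_ifs with h
        · rw [map_one]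
          exact (Equiv.sum_comp (Equiv.neg (ZMod n)) (E K d)).trans (relations K n d).sum
        · simp
      · rw [hΔX, map_add, map_add, LinearMap.rTensor_tmul, LinearMap.rTensor_tmul,
          LinearMap.mul'_apply, LinearMap.mul'_apply, hS', hSX, hS', map_one, MulOpposite.unop_op,
          MulOpposite.unop_one, hεX, map_zero, neg_mul, mul_assoc, charElemInv_mul, mul_one,
          one_mul, neg_add_cancel])
  have hL := mul_antipode_lTensor_of_adjoin (Δ := Δ) (ε := ε) (S := S') (adjoin_eq_top (d := d))
    (by rw [hS', map_one, MulOpposite.unop_one]) hS'mul (by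
      rintro _ (⟨i, rfl⟩ | rfl)
      · rw [hΔE, comulE, map_sum, map_sum, hεE]
        have : ∀ j : ZMod n, LinearMap.mul' K A (S'.lTensor A (E K d j ⊗ₜ[K] E K d (i - j))) =
            if i = 0 then E K d j else 0 := by
          intro j
          rw [LinearMap.lTensor_tmul, LinearMap.mul'_apply, hS', hSE, MulOpposite.unop_op, mul_E]
          refine if_congr ⟨fun h => ?_, fun h => ?_⟩ rfl rfl
          · linear_combination h
          · linear_combination h
        rw [Finset.sum_congr rfl fun j _ => this j]
        split_ifs with h
        · rw [map_one]
          exact (relations K n d).sum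
        · simp
      · rw [hΔX, map_add, map_add, LinearMap.lTensor_tmul, LinearMap.lTensor_tmul,
          LinearMap.mul'_apply, LinearMap.mul'_apply, hS', hSk, hS', hSX, MulOpposite.unop_op,
          MulOpposite.unop_op, hεX, map_zero, one_mul, add_neg_cancel])
  exact ⟨{ Bi with
    antipode := S'
    mul_antipode_rTensor_comul := LinearMap.ext hR
    mul_antipode_lTensor_comul := LinearMap.ext hL }, rfl⟩

end Hopf

/-- The algebra `KZ_n / J^d` with `d ∣ n` admits a Hopf algebra structure if `K` contains a
primitive `d`-th root of unity. -/
theorem admitsHopf (hd : 0 < d) (hdn : d ∣ n) {q : K} (hq : IsPrimitiveRoot q d) :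
    Algebra.AdmitsHopf K (CycleAlgebra K n d) := by
  -- Here `d ∣ n` enters: it makes `q` the value at `1` of a character of `ZMod n`.
  have hqn : q ^ n = 1 := (hq.pow_eq_one_iff_dvd n).2 hdn
  refine admitsHopf_of_addChar (AddChar.zmodChar n hqn) hd ?_
  have : AddChar.zmodChar n hqn 1 = q := by
    have := AddChar.zmodChar_apply' hqn 1
    simpa using this
  rwa [this]

end CycleAlgebra

/-! ### Recognition of direct sums of truncated basic cycle coalgebras -/

namespace QPath

variable {V W : Type*} [Quiver V] [Quiver W]

/-- The image of a path under a morphism of quivers. -/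
def map (F : V ⥤q W) (p : QPath V) : QPath W := ⟨F.obj p.src, F.obj p.tgt, F.mapPath p.path⟩

theorem length_map (F : V ⥤q W) (p : QPath V) : (p.map F).length = p.length := by
  obtain ⟨a, b, p⟩ := p
  change (F.mapPath p).length = p.length
  induction p with
  | nil => rfl
  | cons p e ih =>
    rw [Prefunctor.mapPath_cons, Quiver.Path.length_cons, ih, Quiver.Path.length_cons]

theorem splits_mapPath (F : V ⥤q W) {a b : V} (p : Quiver.Path a b) :
    splits (F.mapPath p) =
      (splits p).map fun s => ⟨F.obj s.1, F.mapPath s.2.1, F.mapPath s.2.2⟩ := by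
  induction p with
  | nil => rfl
  | cons p e ih =>
    rw [Prefunctor.mapPath_cons, splits, splits, ih, List.map_cons, List.map_map, List.map_map]
    rfl

/-- If every vertex has at most one outgoing arrow, then a path is determined by its source and
its length. -/
theorem ext_of_length
    (hV : ∀ (v w w' : V) (e : v ⟶ w) (e' : v ⟶ w'), (⟨w, e⟩ : Σ w, v ⟶ w) = ⟨w', e'⟩)
    {p q : QPath V} (hsrc : p.src = q.src) (hlen : p.length = q.length) : p = q := by
  obtain ⟨a, b, p⟩ := p
  obtain ⟨a', b', q⟩ := q
  obtain rfl : a = a' := hsrc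
  replace hlen : p.length = q.length := hlen
  induction p generalizing b' with
  | nil =>
    cases q with
    | nil => rfl
    | cons q e => simp at hlen
  | cons p e ih =>
    cases q with
    | nil => simp at hlen
    | cons q e' =>
      cases ih _ q (by simpa using hlen)
      cases hV _ _ _ e e'
      rfl

end QPath

namespace PathBasis

variable {K V C : Type*} [Field K] [Quiver V] [AddCommGroup C] [Module K C] [Coalgebra K C]
  (B : PathBasis K V C)

/-- A linear equivalence compatible with the coalgebra structures on a path basis is an
isomorphism of coalgebras. -/
def coalgEquivOfVec {C' : Type*} [AddCommGroup C'] [Module K C'] [Coalgebra K C'] (f : C ≃ₗ[K] C')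
    (hcounit : ∀ p ∈ B.T, counit (R := K) (f (B.vec p)) = counit (R := K) (B.vec p))
    (hcomul : ∀ p ∈ B.T, TensorProduct.map f.toLinearMap f.toLinearMap
      (comul (R := K) (B.vec p)) = comul (R := K) (f (B.vec p))) : C ≃ₗc[K] C' :=
  { f with
    counit_comp := B.ext_vec hcounit
    map_comp_comul := B.ext_vec hcomul }

/-- A coalgebra with a path basis consisting of vertices is a direct sum of copies of `K`. -/
theorem nonempty_coalgEquiv_pi [Fintype V] (h : ∀ p ∈ B.T, p.length = 0) :
    Nonempty (C ≃ₗc[K] (Fin (Fintype.card V) → K)) := by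
  classical
  let e : Fin (Fintype.card V) ≃ B.T := (Fintype.equivFin V).symm.trans (Equiv.ofBijective
    (fun v => ⟨QPath.vertex v, B.vertex_mem v⟩)
    ⟨fun v w hvw => congrArg (fun p : B.T => p.1.src) hvw, by
      rintro ⟨⟨a, b, p⟩, hp⟩
      cases p with
      | nil => exact ⟨a, rfl⟩
      | cons p e => exact absurd (h _ hp) (Nat.succ_ne_zero _)⟩)
  let f : C ≃ₗ[K] (Fin (Fintype.card V) → K) := (B.basis.reindex e.symm).equivFun
  have hf : ∀ i, f (B.vec (e i)) = Pi.single i 1 := by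
    intro i
    rw [← basis_apply]
    have := (B.basis.reindex e.symm).equivFun_self i
    rw [Module.Basis.reindex_apply, Equiv.symm_symm] at this
    exact funext fun j => (this j).trans (by simp [Pi.single_apply, eq_comm])
  have hvec : ∀ p ∈ B.T, ∃ i, p = e i := fun p hp => ⟨e.symm ⟨p, hp⟩, by simp⟩
  refine ⟨B.coalgEquivOfVec f (fun p hp => ?_) fun p hp => ?_⟩
  · obtain ⟨i, rfl⟩ := hvec p hp
    rw [hf, B.counit_vec _ hp, if_pos (h _ hp), Pi.counit_single, CommSemiring.counit_apply]
  · obtain ⟨i, hi⟩ := hvec p hp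
    obtain ⟨a, b, p⟩ := p
    cases p with
    | cons p e => exact absurd (h _ hp) (Nat.succ_ne_zero _)
    | nil =>
      have hfv : f (B.vec ⟨a, a, .nil⟩) = Pi.single i 1 := by rw [hi, hf]
      rw [hfv, B.comul_vec _ hp, Pi.comul_single, CommSemiring.comul_apply]
      simp only [QPath.splits, List.map_cons, List.map_nil, List.sum_cons, List.sum_nil, add_zero,
        TensorProduct.map_tmul]
      change f (B.vec ⟨a, a, .nil⟩) ⊗ₜ[K] f (B.vec ⟨a, a, .nil⟩) = _
      rw [hfv]
      rfl

end PathBasis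

/-- The path basis of the truncated coalgebra of a basic cycle. -/
def cyclePathBasis (K : Type*) [Field K] (n : ℕ) {d : ℕ} (hd : 0 < d) :
    PathBasis K (BasicCycle n) (CycleCoalgebra K n d) :=
  PathCoalgebra.pathBasis (PathCoalgebra.truncated K (BasicCycle n) d) {p | p.length < d} rfl
    fun _ => hd

theorem BasicCycle.exists_path {n : ℕ} (v : BasicCycle n) (k : ℕ) :
    ∃ p : QPath (BasicCycle n), p.src = v ∧ p.length = k := by
  induction k with
  | zero => exact ⟨QPath.vertex v, rfl, rfl⟩
  | succ k ih =>
    obtain ⟨⟨a, b, p⟩, rfl, rfl⟩ := ih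
    exact ⟨⟨a, .ofIdx (b.idx + 1), p.cons (BasicCycle.hom rfl)⟩, rfl, rfl⟩

theorem BasicCycle.sigma_hom_ext {n : ℕ} (v w w' : BasicCycle n) (e : v ⟶ w) (e' : v ⟶ w') :
    (⟨w, e⟩ : Σ w, v ⟶ w) = ⟨w', e'⟩ := by
  obtain rfl : w = w' :=
    BasicCycle.idx_injective ((BasicCycle.idx_of_hom e).trans (BasicCycle.idx_of_hom e').symm)
  rw [BasicCycle.hom_unique e e']

/-- On both sides a path is determined by its source and length, because at most one arrow leaves
each vertex. A bijection on vertices therefore induces one on paths of length less than `d`, and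
quiver morphisms carry factorisations to factorisations. -/
theorem PathBasis.nonempty_coalgEquiv_cycle {K V C : Type*} [Field K] [Quiver V] [AddCommGroup C]
    [Module K C] [Coalgebra K C] (B : PathBasis K V C) {m n d : ℕ} (hd : 0 < d)
    (F : Fin m → (BasicCycle n ⥤q V))
    (hF : Function.Bijective fun x : Fin m × BasicCycle n => (F x.1).obj x.2)
    (hV : ∀ (v w w' : V) (e : v ⟶ w) (e' : v ⟶ w'), (⟨w, e⟩ : Σ w, v ⟶ w) = ⟨w', e'⟩)
    (hT : ∀ p, p ∈ B.T ↔ p.length < d) :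
    Nonempty (C ≃ₗc[K] (Fin m → CycleCoalgebra K n d)) := by
  classical
  let B' := cyclePathBasis K n hd
  let φ : (Σ _ : Fin m, B'.T) → B.T := fun x =>
    ⟨x.2.1.map (F x.1), by rw [hT, QPath.length_map]; exact x.2.2⟩
  have hφ : Function.Bijective φ := by
    constructor
    · rintro ⟨j, p, hp⟩ ⟨j', p', hp'⟩ h
      have h : p.map (F j) = p'.map (F j') := congrArg Subtype.val h
      have h1 : (F j).obj p.src = (F j').obj p'.src := congrArg QPath.src h
      have h2 := congrArg QPath.length h
      rw [QPath.length_map, QPath.length_map] at h2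
      have h3 := hF.1 (a₁ := (j, p.src)) (a₂ := (j', p'.src)) h1
      obtain ⟨rfl, h4⟩ := Prod.ext_iff.1 h3
      obtain rfl := QPath.ext_of_length BasicCycle.sigma_hom_ext h4 h2
      rfl
    · rintro ⟨q, hq⟩
      obtain ⟨⟨j, v⟩, hv⟩ := hF.2 q.src
      obtain ⟨p, rfl, hp⟩ := BasicCycle.exists_path v q.length
      rw [hT, ← hp] at hq
      refine ⟨⟨j, p, hq⟩, Subtype.ext (QPath.ext_of_length hV hv ?_)⟩
      rw [QPath.length_map, hp]
  let f : (Fin m → CycleCoalgebra K n d) ≃ₗ[K] C :=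
    (Pi.basis fun _ : Fin m => B'.basis).equiv B.basis (Equiv.ofBijective φ hφ)
  have hf : ∀ (j : Fin m), ∀ p ∈ B'.T, f (Pi.single j (B'.vec p)) = B.vec (p.map (F j)) := by
    intro j p hp
    have := (Pi.basis fun _ : Fin m => B'.basis).equiv_apply ⟨j, ⟨p, hp⟩⟩ B.basis
      (Equiv.ofBijective φ hφ)
    rw [Pi.basis_apply, PathBasis.basis_apply, PathBasis.basis_apply] at this
    exact this
  refine ⟨CoalgEquiv.symm { f with
    counit_comp := ?_
    map_comp_comul := ?_ }⟩
  · refine (Pi.basis fun _ : Fin m => B'.basis).ext ?_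
    rintro ⟨j, p, hp⟩
    rw [Pi.basis_apply, PathBasis.basis_apply]
    change counit (R := K) (f (Pi.single j (B'.vec p))) =
      counit (R := K) (Pi.single j (B'.vec p) : Fin m → CycleCoalgebra K n d)
    rw [hf j p hp, Pi.counit_single, B'.counit_vec p hp, B.counit_vec _ (φ ⟨j, p, hp⟩).2,
      QPath.length_map]
  · refine (Pi.basis fun _ : Fin m => B'.basis).ext ?_
    rintro ⟨j, p, hp⟩
    rw [Pi.basis_apply, PathBasis.basis_apply]
    change TensorProduct.map f.toLinearMap f.toLinearMap
      (comul (R := K) (Pi.single j (B'.vec p) : Fin m → CycleCoalgebra K n d)) =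
        comul (R := K) (f (Pi.single j (B'.vec p)))
    have hcomul : comul (R := K) (B.vec (p.map (F j))) = ((QPath.splits p.path).map fun s =>
        B.vec (QPath.map (F j) ⟨s.1, p.tgt, s.2.2⟩) ⊗ₜ[K]
          B.vec (QPath.map (F j) ⟨p.src, s.1, s.2.1⟩)).sum := by
      refine (B.comul_vec _ (φ ⟨j, p, hp⟩).2).trans ?_
      change (List.map _ (QPath.splits ((F j).mapPath p.path))).sum = _
      rw [QPath.splits_mapPath]
      exact congrArg List.sum List.map_map
    rw [hf j p hp, hcomul, Pi.comul_single, B'.comul_vec p hp, map_list_sum, map_list_sum,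
      List.map_map, List.map_map]
    refine congrArg List.sum (List.map_congr_left fun s hs => ?_)
    have hs' := (QPath.mem_splits _ _).1 hs
    have hp' : (⟨p.src, p.tgt, s.2.1.comp s.2.2⟩ : QPath (BasicCycle n)) ∈ B'.T := by
      rw [hs']
      exact hp
    change f (Pi.single j (B'.vec _)) ⊗ₜ[K] f (Pi.single j (B'.vec _)) = _
    rw [hf j _ (B'.comp_mem _ _ hp').1, hf j _ (B'.comp_mem _ _ hp').2]

/-- The algebra `KZ_n / J^d` is the convolution algebra of `C_d(n)`. -/
def cycleAlgebraEquivConv (K : Type*) [Field K] (n : ℕ) [NeZero n] {d : ℕ} (hd : 0 < d) :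
    CycleAlgebra K n d ≃ₐ[K] WithConv (CycleCoalgebra K n d →ₗ[K] K) :=
  have : ∀ a b : BasicCycle n, Finite (a ⟶ b) := fun a b => inferInstanceAs (Finite (PLift _))
  have : Finite (cyclePathBasis K n hd).T := (QPath.finite_setOf_length_lt d).to_subtype
  (cyclePathBasis K n hd).quotientEquiv _ fun x => by
    rw [PathAlgebra.mem_arrowIdeal_pow_iff]
    have : (cyclePathBasis K n hd).Tᶜ = {p | d ≤ p.length} := by
      ext p
      exact (not_lt : ¬ p.length < d ↔ d ≤ p.length)
    rw [this]

/-! ### Hopf structures on products of equal factors -/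

theorem nonempty_cycleAlgebra_one_equiv (K : Type*) [Field K] (m : ℕ) [NeZero m] :
    Nonempty ((Fin m → K) ≃ₐ[K] CycleAlgebra K m 1) := by
  obtain ⟨e⟩ := (cyclePathBasis K m one_pos).nonempty_coalgEquiv_pi fun p hp =>
    Nat.lt_one_iff.1 hp
  have hcard : Fintype.card (BasicCycle m) = m := ZMod.card m
  rw [hcard] at e
  exact ⟨(convPiSelf m).symm.trans
    ((convCongr e).trans (cycleAlgebraEquivConv K m one_pos).symm)⟩

/-- `K × ⋯ × K` admits a Hopf algebra structure. -/
theorem admitsHopf_pi (K : Type*) [Field K] {m : ℕ} (hm : 0 < m) :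
    Algebra.AdmitsHopf K (Fin m → K) := by
  have : NeZero m := ⟨hm.ne'⟩
  obtain ⟨e⟩ := nonempty_cycleAlgebra_one_equiv K m
  exact algebraAdmitsHopf_of_algEquiv
    (CycleAlgebra.admitsHopf one_pos (one_dvd m) IsPrimitiveRoot.one) e

theorem admitsHopf_tensorProduct {K A B : Type*} [Field K] [Ring A] [algA : Algebra K A] [Ring B]
    [algB : Algebra K B] (hA : Algebra.AdmitsHopf K A) (hB : Algebra.AdmitsHopf K B) :
    Algebra.AdmitsHopf K (A ⊗[K] B) := by
  obtain ⟨_, rfl⟩ := hA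
  obtain ⟨_, rfl⟩ := hB
  exact ⟨inferInstance, rfl⟩

/-- A product of `m` copies of an algebra is its tensor product with `K^m`, and tensor products of
Hopf algebras are Hopf algebras. The Hopf structure on `K^m` is the case `d = 1` of the cycle
construction. -/
theorem admitsHopf_pi_cycleAlgebra {K : Type*} [Field K] {m n d : ℕ} [NeZero n] (hm : 0 < m)
    (hd : 0 < d) (hdn : d ∣ n) {q : K} (hq : IsPrimitiveRoot q d) :
    Algebra.AdmitsHopf K (Fin m → CycleAlgebra K n d) :=
  algebraAdmitsHopf_of_algEquiv
    (admitsHopf_tensorProduct (CycleAlgebra.admitsHopf hd hdn hq) (admitsHopf_pi K hm))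
    (Algebra.TensorProduct.piScalarRight K K (CycleAlgebra K n d) (Fin m)).symm

/-! ### Uniqueness of integrals of finite dimensional Hopf algebras -/

section Integral

variable {K H : Type*} [Field K] [Ring H] [HopfAlgebra K H]

/-- A functional `l` on `H` with `∑ l(h₂) h₁ = l(h) g` for all `h`. For `g = 1` this is a left
integral of the dual Hopf algebra. -/
def IsIntegralAt (g : H) (l : H →ₗ[K] K) : Prop :=
  ∀ h : H, TensorProduct.rid K H (l.lTensor H (comul (R := K) h)) = l h • g

theorem rid_lTensor_repr (l : H →ₗ[K] K) {h : H} {ι : Type*} (r : Coalgebra.Repr K h ι) :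
    TensorProduct.rid K H (l.lTensor H (comul (R := K) h)) =
      ∑ i ∈ r.index, l (r.right i) • r.left i := by
  rw [← r.eq, map_sum, map_sum]
  rfl

/-- The product of representations of `Δ(a)` and `Δ(b)`. -/
def reprMul {a b : H} {ι κ : Type*} (r : Coalgebra.Repr K a ι) (s : Coalgebra.Repr K b κ) :
    Coalgebra.Repr K (a * b) (ι × κ) where
  index := r.index ×ˢ s.index
  left x := r.left x.1 * s.left x.2
  right x := r.right x.1 * s.right x.2
  eq := by
    refine Eq.trans ?_ (Bialgebra.comul_mul (R := K) a b).symm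
    rw [← r.eq, ← s.eq, Finset.sum_mul_sum, Finset.sum_product]
    simp only [Algebra.TensorProduct.tmul_mul_tmul]

/-- Since `x` is group-like, `Δ(x h) = ∑ x h₁ ⊗ x h₂`; multiplying the integral identity for `x h`
on the left by `y` removes the extra `x` in the first leg. -/
theorem IsIntegralAt.mul_left {g x y : H} {l : H →ₗ[K] K} (hl : IsIntegralAt g l)
    (hx : IsGroupLikeElem K x) (hy : y * x = 1) :
    IsIntegralAt (y * g) (l ∘ₗ LinearMap.mulLeft K x) := by
  intro h
  have r := Coalgebra.Repr.arbitrary K h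
  let s : Coalgebra.Repr K x Unit := ⟨{()}, fun _ => x, fun _ => x, by
    rw [Finset.sum_singleton]
    exact hx.comul_eq_tmul_self.symm⟩
  have h1 := congrArg (y * ·) (hl (x * h))
  rw [rid_lTensor_repr l (reprMul s r)] at h1
  simp only [reprMul, s, Finset.sum_product, Finset.sum_singleton, Finset.mul_sum,
    mul_smul_comm, ← mul_assoc, hy, one_mul] at h1
  rw [rid_lTensor_repr _ r]
  exact h1

/-- The map `x ↦ ∑ l(x h₂) h₁`. -/
def integralMap (l : H →ₗ[K] K) (h : H) : H →ₗ[K] H :=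
  ∑ i ∈ (ℛ K h).index, (LinearMap.toSpanSingleton K H ((ℛ K h).left i)) ∘ₗ l ∘ₗ
    LinearMap.mulRight K ((ℛ K h).right i)

theorem integralMap_apply (l : H →ₗ[K] K) (h x : H) :
    integralMap l h x = ∑ i ∈ (ℛ K h).index, l (x * (ℛ K h).right i) • (ℛ K h).left i := by
  rw [integralMap, LinearMap.sum_apply]
  rfl

/-- This is the integral identity for `x h`, read as an identity of convolution products in `x`.
Convolving with the antipode then recovers `integralMap l h` from the functional `x ↦ l (x * h)`
alone. -/
theorem id_mul_integralMap {l : H →ₗ[K] K} (hl : IsIntegralAt 1 l) (h : H) :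
    toConv (LinearMap.id : H →ₗ[K] H) * toConv (integralMap l h) =
      toConv (LinearMap.toSpanSingleton K H 1 ∘ₗ l ∘ₗ LinearMap.mulRight K h) := by
  refine WithConv.ext (LinearMap.ext fun x => ?_)
  have r := ℛ K x
  rw [r.convMul_apply]
  have := hl (x * h)
  rw [rid_lTensor_repr l (reprMul r (ℛ K h))] at this
  simp only [reprMul, Finset.sum_product] at this
  simp only [LinearMap.id_apply, integralMap_apply, Finset.mul_sum, mul_smul_comm]
  exact this

/-- The action `f ⇀ h = ∑ f(h₁) h₂` of the dual on `H`. -/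
def slice (f : H →ₗ[K] K) (h : H) : H := ∑ i ∈ (ℛ K h).index, f ((ℛ K h).left i) • (ℛ K h).right i

theorem counit_slice (f : H →ₗ[K] K) (h : H) : counit (R := K) (slice f h) = f h := by
  have := congrArg (TensorProduct.rid K H) (Coalgebra.sum_tmul_counit_eq (ℛ K h))
  simp only [map_sum, TensorProduct.rid_tmul, one_smul] at this
  conv_rhs => rw [← this]
  simp only [slice, map_sum, map_smul, smul_eq_mul, mul_comm]

theorem apply_integralMap (f l : H →ₗ[K] K) (h x : H) :
    f (integralMap l h x) = l (x * slice f h) := by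
  simp only [integralMap_apply, slice, map_sum, map_smul, Finset.mul_sum, mul_smul_comm,
    smul_eq_mul, mul_comm]

/-- Expanding the first leg of `Δ(h)` in the basis turns the left side into `∑ S(h₁) h₂`. -/
theorem sum_antipode_mul_slice {ι : Type*} [Fintype ι] (b : Module.Basis ι K H) (h : H) :
    ∑ j, HopfAlgebra.antipode K (b j) * slice (b.coord j) h = counit (R := K) h • (1 : H) := by
  rw [← HopfAlgebra.sum_antipode_mul_eq_smul (ℛ K h)]
  simp only [slice, Finset.mul_sum, mul_smul_comm]
  rw [Finset.sum_comm]
  refine Finset.sum_congr rfl fun i _ => ?_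
  conv_rhs => rw [← b.sum_repr ((ℛ K h).left i)]
  simp only [map_sum, map_smul, Finset.sum_mul, smul_mul_assoc]
  rfl

/-- A relation between the functionals `x ↦ l₁ (x a)` and `x ↦ l₂ (x b)` passes, on convolving with
the antipode, to the maps `integralMap`; applying `f` to these gives the sliced relation. -/
theorem slice_mem_of_integral {l₁ l₂ : H →ₗ[K] K} (h₁ : IsIntegralAt 1 l₁)
    (h₂ : IsIntegralAt 1 l₂) {a b : H} (h : ∀ x, l₁ (x * a) + l₂ (x * b) = 0) (f : H →ₗ[K] K)
    (x : H) : l₁ (x * slice f a) + l₂ (x * slice f b) = 0 := by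
  have key : toConv (integralMap l₁ a) + toConv (integralMap l₂ b) = 0 := by
    rw [← one_mul (toConv (integralMap l₁ a) + toConv (integralMap l₂ b)),
      ← LinearMap.antipode_mul_id, mul_assoc, mul_add, id_mul_integralMap h₁,
      id_mul_integralMap h₂]
    convert mul_zero _
    refine WithConv.ext (LinearMap.ext fun x => ?_)
    change l₁ (x * a) • (1 : H) + l₂ (x * b) • (1 : H) = 0
    rw [← add_smul, h, zero_smul]
  rw [← apply_integralMap, ← apply_integralMap, ← map_add]
  have := LinearMap.congr_fun (congrArg ofConv key) x
  refine (congrArg f this).trans (map_zero f)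

/-- The space of integrals is at most one-dimensional. -/
theorem not_linearIndependent_of_isIntegralAt [FiniteDimensional K H] {l₁ l₂ : H →ₗ[K] K}
    (h₁ : IsIntegralAt 1 l₁) (h₂ : IsIntegralAt 1 l₂) : ¬ LinearIndependent K ![l₁, l₂] := by
  rw [LinearIndependent.pair_iff]
  intro hli
  have hnt : Nontrivial H := by
    by_contra hn
    rw [not_nontrivial_iff_subsingleton] at hn
    have := hli 1 0 (LinearMap.ext fun x => by rw [Subsingleton.elim x 0]; simp)
    exact one_ne_zero this.1
  -- The relation survives slicing, and slices recombine to counits through `∑ S(bⱼ) · slice`. This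
  -- yields `ε(a) l₁ + ε(b) l₂ = 0`, and independence applies.
  have hε : ∀ a b : H, (∀ x, l₁ (x * a) + l₂ (x * b) = 0) →
      counit (R := K) a = 0 ∧ counit (R := K) b = 0 := by
    intro a b h
    refine hli _ _ (LinearMap.ext fun x => ?_)
    let B := Module.finBasis K H
    have h1 : ∀ c : H, x * ∑ j, HopfAlgebra.antipode K (B j) * slice (B.coord j) c =
        counit (R := K) c • x := fun c => by rw [sum_antipode_mul_slice, mul_smul_comm, mul_one]
    have h2 : l₁ (counit (R := K) a • x) + l₂ (counit (R := K) b • x) = 0 := by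
      rw [← h1, ← h1, Finset.mul_sum, Finset.mul_sum, map_sum, map_sum, ← Finset.sum_add_distrib]
      refine Finset.sum_eq_zero fun j _ => ?_
      rw [← mul_assoc, ← mul_assoc]
      exact slice_mem_of_integral h₁ h₂ h _ _
    simpa using h2
  -- If two integrals were independent, `(a, b) ↦ (x ↦ l₁ (x a) + l₂ (x b))` would embed `H × H`
  -- into the dual of `H`, which is impossible by dimension.
  let Φ : (H × H) →ₗ[K] (H →ₗ[K] K) :=
    (LinearMap.mul K H).flip.compr₂ l₁ |>.coprod ((LinearMap.mul K H).flip.compr₂ l₂)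
  have hΦ : ∀ a b x, Φ (a, b) x = l₁ (x * a) + l₂ (x * b) := fun a b x => by simp [Φ]
  have hinj : Function.Injective Φ := by
    rw [injective_iff_map_eq_zero]
    rintro ⟨a, b⟩ hab
    have h : ∀ x, l₁ (x * a) + l₂ (x * b) = 0 := fun x => by rw [← hΦ, hab]; rfl
    -- The counit of a slice by `f` is the value of `f`, so the vanishing of the counits of all
    -- slices gives `a = b = 0`.
    have h' : ∀ f : H →ₗ[K] K, f a = 0 ∧ f b = 0 := fun f => by
      rw [← counit_slice f a, ← counit_slice f b]
      exact hε _ _ (slice_mem_of_integral h₁ h₂ h f)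
    exact Prod.ext ((Module.forall_dual_apply_eq_zero_iff K a).1 fun f => (h' f).1)
      ((Module.forall_dual_apply_eq_zero_iff K b).1 fun f => (h' f).2)
  have hle := LinearMap.finrank_le_finrank_of_injective hinj
  rw [Module.finrank_prod, Subspace.dual_finrank_eq (K := K) (V := H)] at hle
  have := Module.finrank_pos (R := K) (M := H)
  omega

end Integral

/-! ### Group-like elements and maximal paths -/

theorem Quiver.Path.sigma_hom_eq_of_comp_eq {V : Type*} [Quiver V] {a b b' c : V} {e : a ⟶ b}
    {e' : a ⟶ b'} (p : Quiver.Path b c) (p' : Quiver.Path b' c)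
    (h : e.toPath.comp p = e'.toPath.comp p') : (⟨b, e⟩ : Σ b, a ⟶ b) = ⟨b', e'⟩ := by
  induction p with
  | nil =>
    cases p' with
    | nil =>
      cases h
      rfl
    | cons p' f =>
      have := congrArg Quiver.Path.length h
      simp at this
  | cons p f ih =>
    cases p' with
    | nil =>
      have := congrArg Quiver.Path.length h
      simp at this
    | cons p' f' =>
      rw [Quiver.Path.comp_cons, Quiver.Path.comp_cons] at h
      obtain rfl := Quiver.Path.obj_eq_of_cons_eq_cons h
      exact ih p' (eq_of_heq (Quiver.Path.heq_of_cons_eq_cons h))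

namespace PathBasis

section Coalgebra

variable {K V C : Type*} [Field K] [Quiver V] [AddCommGroup C] [Module K C] [Coalgebra K C]
  (B : PathBasis K V C)

/-- The group-like element given by a vertex. -/
def vert (v : V) : C := B.vec (QPath.vertex v)

/-- The skew-primitive element given by an arrow. -/
def arr {v w : V} (e : v ⟶ w) : C := B.vec (QPath.arrow e)

theorem isGroupLikeElem_vert (v : V) : IsGroupLikeElem K (B.vert v) where
  counit_eq_one := by
    rw [vert, B.counit_vec _ (B.vertex_mem v)]
    rfl
  comul_eq_tmul_self := by
    rw [vert, B.comul_vec _ (B.vertex_mem v)]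
    simp [QPath.vertex, QPath.splits]

theorem comul_arr {v w : V} {e : v ⟶ w} (he : QPath.arrow e ∈ B.T) :
    comul (R := K) (B.arr e) = B.vert w ⊗ₜ[K] B.arr e + B.arr e ⊗ₜ[K] B.vert v := by
  rw [arr, B.comul_vec _ he]
  simp [QPath.arrow, Quiver.Hom.toPath, QPath.splits, vert, QPath.vertex]

theorem basis_coord (p : B.T) : B.basis.coord p = B.coord p := by
  classical
  refine B.ext_vec fun q hq => ?_
  have := B.basis.repr_self_apply ⟨q, hq⟩ p
  rw [basis_apply] at this
  rw [B.coord_vec _ hq, Module.Basis.coord_apply, this]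
  simp only [Subtype.ext_iff, eq_comm]

theorem ext_coord {x y : C} (h : ∀ p ∈ B.T, B.coord p x = B.coord p y) : x = y :=
  B.basis.ext_elem fun p => by
    have := h p p.2
    rwa [← basis_coord] at this

open Classical in
theorem coord_vert (p : QPath V) (v : V) :
    B.coord p (B.vert v) = if p = QPath.vertex v then 1 else 0 := B.coord_vec _ (B.vertex_mem v)

theorem coord_vert_of_ne {p : QPath V} (hp : p.length ≠ 0) (v : V) : B.coord p (B.vert v) = 0 := by
  rw [coord_vert, if_neg]
  rintro rfl
  exact hp rfl

theorem vert_injective : Function.Injective B.vert := by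
  intro v w h
  by_contra hne
  have := congrArg (B.coord (QPath.vertex v)) h
  rw [coord_vert, coord_vert, if_pos rfl, if_neg] at this
  · exact one_ne_zero this
  · exact fun h => hne (congrArg QPath.src h)

theorem conv_apply_groupLike (f g : WithConv (C →ₗ[K] K)) {x : C} (hx : IsGroupLikeElem K x) :
    (f * g) x = f x * g x := by
  rw [LinearMap.convMul_apply, hx.comul_eq_tmul_self]
  rfl

theorem coord_comp_groupLike {x : C} (hx : IsGroupLikeElem K x) {a b c : V} (α : Quiver.Path a b)
    (β : Quiver.Path b c) :
    B.coord ⟨a, c, α.comp β⟩ x = B.coord ⟨b, c, β⟩ x * B.coord ⟨a, b, α⟩ x := by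
  have := conv_apply_groupLike (toConv (B.coord ⟨b, c, β⟩)) (toConv (B.coord ⟨a, b, α⟩)) hx
  rwa [B.coord_mul_comp] at this

theorem coord_mul_groupLike_of_ne {x : C} (hx : IsGroupLikeElem K x) {p q : QPath V}
    (h : q.tgt ≠ p.src) : B.coord p x * B.coord q x = 0 := by
  have := conv_apply_groupLike (toConv (B.coord p)) (toConv (B.coord q)) hx
  rw [B.coord_mul_of_ne h] at this
  exact this.symm

/-- Evaluation at a group-like element is multiplicative on the convolution algebra. If it does not
vanish at an arrow, orthogonality of vertices makes the arrow a loop, and then all powers of the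
loop have nonzero coordinate, so they lie in the finite set `T`. -/
theorem coord_arrow_groupLike (hT : B.T.Finite) {x : C} (hx : IsGroupLikeElem K x) {a b : V}
    (e : a ⟶ b) : B.coord (QPath.arrow e) x = 0 := by
  by_contra hne
  have h1 : B.coord (QPath.vertex a) x ≠ 0 := by
    have := B.coord_comp_groupLike hx (.nil : Quiver.Path a a) e.toPath
    rw [Quiver.Path.nil_comp] at this
    exact right_ne_zero_of_mul (this ▸ hne)
  obtain rfl : b = a := by
    by_contra hba
    exact mul_ne_zero h1 hne (B.coord_mul_groupLike_of_ne hx hba)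
  let loop : ℕ → Quiver.Path b b := fun k => k.rec .nil fun _ p => p.cons e
  have hloop : ∀ k, B.coord ⟨b, b, loop k⟩ x ≠ 0 := by
    intro k
    induction k with
    | zero => exact h1
    | succ k ih =>
      have := B.coord_comp_groupLike hx (loop k) e.toPath
      exact this ▸ mul_ne_zero hne ih
  have hlen : ∀ k, (loop k).length = k := by
    intro k
    induction k with
    | zero => rfl
    | succ k ih => exact congrArg Nat.succ ih
  refine Set.infinite_of_injective_forall_mem (f := fun k => (⟨b, b, loop k⟩ : QPath V)) ?_ ?_ hT
  · intro k l hkl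
    rw [← hlen k, ← hlen l]
    exact congrArg QPath.length hkl
  · intro k
    by_contra hk
    exact hloop k (by rw [B.coord_eq_zero hk]; rfl)

theorem coord_groupLike (hT : B.T.Finite) {x : C} (hx : IsGroupLikeElem K x) {p : QPath V}
    (hp : p.length ≠ 0) : B.coord p x = 0 := by
  obtain ⟨a, b, p⟩ := p
  cases p with
  | nil => exact absurd rfl hp
  | cons p e =>
    refine (B.coord_comp_groupLike hx p e.toPath).trans ?_
    rw [show (⟨_, b, e.toPath⟩ : QPath V) = QPath.arrow e from rfl, B.coord_arrow_groupLike hT hx,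
      zero_mul]

/-- The group-like elements are the vertices. -/
theorem exists_vert_eq (hT : B.T.Finite) {x : C} (hx : IsGroupLikeElem K x) :
    ∃ v, B.vert v = x := by
  classical
  have hex : ∃ v, B.coord (QPath.vertex v) x ≠ 0 := by
    by_contra! h
    refine hx.ne_zero (B.ext_coord (y := 0) fun p _ => ?_)
    rw [map_zero]
    obtain ⟨a, b, p⟩ := p
    cases p with
    | nil => exact h a
    | cons p e =>
      exact B.coord_groupLike hT hx (p := ⟨a, _, p.cons e⟩) (Nat.succ_ne_zero _)
  obtain ⟨v, hv⟩ := hex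
  -- Evaluation sends the idempotent of a vertex to an idempotent of `K`. Orthogonality then forces
  -- the remaining vertex coordinates to be zero.
  have hv1 : B.coord (QPath.vertex v) x = 1 := by
    have := B.coord_comp_groupLike hx (.nil : Quiver.Path v v) .nil
    rw [Quiver.Path.nil_comp] at this
    exact (mul_eq_left₀ hv).1 this.symm
  refine ⟨v, B.ext_coord fun p _ => ?_⟩
  obtain ⟨a, b, p⟩ := p
  cases p with
  | nil =>
    change B.coord (QPath.vertex a) _ = B.coord (QPath.vertex a) _
    rw [coord_vert]
    split_ifs with h
    · obtain rfl : a = v := congrArg QPath.src h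
      exact hv1.symm
    · have := B.coord_mul_groupLike_of_ne hx (p := QPath.vertex v) (q := QPath.vertex a)
        fun hav => h (congrArg QPath.vertex hav)
      rw [hv1, one_mul] at this
      exact this.symm
  | cons p e =>
    have hp : (⟨a, b, p.cons e⟩ : QPath V).length ≠ 0 := Nat.succ_ne_zero _
    rw [B.coord_groupLike hT hx hp, B.coord_vert_of_ne hp]

/-- A path in `T` which is not a proper initial part of a path in `T`. -/
def IsMaximal (p : QPath V) : Prop :=
  p ∈ B.T ∧ ∀ (c : V) (β : Quiver.Path p.tgt c), (⟨p.src, c, p.path.comp β⟩ : QPath V) ∈ B.T →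
    β.length = 0

theorem exists_isMaximal_comp (hT : B.T.Finite) {p : QPath V} (hp : p ∈ B.T) :
    ∃ (c : V) (β : Quiver.Path p.tgt c), B.IsMaximal ⟨p.src, c, p.path.comp β⟩ := by
  let S : Set (QPath V) := {q ∈ B.T | ∃ (c : V) (β : Quiver.Path p.tgt c),
    q = ⟨p.src, c, p.path.comp β⟩}
  obtain ⟨q, ⟨hq, c, β, rfl⟩, hmax⟩ := Set.exists_max_image S QPath.length
    (hT.subset fun q hq => hq.1) ⟨p, hp, p.tgt, .nil, rfl⟩
  refine ⟨c, β, hq, fun c' γ hγ => ?_⟩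
  have := hmax _ ⟨hγ, c', β.comp γ, by rw [← Quiver.Path.comp_assoc]⟩
  change ((p.path.comp β).comp γ).length ≤ (p.path.comp β).length at this
  rw [Quiver.Path.length_comp _ γ] at this
  omega

end Coalgebra

section Hopf

variable {K V H : Type*} [Field K] [Quiver V] [Ring H] [HopfAlgebra K H] (B : PathBasis K V H)

/-- The terms of `Δ(q)` carry initial parts of `q` in the second leg. If `p` is an initial part of a
path `q` in `T`, maximality gives `q = p`, and the remaining first leg is the trivial path at the
target of `p`. -/
theorem isIntegralAt_coord {p : QPath V} (hp : B.IsMaximal p) :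
    IsIntegralAt (B.vert p.tgt) (B.coord p) := by
  classical
  intro h
  let L : H →ₗ[K] H := (TensorProduct.rid K H).toLinearMap ∘ₗ (B.coord p).lTensor H ∘ₗ comul
  have : L = (B.coord p).smulRight (B.vert p.tgt) := by
    refine B.ext_vec fun q hq => ?_
    change TensorProduct.rid K H ((B.coord p).lTensor H (comul (R := K) (B.vec q))) =
      B.coord p (B.vec q) • B.vert p.tgt
    rw [B.comul_vec q hq, map_list_sum, map_list_sum, List.map_map, List.map_map, B.coord_vec p hq]
    obtain ⟨a, b, p⟩ := p
    obtain ⟨c, d, q⟩ := q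
    have key : ∀ t : (Σ x : V, Quiver.Path c x × Quiver.Path x d), t.2.1.comp t.2.2 = q →
        (⟨a, b, p⟩ : QPath V) = ⟨c, t.1, t.2.1⟩ → (⟨a, b, p⟩ : QPath V) = ⟨c, d, q⟩ := by
      rintro ⟨x, α, β⟩ rfl h
      cases h
      cases β with
      | nil => rfl
      | cons β e => exact absurd (hp.2 _ _ hq) (Nat.succ_ne_zero _)
    split_ifs with h
    · cases h
      refine (QPath.splits_sum_eq_single p _ ⟨b, p, .nil⟩ rfl ?_).trans ?_
      rotate_left
      · change B.coord _ (B.vec _) • B.vec _ = _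
        rw [B.coord_vec _ hq, if_pos rfl]
        rfl
      · rintro ⟨x, (α : Quiver.Path a x), (β : Quiver.Path x b)⟩ h hne
        obtain rfl : α.comp β = p := h
        change B.coord _ (B.vec _) • B.vec _ = _
        rw [B.coord_vec _ (B.comp_mem _ _ hq).1, if_neg, zero_smul]
        intro h'
        exact hne (QPath.mk_inj_right h'.symm rfl)
    · rw [zero_smul]
      refine QPath.splits_sum_eq_zero _ _ ?_
      rintro ⟨x, (α : Quiver.Path c x), (β : Quiver.Path x d)⟩ hαβ
      obtain rfl : α.comp β = q := hαβ
      change B.coord _ (B.vec _) • B.vec _ = _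
      rw [B.coord_vec _ (B.comp_mem _ _ hq).1, if_neg, zero_smul]
      exact fun h' => h (key ⟨x, α, β⟩ rfl h')
  exact LinearMap.congr_fun this h

variable [Group V]

/-- The multiplication of `V` is that of the group-like elements. -/
def IsMulVert : Prop := ∀ v w, B.vert (v * w) = B.vert v * B.vert w

variable {B}

theorem IsMulVert.vert_one (hG : B.IsMulVert) : B.vert 1 = 1 := by
  have h := hG 1 1
  rw [mul_one] at h
  exact (B.isGroupLikeElem_vert 1).isUnit.mul_eq_left.1 h.symm

theorem IsMulVert.vert_inv_mul (hG : B.IsMulVert) (v : V) : B.vert v⁻¹ * B.vert v = 1 := by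
  rw [← hG, inv_mul_cancel, hG.vert_one]

theorem IsMulVert.vert_mul_inv (hG : B.IsMulVert) (v : V) : B.vert v * B.vert v⁻¹ = 1 := by
  rw [← hG, mul_inv_cancel, hG.vert_one]

/-- Two such paths give integrals at the same group-like element. Translated to integrals at `1`
they are linearly dependent by uniqueness, whereas coordinates of distinct basis paths are
independent. -/
theorem IsMulVert.eq_of_tgt_eq [FiniteDimensional K H] (hG : B.IsMulVert) {p q : QPath V}
    (hp : B.IsMaximal p) (hq : B.IsMaximal q) (h : p.tgt = q.tgt) : p = q := by
  classical
  by_contra hne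
  have h1 := (B.isIntegralAt_coord hp).mul_left (B.isGroupLikeElem_vert p.tgt)
    (hG.vert_inv_mul p.tgt)
  have h2 := (B.isIntegralAt_coord hq).mul_left (B.isGroupLikeElem_vert p.tgt)
    (hG.vert_inv_mul p.tgt)
  rw [hG.vert_inv_mul] at h1
  rw [← h, hG.vert_inv_mul] at h2
  refine not_linearIndependent_of_isIntegralAt h1 h2 ?_
  rw [LinearIndependent.pair_iff]
  intro a b hab
  have hev : ∀ x : H, a * B.coord p x + b * B.coord q x = 0 := fun x => by
    have := LinearMap.congr_fun hab (B.vert p.tgt⁻¹ * x)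
    simpa [← mul_assoc, hG.vert_mul_inv] using this
  constructor
  · have := hev (B.vec p)
    rwa [B.coord_vec _ hp.1, B.coord_vec _ hp.1, if_pos rfl, if_neg (Ne.symm hne), mul_one,
      mul_zero, add_zero] at this
  · have := hev (B.vec q)
    rwa [B.coord_vec _ hq.1, B.coord_vec _ hq.1, if_pos rfl, if_neg hne, mul_one, mul_zero,
      zero_add] at this

/-- Choose a maximal path from each vertex. By uniqueness for targets the map from vertices to the
targets of these paths is injective, hence bijective as `V` is finite; so every maximal path is one
of the chosen ones. -/
theorem IsMulVert.eq_of_src_eq [Finite V] [FiniteDimensional K H] (hG : B.IsMulVert)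
    (hT : B.T.Finite) {p q : QPath V} (hp : B.IsMaximal p) (hq : B.IsMaximal q)
    (h : p.src = q.src) : p = q := by
  have hM : ∀ v, ∃ p, B.IsMaximal p ∧ p.src = v := fun v => by
    obtain ⟨c, β, hβ⟩ := B.exists_isMaximal_comp hT (B.vertex_mem v)
    exact ⟨_, hβ, rfl⟩
  choose M hM hsrc using hM
  have hinj : Function.Injective fun v => (M v).tgt := fun v w hvw => by
    rw [← hsrc v, hG.eq_of_tgt_eq (hM v) (hM w) hvw, hsrc]
  have key : ∀ p, B.IsMaximal p → p = M p.src := fun p hp => by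
    obtain ⟨w, hw⟩ := Finite.surjective_of_injective hinj p.tgt
    have := hG.eq_of_tgt_eq hp (hM w) hw.symm
    rw [this, hsrc]
  rw [key p hp, key q hq, h]

/-- Every vertex has at most one outgoing arrow. -/
theorem IsMulVert.sigma_hom_ext [Finite V] [FiniteDimensional K H] (hG : B.IsMulVert)
    (hT : B.T.Finite) (harr : ∀ (a b : V) (e : a ⟶ b), QPath.arrow e ∈ B.T) (v w w' : V)
    (e : v ⟶ w) (e' : v ⟶ w') : (⟨w, e⟩ : Σ w, v ⟶ w) = ⟨w', e'⟩ := by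
  obtain ⟨c, β, hβ⟩ := B.exists_isMaximal_comp hT (harr _ _ e)
  obtain ⟨c', β', hβ'⟩ := B.exists_isMaximal_comp hT (harr _ _ e')
  have h := hG.eq_of_src_eq hT hβ hβ' rfl
  obtain rfl : c = c' := congrArg QPath.tgt h
  simp only [QPath.mk.injEq] at h
  exact Quiver.Path.sigma_hom_eq_of_comp_eq β β' (eq_of_heq h.2.2)

end Hopf

/-- The vertices form a group. -/
theorem exists_isMulVert {K V H : Type*} [Field K] [Quiver V] [Ring H] [HopfAlgebra K H]
    (B : PathBasis K V H) (hT : B.T.Finite) : ∃ _ : Group V, B.IsMulVert := by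
  let f : V → GroupLike K H := fun v => ⟨B.vert v, B.isGroupLikeElem_vert v⟩
  have hf : Function.Bijective f := by
    constructor
    · exact fun v w h => B.vert_injective (congrArg GroupLike.val h)
    · rintro ⟨x, hx⟩
      obtain ⟨v, rfl⟩ := B.exists_vert_eq hT hx
      exact ⟨v, rfl⟩
  let e := Equiv.ofBijective f hf
  refine ⟨e.group, fun v w => ?_⟩
  let := e.group
  exact congrArg GroupLike.val (map_mul e.mulEquiv v w)

end PathBasis

/-! ### Skew-primitive elements -/

namespace PathBasis

section Coalgebra

variable {K V C : Type*} [Field K] [Quiver V] [AddCommGroup C] [Module K C] [Coalgebra K C]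
  (B : PathBasis K V C)

/-- An element `y` with `Δ(y) = t ⊗ y + y ⊗ s`. -/
def IsSkew (s t : V) (y : C) : Prop :=
  comul (R := K) y = B.vert t ⊗ₜ[K] y + y ⊗ₜ[K] B.vert s

/-- The span of the vertices. -/
def vertSpan : Submodule K C := Submodule.span K (Set.range B.vert)

variable {B}

theorem IsSkew.conv {s t : V} {y : C} (hy : B.IsSkew s t y) (f g : WithConv (C →ₗ[K] K)) :
    (f * g) y = f (B.vert t) * g y + f y * g (B.vert s) := by
  rw [LinearMap.convMul_apply, hy, map_add, map_add]
  rfl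

theorem IsSkew.coord_comp {s t : V} {y : C} (hy : B.IsSkew s t y) {a b c : V}
    (α : Quiver.Path a b) (β : Quiver.Path b c) :
    B.coord ⟨a, c, α.comp β⟩ y = B.coord ⟨b, c, β⟩ (B.vert t) * B.coord ⟨a, b, α⟩ y +
      B.coord ⟨b, c, β⟩ y * B.coord ⟨a, b, α⟩ (B.vert s) := by
  have := hy.conv (toConv (B.coord ⟨b, c, β⟩)) (toConv (B.coord ⟨a, b, α⟩))
  rwa [B.coord_mul_comp] at this

/-- Cut off the last arrow: both pieces have positive length, and each term of the skew-primitive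
coproduct has a vertex in one leg, where the coordinate of such a piece vanishes. -/
theorem IsSkew.coord_cons_cons {s t : V} {y : C} (hy : B.IsSkew s t y) {a b c d : V}
    (p : Quiver.Path a b) (e : b ⟶ c) (f : c ⟶ d) :
    B.coord ⟨a, d, (p.cons e).cons f⟩ y = 0 := by
  refine (hy.coord_comp (p.cons e) f.toPath).trans ?_
  have h1 : (⟨c, d, f.toPath⟩ : QPath V).length ≠ 0 := Nat.succ_ne_zero _
  have h2 : (⟨a, c, p.cons e⟩ : QPath V).length ≠ 0 := Nat.succ_ne_zero _
  rw [B.coord_vert_of_ne h1, B.coord_vert_of_ne h2, zero_mul, mul_zero, add_zero]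

theorem IsSkew.eq_of_coord_ne_zero {s t : V} {y : C} (hy : B.IsSkew s t y) {a b : V} {e : a ⟶ b}
    (he : B.coord (QPath.arrow e) y ≠ 0) : a = s ∧ b = t := by
  classical
  have hlen : (⟨a, b, e.toPath⟩ : QPath V).length ≠ 0 := Nat.succ_ne_zero _
  constructor
  · by_contra h
    refine he ((hy.coord_comp .nil e.toPath).trans ?_)
    rw [B.coord_vert_of_ne hlen, zero_mul, zero_add, B.coord_vert, if_neg, mul_zero]
    exact fun h' => h (congrArg QPath.src h')
  · by_contra h
    refine he ((hy.coord_comp e.toPath .nil).trans ?_)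
    rw [B.coord_vert_of_ne hlen, mul_zero, add_zero, B.coord_vert, if_neg, zero_mul]
    exact fun h' => h (congrArg QPath.src h')

theorem mem_vertSpan {x : C} (h : ∀ p ∈ B.T, p.length ≠ 0 → B.coord p x = 0) :
    x ∈ B.vertSpan := by
  have hx : x ∈ Submodule.span K (B.basis '' {p | p.1.length = 0}) := by
    rw [Module.Basis.mem_span_image]
    intro p hp
    by_contra hlen
    rw [Finset.mem_coe, Finsupp.mem_support_iff, ← Module.Basis.coord_apply, basis_coord] at hp
    exact hp (h p p.2 hlen)
  refine Submodule.span_mono ?_ hx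
  rintro _ ⟨⟨⟨a, b, p⟩, hpT⟩, hp, rfl⟩
  cases p with
  | nil => exact ⟨a, (B.basis_apply ⟨_, hpT⟩).symm⟩
  | cons p e => exact absurd hp (Nat.succ_ne_zero _)

theorem coord_eq_zero_of_mem_vertSpan {x : C} (hx : x ∈ B.vertSpan) {p : QPath V}
    (hp : p.length ≠ 0) : B.coord p x = 0 := by
  refine (Submodule.span_le (p := LinearMap.ker (B.coord p))).2 ?_ hx
  rintro _ ⟨v, rfl⟩
  exact B.coord_vert_of_ne hp v

theorem arr_notMem_vertSpan {a b : V} {e : a ⟶ b} (he : QPath.arrow e ∈ B.T) :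
    B.arr e ∉ B.vertSpan := by
  classical
  intro h
  have := coord_eq_zero_of_mem_vertSpan h (p := QPath.arrow e) (Nat.succ_ne_zero _)
  rw [arr, B.coord_vec _ he, if_pos rfl] at this
  exact one_ne_zero this

/-- A skew-primitive element has no coordinates at paths of length at least two, and its only
possible nonzero arrow coordinates are at arrows from `s` to `t`; without such arrows it is a
combination of vertices. -/
theorem IsSkew.nonempty_hom {s t : V} {y : C} (hy : B.IsSkew s t y) (h : y ∉ B.vertSpan) :
    Nonempty (s ⟶ t) := by
  by_contra hst
  refine h (mem_vertSpan fun p _ hp0 => ?_)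
  obtain ⟨a, b, p⟩ := p
  cases p with
  | nil => exact absurd rfl hp0
  | cons p e =>
    cases p with
    | cons p f => exact hy.coord_cons_cons p f e
    | nil =>
      by_contra hne
      obtain ⟨rfl, rfl⟩ := hy.eq_of_coord_ne_zero (e := e) hne
      exact hst ⟨e⟩

/-- Since `e` is the only arrow from `s` to `t`, subtracting its contribution leaves a
skew-primitive element without arrow coordinates. Thus skew-primitives modulo vertices form at most
a line. -/
theorem IsSkew.sub_smul_mem {s t : V} {y : C} (hy : B.IsSkew s t y)
    (hV : ∀ (v w w' : V) (e : v ⟶ w) (e' : v ⟶ w'), (⟨w, e⟩ : Σ w, v ⟶ w) = ⟨w', e'⟩)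
    {e : s ⟶ t} (he : QPath.arrow e ∈ B.T) :
    y - B.coord (QPath.arrow e) y • B.arr e ∈ B.vertSpan := by
  classical
  have hz : B.IsSkew s t (y - B.coord (QPath.arrow e) y • B.arr e) := by
    rw [IsSkew, map_sub, map_smul, hy, B.comul_arr he, TensorProduct.tmul_sub,
      TensorProduct.sub_tmul, smul_add, TensorProduct.tmul_smul, TensorProduct.smul_tmul']
    abel
  refine mem_vertSpan fun p _ hp0 => ?_
  obtain ⟨a, b, p⟩ := p
  cases p with
  | nil => exact absurd rfl hp0
  | cons p f =>
    cases p with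
    | cons p g => exact hz.coord_cons_cons p g f
    | nil =>
      by_contra hne
      obtain ⟨rfl, rfl⟩ := hz.eq_of_coord_ne_zero (e := f) hne
      obtain rfl : f = e := eq_of_heq (Sigma.mk.inj (hV _ _ _ f e)).2
      refine hne ?_
      change B.coord (QPath.arrow f) _ = 0
      rw [map_sub, map_smul, arr, B.coord_vec _ he, if_pos rfl, smul_eq_mul, mul_one, sub_self]

end Coalgebra

section Hopf

variable {K V H : Type*} [Field K] [Quiver V] [Ring H] [HopfAlgebra K H] {B : PathBasis K V H}
  [Group V]

theorem IsSkew.vert_mul (hG : B.IsMulVert) {s t : V} {y : H} (hy : B.IsSkew s t y) (u : V) :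
    B.IsSkew (u * s) (u * t) (B.vert u * y) := by
  rw [IsSkew, Bialgebra.comul_mul, (B.isGroupLikeElem_vert u).comul_eq_tmul_self, hy, mul_add,
    Algebra.TensorProduct.tmul_mul_tmul, Algebra.TensorProduct.tmul_mul_tmul, ← hG, ← hG]

theorem IsSkew.mul_vert (hG : B.IsMulVert) {s t : V} {y : H} (hy : B.IsSkew s t y) (u : V) :
    B.IsSkew (s * u) (t * u) (y * B.vert u) := by
  rw [IsSkew, Bialgebra.comul_mul, (B.isGroupLikeElem_vert u).comul_eq_tmul_self, hy, add_mul,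
    Algebra.TensorProduct.tmul_mul_tmul, Algebra.TensorProduct.tmul_mul_tmul, ← hG, ← hG]

theorem vert_mul_mem_vertSpan_iff (hG : B.IsMulVert) {x : H} (u : V) :
    B.vert u * x ∈ B.vertSpan ↔ x ∈ B.vertSpan := by
  have key : ∀ (u : V) (x : H), x ∈ B.vertSpan → B.vert u * x ∈ B.vertSpan := by
    intro u x hx
    refine (Submodule.span_le (p := B.vertSpan.comap (LinearMap.mulLeft K (B.vert u)))).2 ?_ hx
    rintro _ ⟨v, rfl⟩
    exact Submodule.subset_span ⟨u * v, hG u v⟩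
  refine ⟨fun h => ?_, key u x⟩
  have := key u⁻¹ _ h
  rwa [← mul_assoc, hG.vert_inv_mul, one_mul] at this

theorem mul_vert_mem_vertSpan_iff (hG : B.IsMulVert) {x : H} (u : V) :
    x * B.vert u ∈ B.vertSpan ↔ x ∈ B.vertSpan := by
  have key : ∀ (u : V) (x : H), x ∈ B.vertSpan → x * B.vert u ∈ B.vertSpan := by
    intro u x hx
    refine (Submodule.span_le (p := B.vertSpan.comap (LinearMap.mulRight K (B.vert u)))).2 ?_ hx
    rintro _ ⟨v, rfl⟩
    exact Submodule.subset_span ⟨v * u, hG v u⟩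
  refine ⟨fun h => ?_, key u x⟩
  have := key u⁻¹ _ h
  rwa [mul_assoc, hG.vert_mul_inv, mul_one] at this

/-- If there is an arrow, then the arrows are `v ⟶ v a` for a central element `a`. -/
theorem IsMulVert.exists_central (hG : B.IsMulVert)
    (harr : ∀ (a b : V) (e : a ⟶ b), QPath.arrow e ∈ B.T)
    (hV : ∀ (v w w' : V) (e : v ⟶ w) (e' : v ⟶ w'), (⟨w, e⟩ : Σ w, v ⟶ w) = ⟨w', e'⟩)
    {s t : V} (e : s ⟶ t) :
    ∃ a : V, (∀ v, v * a = a * v) ∧ ∀ v, Nonempty (v ⟶ v * a) := by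
  have hl : ∀ {s t : V} (_ : s ⟶ t) (u : V), Nonempty (u * s ⟶ u * t) := fun e u =>
    (IsSkew.vert_mul hG (B.comul_arr (harr _ _ e)) u).nonempty_hom
      ((vert_mul_mem_vertSpan_iff hG u).not.2 (arr_notMem_vertSpan (harr _ _ e)))
  have hr : ∀ {s t : V} (_ : s ⟶ t) (u : V), Nonempty (s * u ⟶ t * u) := fun e u =>
    (IsSkew.mul_vert hG (B.comul_arr (harr _ _ e)) u).nonempty_hom
      ((mul_vert_mem_vertSpan_iff hG u).not.2 (arr_notMem_vertSpan (harr _ _ e)))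
  -- Left translation by `v * s⁻¹` turns the given arrow into one from `v` to `v * (s⁻¹ * t)`.
  have h1 : ∀ v, Nonempty (v ⟶ v * (s⁻¹ * t)) := fun v => by
    have := hl e (v * s⁻¹)
    rwa [inv_mul_cancel_right, mul_assoc] at this
  refine ⟨s⁻¹ * t, fun v => ?_, h1⟩
  obtain ⟨f⟩ := h1 v
  -- Right translation of the arrow out of `1` by `v` gives an arrow `v ⟶ a * v`; uniqueness of the
  -- arrow out of `v` identifies its target with `v * a`.
  obtain ⟨g⟩ := h1 1
  obtain ⟨g⟩ := hr g v
  rw [one_mul, one_mul] at g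
  exact congrArg Sigma.fst (hV _ _ _ f g)

end Hopf

end PathBasis

/-! ### Powers of a left invariant functional detecting arrows -/

namespace QPath

variable {V : Type*} [Quiver V]

theorem splits_cons_sum {M : Type*} [AddCommMonoid M] {a b c : V} (p : Quiver.Path a b) (e : b ⟶ c)
    (G : (Σ x : V, Quiver.Path a x × Quiver.Path x c) → M)
    (h : ∀ (x : V) (α : Quiver.Path a x) (β : Quiver.Path x c), α.comp β = p.cons e →
      2 ≤ β.length → G ⟨x, α, β⟩ = 0) :
    ((splits (p.cons e)).map G).sum = G ⟨c, p.cons e, .nil⟩ + G ⟨b, p, e.toPath⟩ := by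
  rw [splits, List.map_cons, List.sum_cons, List.map_map,
    splits_sum_eq_single p _ ⟨b, p, .nil⟩ rfl]
  · rfl
  · rintro ⟨x, α, β⟩ hαβ hne
    obtain rfl : α.comp β = p := hαβ
    cases β with
    | nil => exact absurd rfl hne
    | cons β f => exact h x α _ rfl (by simp)

end QPath

namespace PathBasis

variable {K V H : Type*} [Field K] [Quiver V] [Ring H] [HopfAlgebra K H] {B : PathBasis K V H}

theorem conv_mul_vec (f g : WithConv (H →ₗ[K] K)) {a b c d : V} {p : Quiver.Path a b}
    {r : Quiver.Path c d} (hp : (⟨a, b, p⟩ : QPath V) ∈ B.T) (hr : (⟨c, d, r⟩ : QPath V) ∈ B.T) :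
    (f * g) (B.vec ⟨a, b, p⟩ * B.vec ⟨c, d, r⟩) =
      ((QPath.splits p).map fun s => ((QPath.splits r).map fun t =>
        f (B.vec ⟨s.1, b, s.2.2⟩ * B.vec ⟨t.1, d, t.2.2⟩) *
          g (B.vec ⟨a, s.1, s.2.1⟩ * B.vec ⟨c, t.1, t.2.1⟩)).sum).sum := by
  rw [LinearMap.convMul_apply, Bialgebra.comul_mul, B.comul_vec _ hp, B.comul_vec _ hr,
    ← List.sum_map_mul_right, map_list_sum, map_list_sum, List.map_map, List.map_map]
  refine congrArg List.sum (List.map_congr_left fun s _ => ?_)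
  simp only [Function.comp_apply]
  rw [← List.sum_map_mul_left, map_list_sum, map_list_sum, List.map_map, List.map_map]
  refine congrArg List.sum (List.map_congr_left fun t _ => ?_)
  simp only [Function.comp_apply, Algebra.TensorProduct.tmul_mul_tmul]
  rfl

variable (B)

/-- A left invariant functional which vanishes on vertices but not on arrows. -/
structure IsArrowForm (ξ : H →ₗ[K] K) : Prop where
  vert : ∀ v, ξ (B.vert v) = 0
  vert_mul : ∀ v h, ξ (B.vert v * h) = ξ h
  arr_ne_zero : ∀ {v w : V} (e : v ⟶ w), ξ (B.arr e) ≠ 0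

/-- The product of the values of a functional at the arrows of a path. -/
def arrowProd (ξ : H →ₗ[K] K) {a : V} : {b : V} → Quiver.Path a b → K
  | _, .nil => 1
  | _, .cons p e => ξ (B.arr e) * arrowProd ξ p

variable {B}

theorem IsArrowForm.arrowProd_ne_zero {ξ : H →ₗ[K] K} (hξ : B.IsArrowForm ξ) {b c : V}
    (p : Quiver.Path b c) : B.arrowProd ξ p ≠ 0 := by
  induction p with
  | nil => exact one_ne_zero
  | cons p e ih => exact mul_ne_zero (hξ.arr_ne_zero e) ih

variable [Group V] {a : V}

/-- Left translation brings `y` to a skew-primitive element from `1` to `a`, which modulo vertices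
is a multiple of the arrow `e`. A left invariant functional killing vertices is therefore determined
on such elements by its value at `e`. -/
theorem IsSkew.apply_eq_coord_mul (hG : B.IsMulVert)
    (harr : ∀ (a b : V) (e : a ⟶ b), QPath.arrow e ∈ B.T)
    (hV : ∀ (v w w' : V) (e : v ⟶ w) (e' : v ⟶ w'), (⟨w, e⟩ : Σ w, v ⟶ w) = ⟨w', e'⟩)
    (e : 1 ⟶ a) {v : V} {y : H} (hy : B.IsSkew v (v * a) y) {φ : H →ₗ[K] K}
    (hφ : ∀ v, φ (B.vert v) = 0) (hφ' : ∀ v h, φ (B.vert v * h) = φ h) :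
    φ y = B.coord (QPath.arrow e) (B.vert v⁻¹ * y) * φ (B.arr e) := by
  have h := hy.vert_mul hG v⁻¹
  rw [inv_mul_cancel, inv_mul_cancel_left] at h
  have hmem := h.sub_smul_mem hV (harr _ _ e)
  have hker : B.vertSpan ≤ LinearMap.ker φ := Submodule.span_le.2 (by
    rintro _ ⟨v, rfl⟩
    exact hφ v)
  have h0 : φ _ = 0 := hker hmem
  rwa [map_sub, hφ', map_smul, smul_eq_mul, sub_eq_zero] at h0

/-- The functional is the sum over all left translates of the coordinate at `e`, which makes it
invariant. At `e` itself only the trivial translate contributes, since the others are skew-primitive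
with a different source. -/
theorem IsMulVert.exists_isArrowForm [Finite V] (hG : B.IsMulVert)
    (harr : ∀ (a b : V) (e : a ⟶ b), QPath.arrow e ∈ B.T)
    (hV : ∀ (v w w' : V) (e : v ⟶ w) (e' : v ⟶ w'), (⟨w, e⟩ : Σ w, v ⟶ w) = ⟨w', e'⟩)
    (e : 1 ⟶ a) (ha : ∀ {v w : V} (_ : v ⟶ w), w = v * a) : ∃ ξ, B.IsArrowForm ξ := by
  classical
  have := Fintype.ofFinite V
  let ξ : H →ₗ[K] K := ∑ u : V, B.coord (QPath.arrow e) ∘ₗ LinearMap.mulLeft K (B.vert u)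
  have hξ : ∀ h, ξ h = ∑ u : V, B.coord (QPath.arrow e) (B.vert u * h) := fun h => by
    simp only [ξ, LinearMap.sum_apply]
    rfl
  have h1 : ∀ v, ξ (B.vert v) = 0 := fun v => by
    rw [hξ]
    refine Finset.sum_eq_zero fun u _ => ?_
    rw [← hG]
    exact B.coord_vert_of_ne (p := QPath.arrow e) (Nat.succ_ne_zero _) _
  have h2 : ∀ v h, ξ (B.vert v * h) = ξ h := fun v h => by
    rw [hξ, hξ]
    refine Fintype.sum_equiv (Equiv.mulRight v) _ _ fun u => ?_
    rw [Equiv.coe_mulRight, hG, mul_assoc]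
  have h3 : ξ (B.arr e) = 1 := by
    rw [hξ, Finset.sum_eq_single 1]
    · rw [hG.vert_one, one_mul, arr, B.coord_vec _ (harr _ _ e), if_pos rfl]
    · intro u _ hu
      by_contra hne
      have := ((IsSkew.vert_mul hG (B.comul_arr (harr _ _ e)) u).eq_of_coord_ne_zero hne).1
      rw [mul_one] at this
      exact hu this.symm
    · simp
  refine ⟨ξ, h1, h2, fun {v w} f => ?_⟩
  obtain rfl := ha f
  have hf := harr _ _ f
  rw [IsSkew.apply_eq_coord_mul hG harr hV e (B.comul_arr hf) h1 h2, h3, mul_one]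
  intro h0
  have h := IsSkew.vert_mul hG (B.comul_arr hf) v⁻¹
  rw [inv_mul_cancel, inv_mul_cancel_left] at h
  have hmem := h.sub_smul_mem hV (harr _ _ e)
  rw [h0, zero_smul, sub_zero, vert_mul_mem_vertSpan_iff hG] at hmem
  exact arr_notMem_vertSpan hf hmem

/-- Right translation by `u` acts on skew-primitives modulo vertices, which after left translation
form a line spanned by `e`. It thus scales `ξ` by a factor depending only on `u`, and successive
translations multiply these factors. -/
theorem IsArrowForm.exists_char {ξ : H →ₗ[K] K} (hξ : B.IsArrowForm ξ) (hG : B.IsMulVert)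
    (harr : ∀ (a b : V) (e : a ⟶ b), QPath.arrow e ∈ B.T)
    (hV : ∀ (v w w' : V) (e : v ⟶ w) (e' : v ⟶ w'), (⟨w, e⟩ : Σ w, v ⟶ w) = ⟨w', e'⟩)
    (e : 1 ⟶ a) (hcomm : ∀ v, v * a = a * v) (ha : ∀ {v w : V} (_ : v ⟶ w), w = v * a) :
    ∃ χ : V →* K, ∀ {v w : V} (f : v ⟶ w) (u : V),
      ξ (B.arr f * B.vert u) = χ u * ξ (B.arr f) := by
  have key : ∀ {v : V} {y : H}, B.IsSkew v (v * a) y → ∀ u : V,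
      ξ (y * B.vert u) * ξ (B.arr e) = ξ y * ξ (B.arr e * B.vert u) := by
    intro v y hy u
    have h1 := hy.apply_eq_coord_mul hG harr hV e hξ.vert hξ.vert_mul
    have h2 := hy.apply_eq_coord_mul hG harr hV e
      (φ := ξ ∘ₗ LinearMap.mulRight K (B.vert u))
      (fun v => by
        change ξ (B.vert v * B.vert u) = 0
        rw [← hG, hξ.vert])
      (fun v h => by
        change ξ (B.vert v * h * B.vert u) = ξ (h * B.vert u)
        rw [mul_assoc, hξ.vert_mul])
    change ξ (y * B.vert u) = _ * ξ (B.arr e * B.vert u) at h2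
    rw [h1, h2]
    ring
  have he := hξ.arr_ne_zero e
  -- Centrality of `a` is what keeps right translates of `e` in the shape `u ⟶ u * a`, so that `key`
  -- applies to them.
  have hskew : ∀ u, B.IsSkew u (u * a) (B.arr e * B.vert u) := fun u => by
    have := IsSkew.mul_vert hG (B.comul_arr (harr _ _ e)) u
    rwa [one_mul, ← hcomm] at this
  refine ⟨{ toFun := fun u => ξ (B.arr e * B.vert u) / ξ (B.arr e)
            map_one' := ?_
            map_mul' := ?_ }, ?_⟩
  · rw [hG.vert_one, mul_one, div_self he]
  · intro u u'
    have := key (hskew u) u'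
    rw [mul_assoc, ← hG] at this
    field_simp
    linear_combination this
  · intro v w f u
    obtain rfl := ha f
    have := key (B.comul_arr (harr _ _ f)) u
    change _ = ξ (B.arr e * B.vert u) / ξ (B.arr e) * _
    field_simp
    linear_combination this

/-- The `k`-th convolution power distributes the arrows of both paths over `k` legs. With fewer than
`k` arrows some leg is a product of vertices, where `ξ` vanishes. -/
theorem IsArrowForm.pow_apply_eq_zero {ξ : H →ₗ[K] K} (hξ : B.IsArrowForm ξ) (hG : B.IsMulVert)
    (k : ℕ) {b c b' c' : V} (p : Quiver.Path b c) (r : Quiver.Path b' c')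
    (hp : (⟨b, c, p⟩ : QPath V) ∈ B.T) (hr : (⟨b', c', r⟩ : QPath V) ∈ B.T)
    (h : p.length + r.length < k) :
    (toConv ξ ^ k) (B.vec ⟨b, c, p⟩ * B.vec ⟨b', c', r⟩) = 0 := by
  induction k generalizing b c b' c' with
  | zero => omega
  | succ k ih =>
    rw [pow_succ', conv_mul_vec _ _ hp hr]
    refine QPath.splits_sum_eq_zero _ _ ?_
    rintro ⟨x, α, β⟩ hαβ
    obtain rfl : α.comp β = p := hαβ
    refine QPath.splits_sum_eq_zero _ _ ?_
    rintro ⟨y, γ, δ⟩ hγδ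
    obtain rfl : γ.comp δ = r := hγδ
    rw [Quiver.Path.length_comp, Quiver.Path.length_comp] at h
    by_cases h0 : β.length + δ.length = 0
    · obtain ⟨h1, h2⟩ := Nat.add_eq_zero_iff.1 h0
      cases β with
      | cons => exact absurd h1 (Nat.succ_ne_zero _)
      | nil =>
        cases δ with
        | cons => exact absurd h2 (Nat.succ_ne_zero _)
        | nil =>
          change ξ (B.vert c * B.vert c') * _ = 0
          rw [← hG, hξ.vert, zero_mul]
    · dsimp only
      rw [ih α γ (B.comp_mem _ _ hp).1 (B.comp_mem _ _ hr).1 (by omega), mul_zero]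

theorem tgt_eq_mul_pow (ha : ∀ {v w : V} (_ : v ⟶ w), w = v * a) {v w : V}
    (p : Quiver.Path v w) : w = v * a ^ p.length := by
  induction p with
  | nil => simp
  | cons p e ih => exact (ha e).trans (by rw [Quiver.Path.length_cons, pow_succ, ← mul_assoc, ← ih])

/-- With exactly `k` arrows, each leg must receive one arrow, so the surviving terms are the
shuffles of `p` and `r`. An arrow of `r` is multiplied on the left by a vertex, which costs nothing;
an arrow of `p` is multiplied on the right by a vertex `b' * a ^ j`, which costs `χ b' * χ a ^ j`.
Separating shuffles by the origin of the final arrow gives precisely the recursion of `qbin`. -/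
theorem IsArrowForm.pow_apply_mul {ξ : H →ₗ[K] K} (hξ : B.IsArrowForm ξ) (hG : B.IsMulVert)
    (ha : ∀ {v w : V} (_ : v ⟶ w), w = v * a) {χ : V →* K}
    (hχ : ∀ {v w : V} (f : v ⟶ w) (u : V), ξ (B.arr f * B.vert u) = χ u * ξ (B.arr f))
    (k : ℕ) {b c b' c' : V} (p : Quiver.Path b c) (r : Quiver.Path b' c')
    (hp : (⟨b, c, p⟩ : QPath V) ∈ B.T) (hr : (⟨b', c', r⟩ : QPath V) ∈ B.T)
    (h : p.length + r.length = k) :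
    (toConv ξ ^ k) (B.vec ⟨b, c, p⟩ * B.vec ⟨b', c', r⟩) =
      qbin (χ a) p.length r.length *
        (B.arrowProd ξ p * B.arrowProd ξ r * χ b' ^ p.length) := by
  induction k generalizing b c b' c' with
  | zero =>
    obtain ⟨h1, h2⟩ := Nat.add_eq_zero_iff.1 h
    cases p with
    | cons => exact absurd h1 (Nat.succ_ne_zero _)
    | nil =>
      cases r with
      | cons => exact absurd h2 (Nat.succ_ne_zero _)
      | nil =>
        have : (1 : WithConv (H →ₗ[K] K)) (B.vert b * B.vert b') = 1 := by
          rw [← hG]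
          exact (B.isGroupLikeElem_vert _).counit_eq_one
        refine this.trans ?_
        simp [arrowProd]
  | succ k ih =>
    have hvv : ∀ v w : V, ξ (B.vert v * B.vert w) = 0 := fun v w => by rw [← hG, hξ.vert]
    rw [pow_succ', conv_mul_vec _ _ hp hr]
    cases p with
    | nil =>
      cases r with
      | nil => exact absurd h (Nat.succ_ne_zero _).symm
      | cons r e =>
        simp only [QPath.splits.eq_1, List.map_cons, List.map_nil, List.sum_cons, List.sum_nil,
          add_zero]
        have hr' := (B.comp_mem r e.toPath hr).1
        rw [QPath.splits_cons_sum]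
        · change ξ (B.vert b * B.vert _) * _ + ξ (B.vert b * B.arr e) * _ = _
          rw [hvv, zero_mul, zero_add, hξ.vert_mul]
          refine (congrArg _ (ih .nil r hp hr' (by simpa using h))).trans ?_
          simp [arrowProd]
        · intro x α β hαβ hβ
          have hl := congrArg Quiver.Path.length hαβ
          rw [Quiver.Path.length_comp] at hl
          dsimp only
          rw [hξ.pow_apply_eq_zero hG k .nil α hp (B.comp_mem α β (hαβ ▸ hr)).1, mul_zero]
          omega
    | cons p e =>
      have hp' := (B.comp_mem p e.toPath hp).1
      have hlen : ∀ (y : V) (γ : Quiver.Path b' y) (δ : Quiver.Path y c'), γ.comp δ = r →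
          γ.length + δ.length = r.length := by
        rintro y γ δ rfl
        rw [Quiver.Path.length_comp]
      have hlast : ∀ G : (Σ x : V, Quiver.Path b' x × Quiver.Path x c') → K,
          (∀ (y : V) (γ : Quiver.Path b' y) (δ : Quiver.Path y c'), γ.comp δ = r →
            0 < δ.length → G ⟨y, γ, δ⟩ = 0) →
          ((QPath.splits r).map G).sum = G ⟨c', r, .nil⟩ := by
        intro G hG'
        refine QPath.splits_sum_eq_single r G ⟨c', r, .nil⟩ rfl ?_
        rintro ⟨y, γ, δ⟩ hγδ hne
        refine hG' y γ δ hγδ (Nat.pos_of_ne_zero fun h0 => hne ?_)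
        cases δ with
        | nil =>
          obtain rfl : γ = r := hγδ
          rfl
        | cons => exact absurd h0 (Nat.succ_ne_zero _)
      rw [QPath.splits_cons_sum]
      · rw [Quiver.Path.length_cons] at h
        have hsnd := hlast (fun t => (toConv ξ) (B.vec ⟨_, _, e.toPath⟩ *
            B.vec ⟨t.1, c', t.2.2⟩) * (toConv ξ ^ k) (B.vec ⟨b, _, p⟩ * B.vec ⟨b', t.1, t.2.1⟩)) (by
          intro y γ δ hγδ hδ
          have := hlen y γ δ hγδ
          dsimp only
          rw [hξ.pow_apply_eq_zero hG k p γ hp' (B.comp_mem γ δ (hγδ ▸ hr)).1 (by omega),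
            mul_zero])
        refine (congrArg₂ (· + ·) rfl hsnd).trans ?_
        dsimp only
        -- The term in which the final arrow comes from `p`: all of `r` has been traversed, so the
        -- vertex on the right is `c' = b' * a ^ r.length`, which supplies the power of `χ a` in the
        -- Pascal recursion.
        have h2 : (toConv ξ) (B.vec ⟨_, _, e.toPath⟩ * B.vec ⟨c', c', .nil⟩) =
          χ c' * ξ (B.arr e) := hχ e c'
        rw [h2, ih p r hp' hr (by omega), show χ c' = χ (b' * a ^ r.length) from
          congrArg χ (tgt_eq_mul_pow ha r)]
        cases r with
        | nil =>
          simp only [QPath.splits.eq_1, List.map_cons, List.map_nil, List.sum_cons, List.sum_nil,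
            add_zero]
          change ξ (B.vert c * B.vert b') * _ + _ = _
          rw [hvv]
          simp [arrowProd]
          ring
        | cons r f =>
          have hr' := (B.comp_mem r f.toPath hr).1
          rw [QPath.splits_cons_sum]
          · change ξ (B.vert c * B.vert _) * _ + ξ (B.vert c * B.arr f) *
              (toConv ξ ^ k) (B.vec ⟨b, c, p.cons e⟩ * B.vec ⟨b', _, r⟩) + _ = _
            rw [hvv, zero_mul, zero_add, hξ.vert_mul,
              ih (p.cons e) r hp hr' (by simp at h ⊢; omega)]
            simp only [Quiver.Path.length_cons, arrowProd, qbin_succ_succ, map_mul, map_pow]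
            ring
          · intro y γ δ hγδ hδ
            have := hlen y γ δ hγδ
            dsimp only
            rw [hξ.pow_apply_eq_zero hG k (p.cons e) γ hp (B.comp_mem γ δ (hγδ ▸ hr)).1
              (by rw [Quiver.Path.length_cons]; omega), mul_zero]
      · intro x α β hαβ hβ
        have hl := congrArg Quiver.Path.length hαβ
        rw [Quiver.Path.length_comp] at hl
        refine QPath.splits_sum_eq_zero _ _ ?_
        rintro ⟨y, γ, δ⟩ hγδ
        have hl' := hlen y γ δ hγδ
        dsimp only
        rw [hξ.pow_apply_eq_zero hG k α γ (B.comp_mem α β (hαβ ▸ hp)).1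
          (B.comp_mem γ δ (hγδ ▸ hr)).1 (by omega), mul_zero]

end PathBasis

/-! ### Monomial coalgebras underlying Hopf algebras -/

namespace PathBasis

variable {K V H : Type*} [Field K] [Quiver V] [Ring H] [HopfAlgebra K H] {B : PathBasis K V H}
  {ξ : H →ₗ[K] K}

/-- A vertex is group-like, hence multiplies every leg of the iterated coproduct; `ξ` absorbs it in
the first `k` legs and only `f` feels it. -/
theorem IsArrowForm.pow_vert_mul (hξ : B.IsArrowForm ξ) (k : ℕ) (f : WithConv (H →ₗ[K] K)) (u : V)
    (h : H) : (toConv ξ ^ k * f) (B.vert u * h) =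
      (toConv ξ ^ k * toConv (f.ofConv ∘ₗ LinearMap.mulLeft K (B.vert u))) h := by
  induction k generalizing h with
  | zero =>
    rw [pow_zero, one_mul, one_mul]
    rfl
  | succ k ih =>
    rw [pow_succ', mul_assoc, mul_assoc, LinearMap.convMul_apply, Bialgebra.comul_mul,
      (B.isGroupLikeElem_vert u).comul_eq_tmul_self, LinearMap.convMul_apply]
    induction comul (R := K) h using TensorProduct.induction_on with
    | zero => simp
    | add x y hx hy => rw [mul_add, map_add, map_add, hx, hy, map_add, map_add]
    | tmul x y =>
      rw [Algebra.TensorProduct.tmul_mul_tmul]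
      change ξ (B.vert u * x) * (toConv ξ ^ k * f) (B.vert u * y) =
        ξ x * (toConv ξ ^ k * toConv (f.ofConv ∘ₗ LinearMap.mulLeft K (B.vert u))) y
      rw [hξ.vert_mul, ih]

variable [Group V] {a : V}

theorem IsArrowForm.pow_vec_eq_zero (hξ : B.IsArrowForm ξ) (hG : B.IsMulVert) {k : ℕ}
    {p : QPath V} (hp : p ∈ B.T) (h : p.length < k) : (toConv ξ ^ k) (B.vec p) = 0 := by
  have := hξ.pow_apply_eq_zero hG k p.path (.nil : Quiver.Path (1 : V) 1) hp (B.vertex_mem 1) h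
  rwa [show B.vec ⟨(1 : V), 1, .nil⟩ = 1 from hG.vert_one, mul_one] at this

theorem IsArrowForm.pow_vec (hξ : B.IsArrowForm ξ) (hG : B.IsMulVert)
    (ha : ∀ {v w : V} (_ : v ⟶ w), w = v * a) {χ : V →* K}
    (hχ : ∀ {v w : V} (f : v ⟶ w) (u : V), ξ (B.arr f * B.vert u) = χ u * ξ (B.arr f))
    {p : QPath V} (hp : p ∈ B.T) :
    (toConv ξ ^ p.length) (B.vec p) = B.arrowProd ξ p.path := by
  have := hξ.pow_apply_mul hG ha hχ p.length p.path (.nil : Quiver.Path (1 : V) 1) hp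
    (B.vertex_mem 1) rfl
  rw [show B.vec ⟨(1 : V), 1, .nil⟩ = 1 from hG.vert_one, mul_one] at this
  refine this.trans ?_
  simp [arrowProd]

/-- Translating a path by a vertex does not decrease the lengths of paths in `T`. -/
theorem IsArrowForm.exists_path (hξ : B.IsArrowForm ξ) (hG : B.IsMulVert)
    (ha : ∀ {v w : V} (_ : v ⟶ w), w = v * a) {χ : V →* K}
    (hχ : ∀ {v w : V} (f : v ⟶ w) (u : V), ξ (B.arr f * B.vert u) = χ u * ξ (B.arr f))
    {p : QPath V} (hp : p ∈ B.T) (u : V) :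
    ∃ q ∈ B.T, q.src = u ∧ p.length ≤ q.length := by
  classical
  by_contra! hno
  -- On a basis path, the coordinate at `u` selects the factorisation with trivial initial part at
  -- `u`. By assumption the rest is shorter than `p`, so the power of `ξ` kills it.
  have hzero : toConv ξ ^ p.length * toConv (B.coord (QPath.vertex u)) = 0 := by
    refine WithConv.ext (B.ext_vec fun q hq => ?_)
    refine (B.conv_vec _ _ hq).trans ?_
    refine QPath.splits_sum_eq_zero _ _ ?_
    rintro ⟨x, α, β⟩ hαβ
    obtain ⟨b, c, q⟩ := q
    change Quiver.Path b x at α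
    change Quiver.Path x c at β
    obtain rfl : α.comp β = q := hαβ
    have hmem := B.comp_mem α β hq
    change (toConv ξ ^ p.length) (B.vec ⟨x, c, β⟩) * B.coord _ (B.vec ⟨b, x, α⟩) = 0
    rw [B.coord_vec _ hmem.1]
    split_ifs with h
    · have hlt := hno _ hq (congrArg QPath.src h).symm
      change (α.comp β).length < p.length at hlt
      rw [Quiver.Path.length_comp] at hlt
      rw [hξ.pow_vec_eq_zero hG hmem.2 (lt_of_le_of_lt (Nat.le_add_left _ _) hlt), zero_mul]
    · rw [mul_zero]
  -- Evaluated at the left translate of `p` by `u * p.src⁻¹`, the same functional equals the product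
  -- of the values of `ξ` along `p`, which is not zero.
  have h := hξ.pow_vert_mul p.length (toConv (B.coord (QPath.vertex u))) (u * p.src⁻¹) (B.vec p)
  rw [hzero] at h
  refine hξ.arrowProd_ne_zero p.path ?_
  rw [← hξ.pow_vec hG ha hχ hp]
  refine Eq.trans ?_ h.symm
  rw [B.conv_vec _ _ hp, QPath.splits_sum_eq_single p.path _ ⟨p.src, .nil, p.path⟩ (by simp)]
  · change _ = (toConv ξ ^ p.length) (B.vec p) *
      B.coord (QPath.vertex u) (B.vert (u * p.src⁻¹) * B.vert p.src)
    rw [← hG, inv_mul_cancel_right, coord_vert, if_pos rfl, mul_one]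
  · obtain ⟨b, c, p⟩ := p
    rintro ⟨x, (α : Quiver.Path b x), (β : Quiver.Path x c)⟩ hαβ hne
    obtain rfl : α.comp β = p := hαβ
    dsimp only
    rw [hξ.pow_vec_eq_zero hG (B.comp_mem _ _ hp).2, zero_mul]
    cases α with
    | nil => exact absurd (by simp) hne
    | cons α e =>
      change β.length < ((α.cons e).comp β).length
      rw [Quiver.Path.length_comp, Quiver.Path.length_cons]
      omega

/-- `T` is the set of all paths of length less than some `d ≥ 2`. -/
theorem IsArrowForm.exists_mem_T_iff [Finite V] (hξ : B.IsArrowForm ξ) (hG : B.IsMulVert)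
    (hT : B.T.Finite) (harr : ∀ (a b : V) (e : a ⟶ b), QPath.arrow e ∈ B.T)
    (hV : ∀ (v w w' : V) (e : v ⟶ w) (e' : v ⟶ w'), (⟨w, e⟩ : Σ w, v ⟶ w) = ⟨w', e'⟩)
    (ha : ∀ {v w : V} (_ : v ⟶ w), w = v * a) (f : ∀ v : V, v ⟶ v * a) {χ : V →* K}
    (hχ : ∀ {v w : V} (f : v ⟶ w) (u : V), ξ (B.arr f * B.vert u) = χ u * ξ (B.arr f)) :
    ∃ d, 2 ≤ d ∧ ∀ p, p ∈ B.T ↔ p.length < d := by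
  obtain ⟨M, hM, hmax⟩ := Set.exists_max_image B.T QPath.length hT ⟨_, B.vertex_mem 1⟩
  refine ⟨M.length + 1, Nat.succ_le_succ (hmax _ (harr _ _ (f 1))), fun p => ⟨fun hp =>
    Nat.lt_succ_of_le (hmax p hp), fun hp => ?_⟩⟩
  -- Some path of `T` from the source of `p` is at least as long as the longest path `M`. Extending
  -- `p` to that length gives the same path by uniqueness, so `p` is an initial part of it.
  obtain ⟨q, hq, hsrc, hlen⟩ := hξ.exists_path hG ha hχ hM p.src
  have hext : ∀ k, p.length ≤ k →
      ∃ (c : V) (β : Quiver.Path p.tgt c), (p.path.comp β).length = k := by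
    intro k hk
    induction k, hk using Nat.le_induction with
    | base => exact ⟨_, .nil, rfl⟩
    | succ k _ ih =>
      obtain ⟨c, β, rfl⟩ := ih
      exact ⟨_, β.cons (f c), rfl⟩
  obtain ⟨c, β, hβ⟩ := hext q.length ((Nat.le_of_lt_succ hp).trans hlen)
  obtain rfl : (⟨p.src, c, p.path.comp β⟩ : QPath V) = q := QPath.ext_of_length hV hsrc.symm hβ
  exact (B.comp_mem _ _ hq).1

/-- All basis paths are shorter than `d`, so `ξ ^ d = 0`. On a product of two paths from `1` of
positive lengths `i + j = d`, both in `T`, this power is `qbin (χ a) i j` times nonzero values of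
`ξ`. -/
theorem IsArrowForm.isPrimitiveRoot [CharZero K] (hξ : B.IsArrowForm ξ) (hG : B.IsMulVert)
    (ha : ∀ {v w : V} (_ : v ⟶ w), w = v * a) (f : ∀ v : V, v ⟶ v * a) {χ : V →* K}
    (hχ : ∀ {v w : V} (f : v ⟶ w) (u : V), ξ (B.arr f * B.vert u) = χ u * ξ (B.arr f))
    {d : ℕ} (hd : 2 ≤ d) (hTd : ∀ p, p ∈ B.T ↔ p.length < d) : IsPrimitiveRoot (χ a) d := by
  have hzero : toConv ξ ^ d = 0 := WithConv.ext (B.ext_vec fun p hp =>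
    hξ.pow_vec_eq_zero hG hp ((hTd p).1 hp))
  have hex : ∀ k, ∃ (c : V) (p : Quiver.Path 1 c), p.length = k := by
    intro k
    induction k with
    | zero => exact ⟨_, .nil, rfl⟩
    | succ k ih =>
      obtain ⟨c, p, rfl⟩ := ih
      exact ⟨_, p.cons (f c), rfl⟩
  refine isPrimitiveRoot_of_qbin_eq_zero hd fun i j hi hj hij => ?_
  obtain ⟨c, p, rfl⟩ := hex i
  obtain ⟨c', r, rfl⟩ := hex j
  have hp : (⟨1, c, p⟩ : QPath V) ∈ B.T := (hTd _).2 (show p.length < d by omega)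
  have hr : (⟨1, c', r⟩ : QPath V) ∈ B.T := (hTd _).2 (show r.length < d by omega)
  have h := hξ.pow_apply_mul hG ha hχ d p r hp hr hij
  rw [hzero, map_one, one_pow, mul_one] at h
  exact (mul_eq_zero.1 h.symm).resolve_right
    (mul_ne_zero (hξ.arrowProd_ne_zero p) (hξ.arrowProd_ne_zero r))

/-- The quiver is a disjoint union of basic cycles, one for each coset of `⟨a⟩`. -/
theorem exists_prefunctors {V : Type*} [Quiver V] [Group V] [Fintype V] {a : V}
    (f : ∀ v : V, v ⟶ v * a) : ∃ (m : ℕ) (_ : 0 < m) (F : Fin m → (BasicCycle (orderOf a) ⥤q V)),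
      Function.Bijective fun x : Fin m × BasicCycle (orderOf a) => (F x.1).obj x.2 := by
  classical
  have hn : NeZero (orderOf a) := ⟨(orderOf_pos a).ne'⟩
  let Q := V ⧸ Subgroup.zpowers a
  have : Nonempty Q := ⟨(1 : V)⟩
  have hpow : ∀ i : ZMod (orderOf a), a ^ (i + 1).val = a ^ i.val * a := fun i => by
    rw [← pow_succ, pow_inj_mod, ZMod.val_add, Nat.mod_mod, ZMod.val_one_eq_one_mod,
      Nat.add_mod_mod]
  let e : Fin (Fintype.card Q) ≃ Q := (Fintype.equivFin Q).symm
  -- The `j`-th cycle runs through the powers of `a` starting from a chosen representative of the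
  -- `j`-th left coset of `⟨a⟩`.
  refine ⟨Fintype.card Q, Fintype.card_pos, fun j =>
    { obj := fun i => (e j).out * a ^ i.idx.val
      map := fun {i i'} h => by
        rw [BasicCycle.idx_of_hom h, hpow, ← mul_assoc]
        exact f _ }, ?_, ?_⟩
  · rintro ⟨j, i⟩ ⟨j', i'⟩ h
    replace h : (e j).out * a ^ i.idx.val = (e j').out * a ^ i'.idx.val := h
    have hj : j = j' := by
      have := congrArg (QuotientGroup.mk : V → Q) h
      rw [QuotientGroup.mk_mul_of_mem _ (Subgroup.npow_mem_zpowers a _),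
        QuotientGroup.mk_mul_of_mem _ (Subgroup.npow_mem_zpowers a _), QuotientGroup.out_eq',
        QuotientGroup.out_eq'] at this
      exact e.injective this
    subst hj
    rw [mul_right_inj, pow_inj_mod, Nat.mod_eq_of_lt (ZMod.val_lt _),
      Nat.mod_eq_of_lt (ZMod.val_lt _)] at h
    rw [BasicCycle.idx_injective (ZMod.val_injective _ h)]
  · intro v
    have hv : (Quotient.out (v : Q))⁻¹ * v ∈ Subgroup.zpowers a := by
      rw [← QuotientGroup.eq, QuotientGroup.out_eq']
    obtain ⟨k, hk, hkv⟩ := Finset.mem_image.1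
      ((mem_zpowers_iff_mem_range_orderOf).1 hv)
    refine ⟨⟨e.symm (v : Q), .ofIdx (k : ZMod (orderOf a))⟩, ?_⟩
    change (e (e.symm (v : Q))).out * a ^ (k : ZMod (orderOf a)).val = v
    rw [Equiv.apply_symm_apply, ZMod.val_natCast, pow_mod_orderOf]
    change a ^ k = _ at hkv
    rw [hkv, mul_inv_cancel_left]

/-- The coalgebra structure of a Hopf algebra with a basis of paths. -/
theorem nonempty_coalgEquiv {K V H : Type*} [Field K] [CharZero K] [Quiver V] [Fintype V] [Ring H]
    [HopfAlgebra K H] (B : PathBasis K V H) (hT : B.T.Finite)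
    (harr : ∀ (a b : V) (e : a ⟶ b), QPath.arrow e ∈ B.T) :
    (∃ m : ℕ, 0 < m ∧ Nonempty (H ≃ₗc[K] (Fin m → K))) ∨
      (∃ (n : ℕ) (_ : NeZero n) (d m : ℕ), 2 ≤ d ∧ d ∣ n ∧ 0 < m ∧
        Nonempty (H ≃ₗc[K] (Fin m → CycleCoalgebra K n d))) := by
  obtain ⟨_, hG⟩ := B.exists_isMulVert hT
  have : Finite B.T := hT.to_subtype
  have : FiniteDimensional K H := Module.Finite.of_basis B.basis
  have hV := hG.sigma_hom_ext hT harr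
  by_cases hempty : ∀ s t : V, IsEmpty (s ⟶ t)
  · refine .inl ⟨Fintype.card V, Fintype.card_pos, B.nonempty_coalgEquiv_pi fun p _ => ?_⟩
    obtain ⟨b, c, p⟩ := p
    cases p with
    | nil => rfl
    | cons p e => exact ((hempty _ _).false e).elim
  · right
    push Not at hempty
    obtain ⟨s, t, ⟨e⟩⟩ := hempty
    obtain ⟨a, hcomm, hf⟩ := hG.exists_central harr hV e
    obtain ⟨f⟩ : Nonempty (∀ v : V, v ⟶ v * a) := ⟨fun v => (hf v).some⟩
    have ha : ∀ {v w : V} (_ : v ⟶ w), w = v * a := fun {v w} e =>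
      congrArg Sigma.fst (hV _ _ _ e (f v))
    obtain ⟨g⟩ : Nonempty ((1 : V) ⟶ a) := by
      have := hf 1
      rwa [one_mul] at this
    obtain ⟨ξ, hξ⟩ := hG.exists_isArrowForm harr hV g ha
    obtain ⟨χ, hχ⟩ := hξ.exists_char hG harr hV g hcomm ha
    obtain ⟨d, hd, hTd⟩ := hξ.exists_mem_T_iff hG hT harr hV ha f hχ
    have hprim := hξ.isPrimitiveRoot hG ha f hχ hd hTd
    obtain ⟨m, hm, F, hF⟩ := exists_prefunctors f
    refine ⟨orderOf a, ⟨(orderOf_pos a).ne'⟩, d, m, hd, ?_, hm,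
      B.nonempty_coalgEquiv_cycle (by omega) F hF hV hTd⟩
    -- The character `χ` sends `a` to an element whose power of exponent `orderOf a` is `1`, which
    -- forces `d ∣ orderOf a`.
    refine hprim.dvd_of_pow_eq_one _ ?_
    rw [← map_pow, pow_orderOf_eq_one, map_one]

end PathBasis

/-! ### The classification -/

theorem coalgebraAdmitsHopf_of_convEquiv {K : Type u} {A : Type*} {C : Type v} [Field K] [Ring A]
    [algA : Algebra K A] [AddCommGroup C] [Module K C] [Coalgebra K C] [FiniteDimensional K C]
    (h : Algebra.AdmitsHopf K A) (θ : A ≃ₐ[K] WithConv (C →ₗ[K] K)) : Coalgebra.AdmitsHopf K C := by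
  obtain ⟨_, rfl⟩ := h
  exact admitsHopf_of_convEquiv θ

/-- The convolution algebra of `C_d(n) ⊕ ⋯ ⊕ C_d(n)`. -/
def piCycleAlgebraEquivConv (K : Type*) [Field K] (n m : ℕ) [NeZero n] {d : ℕ} (hd : 0 < d) :
    (Fin m → CycleAlgebra K n d) ≃ₐ[K] WithConv ((Fin m → CycleCoalgebra K n d) →ₗ[K] K) :=
  (AlgEquiv.piCongrRight fun _ => cycleAlgebraEquivConv K n hd).trans
    (convPi fun _ : Fin m => CycleCoalgebra K n d).symm

/-- In one direction the path basis is carried over to the Hopf algebra and its structure analysed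
there. In the other, the algebra dual to the listed coalgebra has an explicit Hopf structure, which
is transposed back; only here are the roots of unity of `K` needed. -/
theorem coalgebraAdmitsHopf_iff {K : Type*} [Field K] [CharZero K]
    (hK : ∀ n : ℕ, 0 < n → ∃ ζ : K, IsPrimitiveRoot ζ n) {C : Type*} [AddCommGroup C] [Module K C]
    [Coalgebra K C] (hC : IsMonomialCoalgebra K C) :
    Coalgebra.AdmitsHopf K C ↔
      (∃ m : ℕ, 0 < m ∧ Nonempty (C ≃ₗc[K] (Fin m → K))) ∨
      (∃ (n : ℕ) (_ : NeZero n) (d m : ℕ), 2 ≤ d ∧ d ∣ n ∧ 0 < m ∧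
        Nonempty (C ≃ₗc[K] (Fin m → CycleCoalgebra K n d))) := by
  obtain ⟨V, _, _, B, hT, harr⟩ := hC.exists_pathBasis
  have : Finite B.T := hT.to_subtype
  have : FiniteDimensional K C := Module.Finite.of_basis B.basis
  constructor
  · rintro ⟨H, _, _, ⟨e⟩⟩
    obtain ⟨m, hm, ⟨f⟩⟩ | ⟨n, hn, d, m, hd, hdn, hm, ⟨f⟩⟩ :=
      (B.map e).nonempty_coalgEquiv hT harr
    · exact .inl ⟨m, hm, ⟨e.trans f⟩⟩
    · exact .inr ⟨n, hn, d, m, hd, hdn, hm, ⟨e.trans f⟩⟩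
  · rintro (⟨m, hm, ⟨e⟩⟩ | ⟨n, hn, d, m, hd, hdn, hm, ⟨e⟩⟩)
    · exact coalgebraAdmitsHopf_of_convEquiv (admitsHopf_pi K hm)
        ((convPiSelf m).symm.trans (convCongr e))
    · have hd0 : 0 < d := by omega
      obtain ⟨q, hq⟩ := hK d hd0
      exact coalgebraAdmitsHopf_of_convEquiv (admitsHopf_pi_cycleAlgebra hm hd0 hdn hq)
        ((piCycleAlgebraEquivConv K n m hd0).trans (convCongr e))

/-- A Hopf structure on `A` transposes to the coalgebra `C` of which `A` is the convolution algebra;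
the classification of `C` dualises back, since convolution algebras take direct sums of coalgebras
to products. -/
theorem algebraAdmitsHopf_iff {K : Type*} [Field K] [CharZero K]
    (hK : ∀ n : ℕ, 0 < n → ∃ ζ : K, IsPrimitiveRoot ζ n) {A : Type*} [Ring A] [Algebra K A]
    (hA : IsMonomialAlgebra K A) :
    Algebra.AdmitsHopf K A ↔
      (∃ m : ℕ, 0 < m ∧ Nonempty (A ≃ₐ[K] (Fin m → K))) ∨
      (∃ (n : ℕ) (_ : NeZero n) (d m : ℕ), 2 ≤ d ∧ d ∣ n ∧ 0 < m ∧
        Nonempty (A ≃ₐ[K] (Fin m → CycleAlgebra K n d))) := by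
  obtain ⟨C, _, _, _, _, hC, ⟨θ⟩⟩ := hA.exists_coalgebra
  constructor
  · intro h
    obtain ⟨m, hm, ⟨f⟩⟩ | ⟨n, hn, d, m, hd, hdn, hm, ⟨f⟩⟩ :=
      (coalgebraAdmitsHopf_iff hK hC).1 (coalgebraAdmitsHopf_of_convEquiv h θ)
    · exact .inl ⟨m, hm, ⟨(θ.trans (convCongr f).symm).trans (convPiSelf m)⟩⟩
    · have hd0 : 0 < d := by omega
      exact .inr ⟨n, hn, d, m, hd, hdn, hm,
        ⟨(θ.trans (convCongr f).symm).trans (piCycleAlgebraEquivConv K n m hd0).symm⟩⟩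
  · rintro (⟨m, hm, ⟨e⟩⟩ | ⟨n, hn, d, m, hd, hdn, hm, ⟨e⟩⟩)
    · exact algebraAdmitsHopf_of_algEquiv (admitsHopf_pi K hm) e
    · have hd0 : 0 < d := by omega
      obtain ⟨q, hq⟩ := hK d hd0
      exact algebraAdmitsHopf_of_algEquiv (admitsHopf_pi_cycleAlgebra hm hd0 hdn hq) e

end

theorem theorem5p1 {K : Type*} [Field K] [CharZero K]
    (hK : ∀ n : ℕ, 0 < n → ∃ ζ : K, IsPrimitiveRoot ζ n) :
    (∀ (A : Type*) [Ring A] [Algebra K A], IsMonomialAlgebra K A →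
      (Algebra.AdmitsHopf K A ↔
        (∃ m : ℕ, 0 < m ∧ Nonempty (A ≃ₐ[K] (Fin m → K))) ∨
        (∃ (n : ℕ) (_ : NeZero n) (d m : ℕ), 2 ≤ d ∧ d ∣ n ∧ 0 < m ∧
          Nonempty (A ≃ₐ[K] (Fin m → CycleAlgebra K n d))))) ∧
    (∀ (C : Type*) [AddCommGroup C] [Module K C] [Coalgebra K C], IsMonomialCoalgebra K C →
      (Coalgebra.AdmitsHopf K C ↔
        (∃ m : ℕ, 0 < m ∧ Nonempty (C ≃ₗc[K] (Fin m → K))) ∨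
        (∃ (n : ℕ) (_ : NeZero n) (d m : ℕ), 2 ≤ d ∧ d ∣ n ∧ 0 < m ∧
          Nonempty (C ≃ₗc[K] (Fin m → CycleCoalgebra K n d))))) := by
  exact ⟨fun A _ _ hA => algebraAdmitsHopf_iff hK hA,
    fun C _ _ _ hC => coalgebraAdmitsHopf_iff hK hC⟩
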